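/- **Setting.** Let $\Omega\in\mathbb R^{p\times p}$ be positive definite and let $X\in\mathbb R^{n\times p}$ have i.i.d. rows from $\mathcal N_p(0,\Omega^{-1})$, with $n\ge 4p$. Let $G=([p],E)$ be the associated undirected graph: $(i,j)\in E$ iff $i\ne j$ and the coordinates $i$ and $j$ are conditionally dependent given all other coordinates. Edges are undirected: $(i,j)$ and $(j,i)$ count once. Let $q\in[0,1]$ and $\delta\in\{0,1\}$. Write $X^{(i)}$ for the $i$-th column of $X$ and $X^{(-i)}$ for $X$ without its $i$-th column. **Knockoffs.** For a design $D$ of full column rank with at least twice as many rows as columns, a strategy $\mathcal O\in\{\mathcal O_{\rm equi},\mathcal O_{\rm sdp}\}$ yields $\widetilde D=D\,(I-(D^TD)^{-1}\mathrm{diag}\{s\})+\widetilde U C$, where $\widetilde U$ has orthonormal columns orthogonal to those of $D$ and $C^TC=2\,\mathrm{diag}\{s\}-\mathrm{diag}\{s\}(D^TD)^{-1}\mathrm{diag}\{s\}$. For $\mathcal O_{\rm equi}$, $s_j=\min(2\lambda_{\min}(D^TD),1)$ for all $j$; for $\mathcal O_{\rm sdp}$, $s$ minimizes $\sum_j(1-s_j)$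 subject to $\mathrm{diag}\{s\}\preceq 2D^TD$ and $0\le s_j\le 1$. The construction is applied either to the design as it is or to the design with columns rescaled to unit length (the knockoffs being scaled back). The choices of $s,\widetilde U,C$ depend measurably on $D$ only. **Feature statistics.** A procedure $\mathcal P$ maps a full-column-rank design $D$, a knockoff matrix $\widetilde D$ of $D$ (that is, $\widetilde D^T\widetilde D=D^TD$ and $D^T\widetilde D=D^TD-\mathrm{diag}\{s\}$ for some $s\ge 0$) and a response $y$ to a vector of statistics. It is assumed to satisfy sufficiency (the vector is a measurable function of $[D\ \widetilde D]^T[D\ \widetilde D]$ and $[D\ \widetilde D]^Ty$) and antisymmetry (swapping the columns of some variables with those of their knockoffs changes the sign of exactly the statistics of these variables). With the design $X^{(-i)}$ and the response $X^{(i)}$ for each $i$, this gives $W=(W^{(i)}_j)_{i,j\in[p]}$, with $W^{(i)}_i=0$. **Thresholds and edges.** For a threshold vector $T\in(0,\infty]^p$ let $\widehat V_i^{+}(T_i)=\{j:W_j^{(i)}\ge T_i\}$ and $\widehat V_i^-(T_i)=\{j:W_j^{(i)}\le -T_i\}$. With a rule $\mathcal R\in\{\mathcal R_{\rm AND},\mathcal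 R_{\rm OR}\}$, $\widehat E(T)$ consists of the pairs $i\neq j$ with $i\in\widehat V_j^+(T_j)$ and (AND), respectively or (OR), $j\in\widehat V_i^+(T_i)$. For a pair $(a,c_a)$, $T$ is feasible if for all $i$ $$\frac{a\delta+|\widehat V_i^-(T_i)|}{|\widehat E(T)|\vee 1}\le \kappa,\qquad T_i\in\big(\{|W^{(i)}_j|:j\in[p]\}\cup\{+\infty\}\big)\setminus\{0\},$$ with $\kappa=2q/(c_ap)$ for AND and $\kappa=q/(c_ap)$ for OR. Let $m_{\max}=\lfloor q(p-1)/c_a-a\delta\rfloor$ for AND and $m_{\max}=\lfloor q(p-1)/(2c_a)-a\delta\rfloor$ for OR. The threshold vector $\widehat T$ is the first feasible vector among those obtained for $m=m_{\max},m_{\max}-1,\dots,0$ by taking, for each $i$, the least admissible $T_i$ with $|\widehat V_i^-(T_i)|\le m$; if there is none (in particular if $m_{\max}<0$), $\widehat T=(+\infty,\dots,+\infty)$. The estimated edge set is $\widehat E=\widehat E(\widehat T)$. The *GGM knockoff filter* applied to a data matrix with hyperparameters $((a,c_a),\mathcal O,\mathcal P,\mathcal R)$ computes $W$ with the knockoffs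 $\widetilde X^{(-i)}$ constructed from $X^{(-i)}$ by $\mathcal O$, and then $\widehat E$. **Sample-splitting-recycling.** Let $\boldsymbol A\subseteq\{(1,1.93),(0.01,102)\}$, $\boldsymbol{\mathcal O}\subseteq\{\mathcal O_{\rm equi},\mathcal O_{\rm sdp}\}$ and $\boldsymbol{\mathcal R}\subseteq\{\mathcal R_{\rm AND},\mathcal R_{\rm OR}\}$ be non-empty, and let $\boldsymbol{\mathcal P}$ be a non-empty finite set of procedures as above. 1. Split the rows of $X$ at random, independently of $X$, into $X_1$ with $\lfloor n/2\rfloor$ rows and $X_2$ with the remaining rows. 2. Run the GGM knockoff filter on $X_1$ (with the given $q,\delta$) for all combinations in $\boldsymbol A\times\boldsymbol{\mathcal O}\times\boldsymbol{\mathcal P}\times\boldsymbol{\mathcal R}$, and choose a combination $((a,c_a),\mathcal O,\mathcal P,\mathcal R)$ with the largest number of discoveries; ties may be broken at random, independently of $X$. 3. Compute $W$ by $\mathcal P$ from all samples $X^{\rm re}=\binom{X_1}{X_2}$ with the recycled knockoffs $\binom{X_1^{(-i)}}{\widetilde X_2^{(-i)}}$, where $\widetilde X_2^{(-i)}$ is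 constructed from $X_2^{(-i)}$ by $\mathcal O$. 4. Compute $\widehat E$ from this $W$ with $q,\delta,(a,c_a),\mathcal R$ as above, and let $\widehat F=\widehat E\setminus E$. **Theorem.** With $\delta=1$ the procedure satisfies $$\mathrm{FDR}=\mathbb E\left[\frac{|\widehat F|}{|\widehat E|\vee 1}\right]\le q,$$ and with $\delta=0$ it satisfies $$\mathrm{mFDR}^{\rm re}=\mathbb E\left[\frac{|\widehat F|}{|\widehat E|+a c_a p/\big(q\,\mathbb 1_{\{\mathcal R_{\rm AND}\text{ is chosen}\}}+q\big)}\right]\le q,$$ where for $q=0$ the term $a c_a p/0$ is read as $+\infty$ (so that $\mathrm{mFDR}^{\rm re}=0$). -/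

import Mathlib

open MeasureTheory ProbabilityTheory
open scoped ENNReal

namespace GGMKnockoff

/-- Matrices over a measurable space carry the entrywise (product) sigma-algebra. -/
instance instMeasurableSpaceMatrix {m n : Type*} : MeasurableSpace (Matrix m n ℝ) :=
  inferInstanceAs (MeasurableSpace (m → n → ℝ))

/-- The nodes other than `i`: the predictors in the node-wise regression with response `i`. -/
abbrev Others {p : ℕ} (i : Fin p) : Type := {j : Fin p // j ≠ i}

/-! ### The Gaussian graphical model -/

/-- `(i, j)` is an edge of the graph of the centred Gaussian vector with precision matrix `Om`:
`i ≠ j`, and the coordinates `i` and `j` are conditionally dependent given all the others. -/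
def IsEdge {p : ℕ} (Om : Matrix (Fin p) (Fin p) ℝ) (i j : Fin p) : Prop :=
  i ≠ j ∧
    ¬ CondIndepFun
        (MeasurableSpace.comap
          (fun (x : EuclideanSpace ℝ (Fin p)) (k : {k : Fin p // k ≠ i ∧ k ≠ j}) => x k.1)
          inferInstance)
        (Measurable.comap_le (by fun_prop))
        (fun x : EuclideanSpace ℝ (Fin p) => x i)
        (fun x : EuclideanSpace ℝ (Fin p) => x j)
        (multivariateGaussian 0 Om⁻¹)

/-- The rows of `X` are i.i.d. observations from the centred Gaussian distribution with
precision matrix `Om`. -/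
structure IsGaussianSample {Ω : Type*} [MeasurableSpace Ω] (μ : Measure Ω) {n p : ℕ}
    (Om : Matrix (Fin p) (Fin p) ℝ) (X : Ω → Matrix (Fin n) (Fin p) ℝ) : Prop where
  measurable : Measurable X
  indep : iIndepFun (fun (k : Fin n) (ω : Ω) => X ω k) μ
  law : ∀ k : Fin n,
    μ.map (fun ω => WithLp.toLp 2 (X ω k)) = multivariateGaussian 0 Om⁻¹

/-! ### Fixed-X knockoffs -/

section Knockoffs

variable {m ι : Type*} [Fintype m] [Fintype ι] [DecidableEq ι]

/-- `Xt` is a knockoff matrix of `X`: same Gram matrix, and the cross products agree with the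
Gram matrix up to a non-negative diagonal matrix. -/
def IsKnockoff (X Xt : Matrix m ι ℝ) : Prop :=
  ∃ s : ι → ℝ, (∀ j, 0 ≤ s j) ∧
    X.transpose * Xt = X.transpose * X - Matrix.diagonal s ∧
    Xt.transpose * X = X.transpose * X - Matrix.diagonal s ∧
    Xt.transpose * Xt = X.transpose * X

/-- The strategies for computing the vector `s`. -/
inductive OptStrategy : Type
  | equi
  | sdp

/-- Feasible points of the semidefinite program with Gram matrix `G`. -/
def SDPFeasible (G : Matrix ι ι ℝ) (s : ι → ℝ) : Prop :=
  ((2 : ℝ) • G - Matrix.diagonal s).PosSemidef ∧ ∀ j, 0 ≤ s j ∧ s j ≤ 1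

/-- `s` is produced by the given strategy from the Gram matrix `G`. For `equi`, the minimal
eigenvalue of the symmetric matrix `G` is the least element of its (finite) spectrum. -/
def IsStrategySolution (o : OptStrategy) (G : Matrix ι ι ℝ) (s : ι → ℝ) : Prop :=
  match o with
  | .equi => ∀ j, s j = min (2 * sInf (spectrum ℝ G)) 1
  | .sdp => SDPFeasible G s ∧
      ∀ s', SDPFeasible G s' → ∑ j, (1 - s j) ≤ ∑ j, (1 - s' j)

/-- `Xt = X (I - (XᵀX)⁻¹ diag s) + U C`, where `s` comes from the strategy `o`, the columns of `U`
are orthonormal and orthogonal to those of `X`, and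
`CᵀC = 2 diag s - diag s (XᵀX)⁻¹ diag s`. -/
def IsConstructedKnockoff (o : OptStrategy) (X Xt : Matrix m ι ℝ) : Prop :=
  ∃ (s : ι → ℝ) (U : Matrix m ι ℝ) (C : Matrix ι ι ℝ),
    IsStrategySolution o (X.transpose * X) s ∧
    U.transpose * U = 1 ∧
    U.transpose * X = 0 ∧
    C.transpose * C = (2 : ℝ) • Matrix.diagonal s -
      Matrix.diagonal s * (X.transpose * X)⁻¹ * Matrix.diagonal s ∧
    Xt = X * (1 - (X.transpose * X)⁻¹ * Matrix.diagonal s) + U * C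

/-- Euclidean lengths of the columns. -/
noncomputable def colNorm (X : Matrix m ι ℝ) (j : ι) : ℝ := √(∑ k, X k j ^ 2)

/-- Divide column `j` by `d j`. -/
noncomputable def scaleCols (d : ι → ℝ) (X : Matrix m ι ℝ) : Matrix m ι ℝ :=
  Matrix.of fun k j => X k j / d j

/-- Exchange the columns in `H`: `[X Xt]_swap(H)` is `[swapCols H X Xt, swapCols H Xt X]`. -/
def swapCols (H : Finset ι) (X Xt : Matrix m ι ℝ) : Matrix m ι ℝ :=
  Matrix.of fun k j => if j ∈ H then Xt k j else X k j

end Knockoffs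

/-- A knockoff construction: for every sample size and response node, a map from designs to
knockoff matrices. -/
abbrev KnockoffRule (p : ℕ) : Type :=
  (n : ℕ) → (i : Fin p) → Matrix (Fin n) (Others i) ℝ → Matrix (Fin n) (Others i) ℝ

/-- `K` constructs knockoffs by the strategy `o`, for all designs of full column rank with at
least twice as many rows as columns. If `std` is true, the construction is carried out on the
design with columns rescaled to unit length (and the knockoffs are scaled back); if it is false,
it is carried out on the design as it is. -/
structure IsKnockoffRule {p : ℕ} (std : Bool) (o : OptStrategy) (K : KnockoffRule p) : Prop where
  measurable : ∀ n i, Measurable (K n i)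
  constructed : ∀ (n : ℕ) (i : Fin p) (X : Matrix (Fin n) (Others i) ℝ),
    2 * Fintype.card (Others i) ≤ n → IsUnit (X.transpose * X).det →
    match std with
    | true => IsConstructedKnockoff o (scaleCols (colNorm X) X) (scaleCols (colNorm X) (K n i X))
    | false => IsConstructedKnockoff o X (K n i X)

/-! ### Feature statistics -/

/-- A procedure for the feature statistics: for every sample size and response node, a map from
design, knockoff matrix and response vector to the vector of statistics. -/
abbrev FeatureProcedure (p : ℕ) : Type :=
  (n : ℕ) → (i : Fin p) → Matrix (Fin n) (Others i) ℝ → Matrix (Fin n) (Others i) ℝ →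
    (Fin n → ℝ) → Others i → ℝ

/-- Sufficiency: the statistics are a (measurable) function of `[X Xt]ᵀ[X Xt]` and `[X Xt]ᵀ y`. -/
def HasSufficiency {p : ℕ} (P : FeatureProcedure p) : Prop :=
  ∀ (n : ℕ) (i : Fin p),
    ∃ f : Matrix (Others i ⊕ Others i) (Others i ⊕ Others i) ℝ × (Others i ⊕ Others i → ℝ) →
        Others i → ℝ,
      Measurable f ∧
      ∀ (X Xt : Matrix (Fin n) (Others i) ℝ) (y : Fin n → ℝ),
        IsUnit (X.transpose * X).det → IsKnockoff X Xt →
        P n i X Xt y =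
          f ((Matrix.fromCols X Xt).transpose * Matrix.fromCols X Xt,
            (Matrix.fromCols X Xt).transpose.mulVec y)

/-- Antisymmetry: exchanging original variables with their knockoffs switches the signs of
exactly the corresponding statistics. -/
def HasAntisymmetry {p : ℕ} (P : FeatureProcedure p) : Prop :=
  ∀ (n : ℕ) (i : Fin p) (X Xt : Matrix (Fin n) (Others i) ℝ) (y : Fin n → ℝ),
    IsUnit (X.transpose * X).det → IsKnockoff X Xt →
    ∀ (H : Finset (Others i)) (j : Others i),
      P n i (swapCols H X Xt) (swapCols H Xt X) y j =
        if j ∈ H then - P n i X Xt y j else P n i X Xt y j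

/-- The design matrix of the regression on node `i`: delete column `i`. -/
def nodeDesign {n p : ℕ} (X : Matrix (Fin n) (Fin p) ℝ) (i : Fin p) :
    Matrix (Fin n) (Others i) ℝ :=
  X.submatrix id Subtype.val

/-- The feature statistic matrix for data `X` and node-wise knockoffs `Xt`. Here `W i j` is the
statistic of predictor `j` when node `i` is the response, with `W i i = 0`. -/
def statMatrix {n p : ℕ} (P : FeatureProcedure p) (X : Matrix (Fin n) (Fin p) ℝ)
    (Xt : (i : Fin p) → Matrix (Fin n) (Others i) ℝ) : Fin p → Fin p → ℝ :=
  fun i j => if h : j ≠ i then P n i (nodeDesign X i) (Xt i) (fun k => X k i) ⟨j, h⟩ else 0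

/-! ### Thresholds and edge sets -/

/-- The rules for combining estimated neighbourhoods into a graph. -/
inductive EdgeRule : Type
  | AND
  | OR

open Classical in
/-- `{j : W i j ≥ T i}`, the estimated neighbourhood of `i`. -/
noncomputable def posSet {p : ℕ} (W : Fin p → Fin p → ℝ) (i : Fin p) (t : EReal) :
    Finset (Fin p) :=
  Finset.univ.filter fun j => t ≤ (W i j : EReal)

open Classical in
/-- `{j : W i j ≤ -T i}`. -/
noncomputable def negSet {p : ℕ} (W : Fin p → Fin p → ℝ) (i : Fin p) (t : EReal) :
    Finset (Fin p) :=
  Finset.univ.filter fun j => (W i j : EReal) ≤ -t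

open Classical in
/-- The edge set obtained from neighbourhoods `V`; an undirected edge is the pair `(i, j)` with
`i < j`, so it is counted once. -/
noncomputable def edgesOf {p : ℕ} (r : EdgeRule) (V : Fin p → Finset (Fin p)) :
    Finset (Fin p × Fin p) :=
  Finset.univ.filter fun e => e.1 < e.2 ∧
    match r with
    | .AND => e.1 ∈ V e.2 ∧ e.2 ∈ V e.1
    | .OR => e.1 ∈ V e.2 ∨ e.2 ∈ V e.1

/-- The estimated edge set for statistics `W` and thresholds `T`. -/
noncomputable def estEdges {p : ℕ} (r : EdgeRule) (W : Fin p → Fin p → ℝ) (T : Fin p → EReal) :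
    Finset (Fin p × Fin p) :=
  edgesOf r fun i => posSet W i (T i)

/-- Admissible thresholds for node `i`: `({|W i j| : j} ∪ {+∞}) \ {0}`. -/
noncomputable def thresholdCandidates {p : ℕ} (W : Fin p → Fin p → ℝ) (i : Fin p) :
    Finset EReal :=
  (insert ⊤ (Finset.univ.image fun j => ((|W i j| : ℝ) : EReal))).erase 0

/-- The right-hand side of the constraints. -/
noncomputable def constraintLevel (p : ℕ) (r : EdgeRule) (q c : ℝ) : ℝ :=
  match r with
  | .AND => 2 * q / (c * p)
  | .OR => q / (c * p)

/-- The constraints of the optimization problem (`δ = 1` for FDR, `δ = 0` for modified FDR);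
`ac` is the pair `(a, c_a)`. -/
def IsFeasible {p : ℕ} (r : EdgeRule) (q δ : ℝ) (ac : ℝ × ℝ) (W : Fin p → Fin p → ℝ)
    (T : Fin p → EReal) : Prop :=
  ∀ i, (ac.1 * δ + ((negSet W i (T i)).card : ℝ)) / max ((estEdges r W T).card : ℝ) 1
      ≤ constraintLevel p r q ac.2 ∧
    T i ∈ thresholdCandidates W i

open Classical in
/-- For every `i`, the least admissible threshold with `|negSet| ≤ k`. -/
noncomputable def levelThreshold {p : ℕ} (W : Fin p → Fin p → ℝ) (k : ℕ) : Fin p → EReal :=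
  fun i => ((thresholdCandidates W i).filter fun t => (negSet W i t).card ≤ k).inf id

/-- The bound from which the search starts. -/
noncomputable def searchBound (p : ℕ) (r : EdgeRule) (q δ : ℝ) (ac : ℝ × ℝ) : ℤ :=
  match r with
  | .AND => ⌊q * ((p : ℝ) - 1) / ac.2 - ac.1 * δ⌋
  | .OR => ⌊q * ((p : ℝ) - 1) / (2 * ac.2) - ac.1 * δ⌋

open Classical in
/-- The first feasible `levelThreshold` for `k, k - 1, …, 0`, and `+∞` if there is none. -/
noncomputable def searchDown {p : ℕ} (r : EdgeRule) (q δ : ℝ) (ac : ℝ × ℝ)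
    (W : Fin p → Fin p → ℝ) : ℕ → Fin p → EReal
  | 0 => if IsFeasible r q δ ac W (levelThreshold W 0) then levelThreshold W 0 else fun _ => ⊤
  | k + 1 => if IsFeasible r q δ ac W (levelThreshold W (k + 1)) then levelThreshold W (k + 1)
      else searchDown r q δ ac W k

/-- The threshold vector. -/
noncomputable def threshold {p : ℕ} (r : EdgeRule) (q δ : ℝ) (ac : ℝ × ℝ)
    (W : Fin p → Fin p → ℝ) : Fin p → EReal :=
  if searchBound p r q δ ac < 0 then fun _ => ⊤
  else searchDown r q δ ac W (searchBound p r q δ ac).toNat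

/-! ### The filter, and the filter with sample-splitting-recycling -/

/-- The hyperparameters `((a, c_a), O, P, R)`. -/
structure Hyper (p : ℕ) : Type where
  ac : ℝ × ℝ
  opt : OptStrategy
  proc : FeatureProcedure p
  rule : EdgeRule

/-- The edge set of the GGM knockoff filter on data `X`. -/
noncomputable def ggmFilter {n p : ℕ} (K : OptStrategy → KnockoffRule p) (q δ : ℝ) (h : Hyper p)
    (X : Matrix (Fin n) (Fin p) ℝ) : Finset (Fin p × Fin p) :=
  let W := statMatrix h.proc X fun i => K h.opt n i (nodeDesign X i)
  estEdges h.rule W (threshold h.rule q δ h.ac W)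

/-- The first `⌊n / 2⌋` rows. -/
def firstHalf {n p : ℕ} (X : Matrix (Fin n) (Fin p) ℝ) : Matrix (Fin (n / 2)) (Fin p) ℝ :=
  Matrix.of fun k => X ⟨k, by omega⟩

/-- The remaining `n - ⌊n / 2⌋` rows. -/
def secondHalf {n p : ℕ} (X : Matrix (Fin n) (Fin p) ℝ) : Matrix (Fin (n - n / 2)) (Fin p) ℝ :=
  Matrix.of fun k => X ⟨n / 2 + k, by omega⟩

/-- Recycled knockoffs: the first-half rows are copies of the design, the second-half rows are
the knockoffs constructed from the second half. -/
def recycledKnockoff {n p : ℕ} (K : KnockoffRule p) (X : Matrix (Fin n) (Fin p) ℝ) (i : Fin p) :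
    Matrix (Fin n) (Others i) ℝ :=
  Matrix.of fun k j =>
    if hk : (k : ℕ) < n / 2 then nodeDesign X i k j
    else K (n - n / 2) i (nodeDesign (secondHalf X) i) ⟨k - n / 2, by omega⟩ j

/-- The edge set computed from all samples with recycled knockoffs and hyperparameters `h`;
`X` is the data matrix after splitting, the first part being on top. -/
noncomputable def recycledFilter {n p : ℕ} (K : OptStrategy → KnockoffRule p) (q δ : ℝ)
    (h : Hyper p) (X : Matrix (Fin n) (Fin p) ℝ) : Finset (Fin p × Fin p) :=
  let W := statMatrix h.proc X fun i => recycledKnockoff (K h.opt) X i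
  estEdges h.rule W (threshold h.rule q δ h.ac W)

/-- All combinations of candidate hyperparameters. -/
def candidates {p : ℕ} (A : Set (ℝ × ℝ)) (Os : Set OptStrategy) (Ps : Set (FeatureProcedure p))
    (Rs : Set EdgeRule) : Set (Hyper p) :=
  {h | h.ac ∈ A ∧ h.opt ∈ Os ∧ h.proc ∈ Ps ∧ h.rule ∈ Rs}

/-- `sel` chooses, from the first half of the data, a candidate with the maximum number of
discoveries; ties are broken with the help of the auxiliary randomness in `S`. -/
structure IsSelection {S : Type*} [MeasurableSpace S] {n₁ p : ℕ} (H : Set (Hyper p))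
    (K : OptStrategy → KnockoffRule p) (q δ : ℝ)
    (sel : S → Matrix (Fin n₁) (Fin p) ℝ → Hyper p) : Prop where
  measurable : ∀ h, MeasurableSet {z : S × Matrix (Fin n₁) (Fin p) ℝ | sel z.1 z.2 = h}
  mem : ∀ u X₁, sel u X₁ ∈ H
  maximal : ∀ u X₁, ∀ h ∈ H, (ggmFilter K q δ h X₁).card ≤ (ggmFilter K q δ (sel u X₁) X₁).card

/-- The data after a random split: the rows are rearranged by the permutation `split u`. -/
def splitData {S : Type*} {n p : ℕ} (split : S → Equiv.Perm (Fin n)) (u : S)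
    (X : Matrix (Fin n) (Fin p) ℝ) : Matrix (Fin n) (Fin p) ℝ :=
  X.submatrix (split u) id

/-- The hyperparameters chosen by the procedure with sample-splitting-recycling. -/
def chosenHyper {S : Type*} {n p : ℕ} (split : S → Equiv.Perm (Fin n))
    (sel : S → Matrix (Fin (n / 2)) (Fin p) ℝ → Hyper p) (u : S)
    (X : Matrix (Fin n) (Fin p) ℝ) : Hyper p :=
  sel u (firstHalf (splitData split u X))

/-- The output of the GGM knockoff filter with sample-splitting-recycling. -/
noncomputable def recyclingProcedure {S : Type*} {n p : ℕ} (K : OptStrategy → KnockoffRule p)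
    (q δ : ℝ) (split : S → Equiv.Perm (Fin n))
    (sel : S → Matrix (Fin (n / 2)) (Fin p) ℝ → Hyper p) (u : S)
    (X : Matrix (Fin n) (Fin p) ℝ) : Finset (Fin p × Fin p) :=
  recycledFilter K q δ (chosenHyper split sel u X) (splitData split u X)

/-! ### Error rates -/

open Classical in
/-- The falsely discovered edges. -/
noncomputable def falseEdges {p : ℕ} (Om : Matrix (Fin p) (Fin p) ℝ)
    (E : Finset (Fin p × Fin p)) : Finset (Fin p × Fin p) :=
  E.filter fun e => ¬ IsEdge Om e.1 e.2

/-- The false discovery rate of a random edge set. -/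
noncomputable def FDR {Ω : Type*} [MeasurableSpace Ω] (μ : Measure Ω) {p : ℕ}
    (Om : Matrix (Fin p) (Fin p) ℝ) (E : Ω → Finset (Fin p × Fin p)) : ℝ≥0∞ :=
  ∫⁻ ω, ((falseEdges Om (E ω)).card : ℝ≥0∞) / max ((E ω).card : ℝ≥0∞) 1 ∂μ

/-- `a c_a p / (q 1_{R = AND} + q)`, with value `+∞` when `q = 0`. -/
noncomputable def mFDROffset {p : ℕ} (q : ℝ) (h : Hyper p) : ℝ≥0∞ :=
  ENNReal.ofReal (h.ac.1 * h.ac.2 * p) /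
    ENNReal.ofReal (q * (match h.rule with | .AND => 1 | .OR => 0) + q)

/-- The rule-dependent modified false discovery rate; `h` are the chosen hyperparameters. -/
noncomputable def mFDRre {Ω : Type*} [MeasurableSpace Ω] (μ : Measure Ω) {p : ℕ}
    (Om : Matrix (Fin p) (Fin p) ℝ) (q : ℝ) (h : Ω → Hyper p)
    (E : Ω → Finset (Fin p × Fin p)) : ℝ≥0∞ :=
  ∫⁻ ω, ((falseEdges Om (E ω)).card : ℝ≥0∞) / (((E ω).card : ℝ≥0∞) + mFDROffset q (h ω)) ∂μ

end GGMKnockoff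

/-! Write `M_i` for `maxRatio a (nullSet Om i) (W i)`: over all thresholds, the largest ratio of the
number of null predictors of node `i` above the threshold to `a` plus the number below its negative.
The proof combines a pathwise bound by the `M_i` with a bound on their conditional expectations.

Pathwise, the loss is at most `q / (c * p) * ∑ i, M_i` (`fdp_le_sum_maxRatio`,
`mfdp_le_sum_maxRatio`). The two ends of a false edge are null for each other, since conditional
independence makes the precision entry vanish (`precision_eq_zero_of_not_isEdge`). The edge
therefore accounts for two null selections under AND and at least one under OR, which is exactly the
factor in the constraint level. Feasibility bounds the negative counts by the number of edges. This
works for any feasible threshold vector, so the details of the search are immaterial. For `δ = 0`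
the offset in the modified rate supplies the `a` that the constraint lacks.

Given the first half of the data, `M_i` has expectation at most `c`. Fix also the second-half design
`D`, with knockoffs `Dt`: the response there is `D β + ε` with spherical Gaussian `ε`. If `β j = 0`,
the reflection along the difference of the `j`-th columns of `D` and `Dt` exchanges these two
columns, fixes all the others and hence `D β`, and preserves the law of `ε`. On recycled rows design
and knockoffs coincide, so a swap does nothing there. By sufficiency and antisymmetry the reflection
flips the sign of statistic `j` alone (`statMatrix_reflectAlong`).

Null signs thus behave as fair coins given the moduli. As the threshold decreases, the positive and
negative counts `(s, f)` run along a coin-tossing path, and `M_i > x` requires the path to enter `s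
> x * (a + f)`. Integrating hitting probabilities over `x` (`Layered`) reduces the claim to
numerical bounds: the martingales `θ ^ s * (2 - θ) ^ f` suffice for `a = 0.01` (`layered_centi`),
and for `a = 1` certified exact backward recursion sharpens them (`layered_one`).

The chosen hyperparameters depend only on the first half and on independent randomness, so the
conditional bound applies with the choice frozen (`lintegral_chosen_loss_le`). -/

namespace GGMKnockoff

/-! ### Sign flips and the maximal inequality for the ratio of positive to negative counts -/

section Counts

variable {ι : Type*}

open Classical in
/-- The number of coordinates in `H` that are at least `t`. -/
noncomputable def posCount (H : Finset ι) (w : ι → ℝ) (t : ℝ) : ℕ :=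
  (H.filter fun k => t ≤ w k).card

open Classical in
/-- The number of coordinates in `H` that are at most `-t`. -/
noncomputable def negCount (H : Finset ι) (w : ι → ℝ) (t : ℝ) : ℕ :=
  (H.filter fun k => w k ≤ -t).card

/-- `V s f` bounds the probability that a fair coin-tossing path that has `s` successes and `f`
failures so far ever enters `A`. -/
structure IsHitBound (A : ℕ → ℕ → Prop) (V : ℕ → ℕ → ℝ) : Prop where
  nonneg : ∀ s f, 0 ≤ V s f
  one_le : ∀ s f, A s f → 1 ≤ V s f
  step : ∀ s f, ¬ A s f → V (s + 1) f + V s (f + 1) ≤ 2 * V s f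

lemma posCount_congr {H : Finset ι} {w w' : ι → ℝ} (h : ∀ k ∈ H, w k = w' k) (t : ℝ) :
    posCount H w t = posCount H w' t := by
  unfold posCount
  congr 1
  exact Finset.filter_congr fun k hk => by rw [h k hk]

lemma negCount_congr {H : Finset ι} {w w' : ι → ℝ} (h : ∀ k ∈ H, w k = w' k) (t : ℝ) :
    negCount H w t = negCount H w' t := by
  unfold negCount
  congr 1
  exact Finset.filter_congr fun k hk => by rw [h k hk]

lemma posCount_eq_zero {H : Finset ι} {w : ι → ℝ} {t : ℝ} (h : ∀ k ∈ H, |w k| < t) :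
    posCount H w t = 0 := by
  unfold posCount
  rw [Finset.card_eq_zero, Finset.filter_eq_empty_iff]
  intro k hk hk'
  exact absurd (le_abs_self (w k)) (by linarith [h k hk])

lemma negCount_eq_zero {H : Finset ι} {w : ι → ℝ} {t : ℝ} (h : ∀ k ∈ H, |w k| < t) :
    negCount H w t = 0 := by
  unfold negCount
  rw [Finset.card_eq_zero, Finset.filter_eq_empty_iff]
  intro k hk hk'
  exact absurd (neg_abs_le (w k)) (by linarith [h k hk])

/-- Some threshold in `Ts` brings the pair of counts of `H`, started from `(s, f)`, into `A`. -/
def Hits (A : ℕ → ℕ → Prop) (Ts : Set ℝ) (H : Finset ι) (w : ι → ℝ) (s f : ℕ) : Prop :=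
  ∃ t ∈ Ts, A (s + posCount H w t) (f + negCount H w t)

lemma Hits.congr {A : ℕ → ℕ → Prop} {Ts : Set ℝ} {H : Finset ι} {w w' : ι → ℝ} {s f : ℕ}
    (hw : ∀ k ∈ H, w k = w' k) : Hits A Ts H w s f ↔ Hits A Ts H w' s f := by
  unfold Hits
  simp only [posCount_congr hw, negCount_congr hw]

end Counts

section Flips

variable {ι : Type*} [DecidableEq ι]

/-- Change the signs of the coordinates in `F`. -/
def flipOn (F : Finset ι) (w : ι → ℝ) : ι → ℝ := fun k => if k ∈ F then -w k else w k

open Classical in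
lemma posCount_insert {a : ι} {H : Finset ι} (ha : a ∉ H) (w : ι → ℝ) (t : ℝ) :
    posCount (insert a H) w t = posCount H w t + if t ≤ w a then 1 else 0 := by
  unfold posCount
  rw [Finset.filter_insert]
  split_ifs with h
  · rw [Finset.card_insert_of_notMem (by simp [ha])]
  · simp

open Classical in
lemma negCount_insert {a : ι} {H : Finset ι} (ha : a ∉ H) (w : ι → ℝ) (t : ℝ) :
    negCount (insert a H) w t = negCount H w t + if w a ≤ -t then 1 else 0 := by
  unfold negCount
  rw [Finset.filter_insert]
  split_ifs with h
  · rw [Finset.card_insert_of_notMem (by simp [ha])]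
  · simp

lemma abs_flipOn (F : Finset ι) (w : ι → ℝ) (k : ι) : |flipOn F w k| = |w k| := by
  unfold flipOn; split_ifs <;> simp

lemma flipOn_insert {a : ι} {F : Finset ι} (ha : a ∉ F) (w : ι → ℝ) :
    flipOn (insert a F) w = flipOn {a} (flipOn F w) := by
  ext k
  by_cases hk : k = a
  · subst hk; simp [flipOn, ha]
  · simp [flipOn, hk]

lemma flipOn_empty (w : ι → ℝ) : flipOn ∅ w = w := by
  ext k; simp [flipOn]

/-- A threshold above `|w a|` counts nothing, and the empty count is outside `A`. A successful
threshold is therefore at most `|w a|` and counts `a` on the side of its sign, so `a` may be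
regarded as the first toss. -/
lemma Hits.insert_max {A : ℕ → ℕ → Prop} {Ts : Set ℝ} (hTs : ∀ t ∈ Ts, 0 < t) {a : ι}
    {H : Finset ι} (ha : a ∉ H) {w : ι → ℝ} (hmax : ∀ k ∈ H, |w k| ≤ |w a|) {s f : ℕ}
    (hA : ¬ A s f) (h : Hits A Ts (insert a H) w s f) :
    (0 ≤ w a → Hits A Ts H w (s + 1) f) ∧ (w a ≤ 0 → Hits A Ts H w s (f + 1)) := by
  obtain ⟨t, ht, hh⟩ := h
  have ht0 := hTs t ht
  have hta : t ≤ |w a| := by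
    by_contra hlt
    rw [not_le] at hlt
    have hall : ∀ k ∈ insert a H, |w k| < t := by
      intro k hk
      rcases Finset.mem_insert.1 hk with rfl | hk
      · exact hlt
      · exact (hmax k hk).trans_lt hlt
    rw [posCount_eq_zero hall, negCount_eq_zero hall] at hh
    exact hA hh
  rw [posCount_insert ha, negCount_insert ha] at hh
  refine ⟨fun h0 => ⟨t, ht, ?_⟩, fun h0 => ⟨t, ht, ?_⟩⟩
  · rw [abs_of_nonneg h0] at hta
    rw [if_pos hta, if_neg (by linarith)] at hh
    convert hh using 1 <;> ring
  · rw [abs_of_nonpos h0] at hta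
    rw [if_neg (by linarith), if_pos (by linarith)] at hh
    convert hh using 1 <;> ring

open Classical in
/-- Among all sign patterns, the proportion of those that hit `A` is at most `V`. -/
theorem IsHitBound.sum_hits_le {A : ℕ → ℕ → Prop} {V : ℕ → ℕ → ℝ} (hV : IsHitBound A V)
    {Ts : Set ℝ} (hTs : ∀ t ∈ Ts, 0 < t) (w : ι → ℝ) (H : Finset ι) (s f : ℕ) :
    ∑ F ∈ H.powerset, (if Hits A Ts H (flipOn F w) s f then (1 : ℝ) else 0)
      ≤ 2 ^ H.card * V s f := by
  -- The largest modulus is removed first: this is the order in which a decreasing threshold reveals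
  -- the coordinates.
  induction H using Finset.induction_on_max_value (fun k => |w k|) generalizing s f with
  | empty =>
    simp only [Finset.powerset_empty, Finset.sum_singleton, Finset.card_empty, pow_zero, one_mul]
    split_ifs with h
    · obtain ⟨t, -, h⟩ := h
      exact hV.one_le s f (by simpa [posCount, negCount] using h)
    · exact hV.nonneg s f
  | insert a H ha hmax ih =>
    by_cases hA : A s f
    · calc _ ≤ ∑ F ∈ (insert a H).powerset, (1 : ℝ) :=
            Finset.sum_le_sum fun F _ => by split_ifs <;> norm_num
        _ = 2 ^ (insert a H).card * 1 := by simp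
        _ ≤ _ := by
            have := hV.one_le s f hA
            gcongr
    -- Sign patterns are split by whether `a` is flipped. In one half the toss of `a` is a success,
    -- in the other a failure, and `V.step` averages the two; if `w a = 0`, either reading is
    -- allowed.
    rw [Finset.sum_powerset_insert ha, Finset.card_insert_of_notMem ha]
    have hcong : ∀ F ∈ H.powerset, ∀ k ∈ H, flipOn (insert a F) w k = flipOn F w k := by
      intro F _ k hk
      have : k ≠ a := fun h => ha (h ▸ hk)
      simp [flipOn, this]
    have hval : ∀ F ∈ H.powerset, flipOn F w a = w a ∧ flipOn (insert a F) w a = - w a := by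
      intro F hF
      have : a ∉ F := fun h => ha (Finset.mem_powerset.1 hF h)
      simp [flipOn, this]
    have hind : ∀ {p q : Prop}, (p → q) → (if p then (1 : ℝ) else 0) ≤ if q then 1 else 0 := by
      intro p q hpq
      by_cases hp : p
      · simp [hp, hpq hp]
      · simp only [hp, if_false]; split_ifs <;> norm_num
    have hplain := fun F (hF : F ∈ H.powerset) (h : Hits A Ts (insert a H) (flipOn F w) s f) =>
      Hits.insert_max hTs ha (by simpa only [abs_flipOn] using hmax) hA h
    have hflip : ∀ F ∈ H.powerset, Hits A Ts (insert a H) (flipOn (insert a F) w) s f →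
        (0 ≤ - w a → Hits A Ts H (flipOn F w) (s + 1) f) ∧
          (- w a ≤ 0 → Hits A Ts H (flipOn F w) s (f + 1)) := by
      intro F hF h
      have := Hits.insert_max hTs ha (by simpa only [abs_flipOn] using hmax) hA h
      rwa [(hval F hF).2, Hits.congr (hcong F hF), Hits.congr (hcong F hF)] at this
    have hstep := hV.step s f hA
    have key : ∑ F ∈ H.powerset,
          (if Hits A Ts (insert a H) (flipOn F w) s f then (1 : ℝ) else 0) +
        ∑ F ∈ H.powerset,
          (if Hits A Ts (insert a H) (flipOn (insert a F) w) s f then (1 : ℝ) else 0) ≤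
        2 ^ H.card * V (s + 1) f + 2 ^ H.card * V s (f + 1) := by
      rcases le_total 0 (w a) with h0 | h0
      · refine add_le_add (le_trans (Finset.sum_le_sum fun F hF => hind fun h => ?_) (ih _ _))
          (le_trans (Finset.sum_le_sum fun F hF => hind fun h => ?_) (ih _ _))
        · exact (hplain F hF h).1 (by rwa [(hval F hF).1])
        · exact (hflip F hF h).2 (by linarith)
      · rw [add_comm]
        refine add_le_add (le_trans (Finset.sum_le_sum fun F hF => hind fun h => ?_) (ih _ _))
          (le_trans (Finset.sum_le_sum fun F hF => hind fun h => ?_) (ih _ _))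
        · exact (hflip F hF h).1 (by linarith)
        · exact (hplain F hF h).2 (by rwa [(hval F hF).1])
    calc _ ≤ _ := key
      _ = 2 ^ H.card * (V (s + 1) f + V s (f + 1)) := by ring
      _ ≤ 2 ^ H.card * (2 * V s f) := by gcongr
      _ = _ := by ring

end Flips

end GGMKnockoff

namespace GGMKnockoff

/-! ### Layer-cake bounds for the expected maximal ratio -/

/-- The largest ratio `#{k ∈ H : t ≤ w k} / (a + #{k ∈ H : w k ≤ -t})` over the positive
thresholds `t` among the absolute values of the coordinates of `w`. -/
noncomputable def maxRatio {ι : Type*} (a : ℝ) (H : Finset ι) (w : ι → ℝ) : ℝ≥0∞ :=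
  ⨆ (j : ι) (_ : w j ≠ 0),
    (posCount H w |w j| : ℝ≥0∞) / (ENNReal.ofReal a + (negCount H w |w j| : ℝ≥0∞))

/-- Levels `y = x 0 ≤ x 1 ≤ …` tending to infinity, with hitting bounds for the events that the
ratio of successes to `a` plus failures exceeds `x i`, whose weighted sum is at most `c`. -/
def Layered (a y c : ℝ) : Prop :=
  ∃ (x : ℕ → ℝ) (V : ℕ → ℕ → ℕ → ℝ), x 0 = y ∧ Monotone x ∧
    Filter.Tendsto x Filter.atTop Filter.atTop ∧
    (∀ i, IsHitBound (fun s f => x i * (a + f) < s) (V i)) ∧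
    ∀ N, ∑ i ∈ Finset.range N, (x (i + 1) - x i) * V i 0 0 ≤ c

/-- Discrete layer cake: the increments over the levels below `y` telescope to a level that is at
least `y`. The induction shifts the sequence and peels off the lowest level. -/
lemma le_add_sum_layers {x : ℕ → ℝ} (hx : Monotone x) (y : ℝ) (N : ℕ) (hy : y ≤ x N) :
    y ≤ x 0 + ∑ i ∈ Finset.range N, (x (i + 1) - x i) * (if x i < y then 1 else 0) := by
  induction N generalizing x with
  | zero => simpa using hy
  | succ N ih =>
    have hsh : Monotone fun i => x (i + 1) := fun i j hij => hx (by omega)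
    have := ih hsh hy
    rw [Finset.sum_range_succ']
    split_ifs with h0
    · simp only [zero_add] at this ⊢
      linarith
    · have : 0 ≤ ∑ i ∈ Finset.range N,
          (x (i + 1 + 1) - x (i + 1)) * (if x (i + 1) < y then (1 : ℝ) else 0) := by
        refine Finset.sum_nonneg fun i _ => mul_nonneg ?_ (by split_ifs <;> norm_num)
        linarith [hx (show i + 1 ≤ i + 1 + 1 by omega)]
      linarith

/-- For each sign pattern the maximal ratio is at most the sum of the layer widths whose lower level
it exceeds. Exchanging this sum with the one over patterns leaves, level by level,
`IsHitBound.sum_hits_le`. -/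
theorem Layered.sum_maxRatio_le {a c : ℝ} (ha : 0 < a) (h : Layered a 0 c) {ι : Type*}
    [DecidableEq ι] (H : Finset ι) (w : ι → ℝ) :
    ∑ F ∈ H.powerset, maxRatio a H (flipOn F w) ≤ 2 ^ H.card * ENNReal.ofReal c := by
  classical
  obtain ⟨x, V, hx0, hmono, htop, hV, hsum⟩ := h
  -- No ratio exceeds `H.card / a`, so finitely many layers suffice.
  obtain ⟨N, hN⟩ := (htop.eventually_ge_atTop ((H.card : ℝ) / a)).exists
  -- The thresholds are moduli of `w`, hence the same for all sign patterns.
  set Ts : Set ℝ := {t | ∃ j, w j ≠ 0 ∧ t = |w j|} with hTs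
  have hTs0 : ∀ t ∈ Ts, 0 < t := by
    rintro t ⟨j, hj, rfl⟩; exact abs_pos.2 hj
  have hdx : ∀ i, 0 ≤ x (i + 1) - x i := fun i => sub_nonneg.2 (hmono (Nat.le_succ i))
  let ind : ℕ → Finset ι → ℝ := fun i F =>
    if Hits (fun s f => x i * (a + f) < s) Ts H (flipOn F w) 0 0 then 1 else 0
  have hind : ∀ i F, 0 ≤ ind i F := fun i F => by simp only [ind]; split_ifs <;> norm_num
  have hbound : ∀ F, maxRatio a H (flipOn F w) ≤
      ENNReal.ofReal (∑ i ∈ Finset.range N, (x (i + 1) - x i) * ind i F) := by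
    intro F
    refine iSup₂_le fun j hj => ?_
    have hjw : w j ≠ 0 := by rwa [← abs_ne_zero, ← abs_flipOn F, abs_ne_zero]
    rw [abs_flipOn]
    set P := posCount H (flipOn F w) |w j|
    set M := negCount H (flipOn F w) |w j|
    have hpos : (0 : ℝ) < a + M := by positivity
    have hcast : (P : ℝ≥0∞) / (ENNReal.ofReal a + (M : ℝ≥0∞)) =
        ENNReal.ofReal ((P : ℝ) / (a + M)) := by
      rw [ENNReal.ofReal_div_of_pos hpos, ENNReal.ofReal_add ha.le (by positivity)]
      simp
    rw [hcast]
    refine ENNReal.ofReal_le_ofReal ?_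
    have hPH : (P : ℝ) ≤ H.card := by exact_mod_cast Finset.card_filter_le _ _
    have hle : (P : ℝ) / (a + M) ≤ x N := by
      refine le_trans ?_ hN
      gcongr
      linarith [(Nat.cast_nonneg M : (0 : ℝ) ≤ M)]
    have := le_add_sum_layers hmono _ N hle
    rw [hx0, zero_add] at this
    refine this.trans (Finset.sum_le_sum fun i _ => mul_le_mul_of_nonneg_left ?_ (hdx i))
    by_cases hi : x i < (P : ℝ) / (a + M)
    · have : Hits (fun s f => x i * (a + f) < s) Ts H (flipOn F w) 0 0 := by
        refine ⟨|w j|, ⟨j, hjw, rfl⟩, ?_⟩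
        rw [lt_div_iff₀ hpos] at hi
        simpa using hi
      simp [ind, this, hi]
    · rw [if_neg hi]; exact hind i F
  calc ∑ F ∈ H.powerset, maxRatio a H (flipOn F w)
      ≤ ∑ F ∈ H.powerset,
          ENNReal.ofReal (∑ i ∈ Finset.range N, (x (i + 1) - x i) * ind i F) :=
        Finset.sum_le_sum fun F _ => hbound F
    _ = ENNReal.ofReal (∑ F ∈ H.powerset,
          ∑ i ∈ Finset.range N, (x (i + 1) - x i) * ind i F) :=
        (ENNReal.ofReal_sum_of_nonneg fun F _ =>
          Finset.sum_nonneg fun i _ => mul_nonneg (hdx i) (hind i F)).symm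
    _ ≤ ENNReal.ofReal (2 ^ H.card * c) := by
        refine ENNReal.ofReal_le_ofReal ?_
        rw [Finset.sum_comm]
        calc ∑ i ∈ Finset.range N, ∑ F ∈ H.powerset, (x (i + 1) - x i) * ind i F
            ≤ ∑ i ∈ Finset.range N, (x (i + 1) - x i) * (2 ^ H.card * V i 0 0) := by
              refine Finset.sum_le_sum fun i _ => ?_
              rw [← Finset.mul_sum]
              exact mul_le_mul_of_nonneg_left ((hV i).sum_hits_le hTs0 w H 0 0) (hdx i)
          _ = 2 ^ H.card * ∑ i ∈ Finset.range N, (x (i + 1) - x i) * V i 0 0 := by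
              rw [Finset.mul_sum]
              exact Finset.sum_congr rfl fun i _ => by ring
          _ ≤ 2 ^ H.card * c := by gcongr; exact hsum N
    _ = 2 ^ H.card * ENNReal.ofReal c := by
        rw [ENNReal.ofReal_mul (by positivity), ENNReal.ofReal_pow (by norm_num)]
        simp

lemma Layered.mono {a y c c' : ℝ} (h : Layered a y c) (hc : c ≤ c') : Layered a y c' := by
  obtain ⟨x, V, h0, h1, h2, h3, h4⟩ := h
  exact ⟨x, V, h0, h1, h2, h3, fun N => (h4 N).trans hc⟩

/-- A new lowest level costs the width of its layer times the hitting bound at the lower end. The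
numerical estimates are built downwards from a tail in this way. -/
lemma Layered.prepend {a y y' c b : ℝ} {V : ℕ → ℕ → ℝ} (h : Layered a y' c) (hy : y ≤ y')
    (hV : IsHitBound (fun s f => y * (a + f) < s) V) (hb : V 0 0 ≤ b) :
    Layered a y (c + (y' - y) * b) := by
  obtain ⟨x, W, h0, h1, h2, h3, h4⟩ := h
  refine ⟨fun i => Nat.casesOn i y x, fun i => Nat.casesOn i V W, rfl,
    monotone_nat_of_le_succ ?_, ?_, ?_, ?_⟩
  · rintro (_ | n)
    · simpa [h0] using hy
    · exact h1 (Nat.le_succ n)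
  · rw [← Filter.tendsto_add_atTop_iff_nat 1]
    exact h2
  · rintro (_ | n)
    · exact hV
    · exact h3 n
  · intro N
    rcases N with _ | N
    · have h5 := h4 0
      rw [Finset.sum_range_zero] at h5 ⊢
      have : 0 ≤ b := (hV.nonneg 0 0).trans hb
      nlinarith [mul_nonneg (sub_nonneg.2 hy) this]
    · rw [Finset.sum_range_succ']
      have : (y' - y) * V 0 0 ≤ (y' - y) * b :=
        mul_le_mul_of_nonneg_left hb (sub_nonneg.2 hy)
      have h5 := h4 N
      have h6 : ∑ i ∈ Finset.range N, (x (i + 1) - x i) * W i 0 0 + (x 0 - y) * V 0 0 ≤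
          c + (y' - y) * b := by rw [h0]; linarith
      exact h6

/-! ### Exponential hitting bounds and their improvement by exact steps -/

lemma isHitBound_one (A : ℕ → ℕ → Prop) : IsHitBound A fun _ _ => 1 :=
  ⟨fun _ _ => zero_le_one, fun _ _ _ => le_rfl, fun _ _ _ => by norm_num⟩

/-- The exponential bound for levels at which a hit forces `m * f + r ≤ s`. -/
lemma isHitBound_exp {A : ℕ → ℕ → Prop} {θ : ℝ} {m r : ℕ} (h1 : 1 ≤ θ) (h2 : θ ≤ 2)
    (hθ : 1 ≤ (2 - θ) * θ ^ m) (hA : ∀ s f, A s f → m * f + r ≤ s) :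
    IsHitBound A fun s f => θ ^ s * (2 - θ) ^ f / θ ^ r where
  nonneg s f := by
    have := sub_nonneg.2 h2
    positivity
  one_le s f h := by
    rw [one_le_div (by positivity)]
    have h2' := sub_nonneg.2 h2
    calc θ ^ r = θ ^ r * 1 := by ring
      -- Each failure costs a factor `2 - θ`, which the `m` successes that the level demands for it
      -- pay back.
      _ ≤ θ ^ r * ((2 - θ) * θ ^ m) ^ f := by gcongr; exact one_le_pow₀ hθ
      _ = θ ^ (m * f + r) * (2 - θ) ^ f := by rw [mul_pow, pow_add, pow_mul]; ring
      _ ≤ θ ^ s * (2 - θ) ^ f := by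
        gcongr
        exact hA s f h
  step s f _ := by
    -- The two factors `θ` and `2 - θ` add up to `2`, so this is a martingale.
    refine le_of_eq ?_
    rw [pow_succ, pow_succ]
    ring

/-- The exponential bound at the rational level `p / q`, for `a = 1`. -/
lemma isHitBound_exp_rat {θ : ℝ} {p q : ℕ} (hq : 0 < q) (h1 : 1 ≤ θ) (h2 : θ ≤ 2)
    (hθ : 1 ≤ (2 - θ) ^ q * θ ^ p) :
    IsHitBound (fun s f => p * (1 + f) < q * s) fun s f => θ ^ s * (2 - θ) ^ (f + 1) where
  nonneg s f := by
    have := sub_nonneg.2 h2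
    positivity
  one_le s f h := by
    have h2' := sub_nonneg.2 h2
    -- The `q`-th power clears the denominator of the level. The exponent `f + 1` treats `a = 1` as
    -- one failure in advance.
    rw [← one_le_pow_iff_of_nonneg (by positivity) hq.ne']
    calc 1 ≤ ((2 - θ) ^ q * θ ^ p) ^ (f + 1) := one_le_pow₀ hθ
      _ = θ ^ (p * (1 + f)) * ((2 - θ) ^ (f + 1)) ^ q := by
          rw [mul_pow, ← pow_mul, ← pow_mul, ← pow_mul, mul_comm q, add_comm 1 f]; ring
      _ ≤ θ ^ (q * s) * ((2 - θ) ^ (f + 1)) ^ q := by gcongr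
      _ = _ := by rw [mul_pow, ← pow_mul, ← pow_mul, mul_comm q]
  step s f _ := by
    refine le_of_eq ?_
    rw [pow_succ θ, pow_succ _ (f + 1)]
    ring

open Classical in
/-- One step of exact calculation improves a bound. -/
noncomputable def hitStep (A : ℕ → ℕ → Prop) (V : ℕ → ℕ → ℝ) (s f : ℕ) : ℝ :=
  if A s f then 1 else (V (s + 1) f + V s (f + 1)) / 2

/-- The new function lies below `V` everywhere, in particular at the two successors, while at the
current point outside `A` it is exactly the average of the old successor values. So the averaging
inequality survives. -/
lemma IsHitBound.hitStep {A : ℕ → ℕ → Prop} {V : ℕ → ℕ → ℝ} (h : IsHitBound A V) :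
    IsHitBound A (hitStep A V) := by
  have hle : ∀ s f, GGMKnockoff.hitStep A V s f ≤ V s f := by
    intro s f
    unfold GGMKnockoff.hitStep
    split_ifs with hA
    · exact h.one_le s f hA
    · linarith [h.step s f hA]
  refine ⟨fun s f => ?_, fun s f hA => ?_, fun s f hA => ?_⟩
  · unfold GGMKnockoff.hitStep
    split_ifs
    · norm_num
    · linarith [h.nonneg (s + 1) f, h.nonneg s (f + 1)]
  · simp [GGMKnockoff.hitStep, hA]
  · have h1 := hle (s + 1) f
    have h2 := hle s (f + 1)
    have : 2 * GGMKnockoff.hitStep A V s f = V (s + 1) f + V s (f + 1) := by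
      rw [GGMKnockoff.hitStep, if_neg hA]; ring
    linarith

lemma IsHitBound.iterate {A : ℕ → ℕ → Prop} {V : ℕ → ℕ → ℝ} (h : IsHitBound A V) (K : ℕ) :
    IsHitBound A ((GGMKnockoff.hitStep A)^[K] V) := by
  induction K with
  | zero => exact h
  | succ K ih => rw [Function.iterate_succ_apply']; exact ih.hitStep

/-! ### Integer arithmetic for the iterated bounds -/

/-- The values `t ^ s * e ^ (f + 1)` along the antidiagonal that starts at `(s, f)`. -/
def baseRow (t e : ℕ) : ℕ → ℕ → List ℕ
  | s, 0 => [t ^ s * e]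
  | s, f + 1 => t ^ s * e ^ (f + 2) :: baseRow t e (s + 1) f

/-- One step back from the antidiagonal of `(s, f + 1)` to that of `(s, f)`; `u` stands for
probability one on the new antidiagonal. -/
def upRow (p q u : ℕ) : ℕ → ℕ → List ℕ → List ℕ
  | s, 0, a :: b :: _ => [if p < q * s then u else a + b]
  | s, f + 1, a :: b :: l =>
      (if p * (f + 2) < q * s then u else a + b) :: upRow p q u (s + 1) f (b :: l)
  | _, _, _ => []

/-- Step back from the antidiagonal of `(0, k)` to the origin. -/
def climb (p q : ℕ) : ℕ → ℕ → List ℕ → List ℕ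
  | 0, _, l => l
  | k + 1, u, l => climb p q k (2 * u) (upRow p q (2 * u) 0 k l)

/-- The list holds the values of `c * g` along the antidiagonal that starts at `(s, f)`. -/
def RowIs (g : ℕ → ℕ → ℝ) (c : ℝ) : ℕ → ℕ → List ℕ → Prop
  | s, 0, l => ∃ a : ℕ, l = [a] ∧ (a : ℝ) = c * g s 0
  | s, f + 1, l => ∃ (a : ℕ) (l' : List ℕ), l = a :: l' ∧ (a : ℝ) = c * g s (f + 1) ∧
      RowIs g c (s + 1) f l'

/-- With `θ = t / D`, the exponents `s` and `f + 1` have a constant sum along an antidiagonal, so a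
single power of `D` clears every denominator in the row. -/
lemma rowIs_baseRow {t D : ℕ} (hD : 0 < D) (ht : t ≤ 2 * D) (s f : ℕ) :
    RowIs (fun s f => ((t : ℝ) / D) ^ s * (2 - (t : ℝ) / D) ^ (f + 1)) ((D : ℝ) ^ (s + f + 1)) s f
      (baseRow t (2 * D - t) s f) := by
  have hD' : (D : ℝ) ≠ 0 := by positivity
  have hval : ∀ s f : ℕ, ((t ^ s * (2 * D - t) ^ (f + 1) : ℕ) : ℝ) =
      (D : ℝ) ^ (s + f + 1) * (((t : ℝ) / D) ^ s * (2 - (t : ℝ) / D) ^ (f + 1)) := by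
    intro s f
    have : (2 - (t : ℝ) / D) = (2 * D - t) / D := by field_simp
    rw [this, div_pow, div_pow]
    push_cast [Nat.cast_sub ht]
    field_simp
    ring
  induction f generalizing s with
  | zero => exact ⟨_, rfl, by simpa using hval s 0⟩
  | succ f ih =>
    refine ⟨_, _, rfl, hval s (f + 1), ?_⟩
    have := ih (s + 1)
    rwa [show s + 1 + f + 1 = s + (f + 1) + 1 by ring] at this

/-- Doubling the scale replaces the average of two neighbours by their sum, so the recursion stays
in the integers. -/
lemma rowIs_upRow {g : ℕ → ℕ → ℝ} {p q u : ℕ} (s f : ℕ) (l : List ℕ)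
    (h : RowIs g u s (f + 1) l) :
    RowIs (hitStep (fun s f => p * (1 + f) < q * s) g) ((2 * u : ℕ) : ℝ) s f
      (upRow p q (2 * u) s f l) := by
  have hval : ∀ (s f a b : ℕ), (a : ℝ) = u * g s (f + 1) → (b : ℝ) = u * g (s + 1) f →
      (((if p * (1 + f) < q * s then 2 * u else a + b : ℕ)) : ℝ) =
        ((2 * u : ℕ) : ℝ) * hitStep (fun s f => p * (1 + f) < q * s) g s f := by
    intro s f a b ha hb
    unfold hitStep
    split_ifs
    · simp
    · push_cast; rw [ha, hb]; ring
  induction f generalizing s l with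
  | zero =>
    obtain ⟨a, l', rfl, ha, b, rfl, hb⟩ := h
    refine ⟨_, rfl, ?_⟩
    have := hval s 0 a b ha hb
    simpa using this
  | succ f ih =>
    obtain ⟨a, l', rfl, ha, b, l'', rfl, hb, hl⟩ := h
    refine ⟨_, _, rfl, ?_, ih (s + 1) (b :: l'') ⟨b, l'', rfl, hb, hl⟩⟩
    have := hval s (f + 1) a b ha hb
    rwa [show 1 + (f + 1) = f + 2 by ring] at this

lemma climb_eq {p q : ℕ} {g : ℕ → ℕ → ℝ} (k u : ℕ) (l : List ℕ) (h : RowIs g u 0 k l) :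
    ((climb p q k u l).headD 0 : ℝ) =
      2 ^ k * u * ((hitStep fun s f => p * (1 + f) < q * s)^[k] g) 0 0 := by
  induction k generalizing g u l with
  | zero =>
    obtain ⟨a, rfl, ha⟩ := h
    simpa [climb] using ha
  | succ k ih =>
    have := ih (2 * u) _ (rowIs_upRow (p := p) (q := q) 0 k l h)
    rw [climb, this, Function.iterate_succ_apply]
    push_cast
    ring

/-- A checkable certificate: at level `p / q` (with `a = 1`) the hitting probability is at most
`b / 10 ^ 6`, by `K` steps of exact calculation from the exponential bound with
`θ = t / 1000`. -/
def levelCheck (K p q t b : ℕ) : Bool :=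
  decide (0 < q ∧ 1000 ≤ t ∧ t ≤ 2000 ∧ 1000 ^ (q + p) ≤ (2000 - t) ^ q * t ^ p ∧
    (climb p q K (1000 ^ (K + 1)) (baseRow t (2000 - t) 0 K)).headD 0 * 10 ^ 6 ≤
      b * (1000 ^ (K + 1) * 2 ^ K))

/-- The power inequality in the certificate is `1 ≤ (2 - θ) ^ q * θ ^ p` after clearing
denominators. By `climb_eq` the last entry is `2 ^ K * 1000 ^ (K + 1)` times the iterated bound at
the origin. -/
lemma exists_isHitBound_of_levelCheck {K p q t b : ℕ} (h : levelCheck K p q t b = true) :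
    ∃ V, IsHitBound (fun s f => (p / q : ℝ) * (1 + f) < s) V ∧ V 0 0 ≤ b / 10 ^ 6 := by
  simp only [levelCheck, decide_eq_true_eq] at h
  obtain ⟨hq, h1, h2, h3, h4⟩ := h
  have hA : (fun s f : ℕ => (p / q : ℝ) * (1 + f) < s) = fun s f => p * (1 + f) < q * s := by
    ext s f
    rw [div_mul_eq_mul_div, div_lt_iff₀ (by exact_mod_cast hq), mul_comm (s : ℝ)]
    exact_mod_cast Iff.rfl
  rw [hA]
  have hb := isHitBound_exp_rat (θ := (t : ℝ) / (1000 : ℕ)) (p := p) hq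
    (by rw [one_le_div (by norm_num)]; exact_mod_cast h1)
    (by rw [div_le_iff₀ (by norm_num)]; exact_mod_cast h2) (by
      have h3' : (1000 : ℝ) ^ (q + p) ≤ (2000 - t) ^ q * t ^ p := by
        have : ((1000 ^ (q + p) : ℕ) : ℝ) ≤ (((2000 - t) ^ q * t ^ p : ℕ) : ℝ) := by
          exact_mod_cast h3
        simpa [Nat.cast_sub h2] using this
      have : (2 - (t : ℝ) / (1000 : ℕ)) = (2000 - t) / 1000 := by push_cast; ring
      rw [this, div_pow, div_pow, div_mul_div_comm, one_le_div (by positivity)]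
      simpa [pow_add] using h3')
  refine ⟨_, hb.iterate K, ?_⟩
  have hrow := rowIs_baseRow (t := t) (D := 1000) (by norm_num) h2 0 K
  rw [zero_add] at hrow
  have hc := climb_eq (p := p) (q := q) K (1000 ^ (K + 1)) _
    (by simpa only [Nat.cast_pow] using hrow)
  have h4' : ((climb p q K (1000 ^ (K + 1)) (baseRow t (2 * 1000 - t) 0 K)).headD 0 : ℝ) * 10 ^ 6
      ≤ b * (1000 ^ (K + 1) * 2 ^ K) := by exact_mod_cast h4
  rw [hc] at h4'
  rw [le_div_iff₀ (by positivity)]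
  refine le_of_mul_le_mul_left ?_ (show (0 : ℝ) < 2 ^ K * (1000 ^ (K + 1) : ℕ) by positivity)
  calc _ = _ := by ring
    _ ≤ _ := h4'
    _ = _ := by push_cast; ring

/-- The list holds decreasing levels `p / q` below `pl / ql`, with certified bounds. -/
def gridCheck (K : ℕ) : ℕ → ℕ → List (ℕ × ℕ × ℕ × ℕ) → Bool
  | _, _, [] => true
  | pl, ql, (p, q, t, b) :: l =>
      levelCheck K p q t b && decide (p * ql ≤ pl * q) && gridCheck K p q l

/-- The weighted sum of the bounds in the list. -/
noncomputable def gridSum : ℕ → ℕ → List (ℕ × ℕ × ℕ × ℕ) → ℝ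
  | _, _, [] => 0
  | pl, ql, (p, q, _, b) :: l => ((pl : ℝ) / ql - p / q) * (b / 10 ^ 6) + gridSum p q l

/-- The lowest level in the list. -/
noncomputable def gridBottom : ℕ → ℕ → List (ℕ × ℕ × ℕ × ℕ) → ℝ
  | pl, ql, [] => (pl : ℝ) / ql
  | _, _, (p, q, _, _) :: l => gridBottom p q l

lemma Layered.of_gridCheck {K : ℕ} (l : List (ℕ × ℕ × ℕ × ℕ)) {pl ql : ℕ} {c : ℝ} (hql : 0 < ql)
    (h : Layered 1 ((pl : ℝ) / ql) c) (hl : gridCheck K pl ql l = true) :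
    Layered 1 (gridBottom pl ql l) (c + gridSum pl ql l) := by
  induction l generalizing pl ql c with
  | nil => simpa [gridBottom, gridSum] using h
  | cons e l ih =>
    obtain ⟨p, q, t, b⟩ := e
    simp only [gridCheck, Bool.and_eq_true, decide_eq_true_eq] at hl
    obtain ⟨⟨h1, h2⟩, h3⟩ := hl
    have hq : 0 < q := by
      simp only [levelCheck, decide_eq_true_eq] at h1
      exact h1.1
    obtain ⟨V, hV, hb⟩ := exists_isHitBound_of_levelCheck h1
    have hle : (p : ℝ) / q ≤ (pl : ℝ) / ql := by
      rw [div_le_div_iff₀ (by exact_mod_cast hq) (by exact_mod_cast hql)]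
      exact_mod_cast h2
    have := ih hq (h.prepend hle hV hb) h3
    rw [gridBottom, gridSum, ← add_assoc]
    exact this

/-- One `θ` serves all levels `m + i`, because the required inequality only improves with the
exponent. A hit forces `s` to be at least `(m + i) * f + (m + 1 + i)`, so the bounds at the origin
form a geometric series. -/
lemma layered_exp_tail {θ : ℝ} {m : ℕ} (h1 : 1 < θ) (h2 : θ ≤ 2)
    (hθ : 1 ≤ (2 - θ) * θ ^ m) : Layered 1 m (1 / (θ ^ m * (θ - 1))) := by
  have h0 : 0 < θ := by linarith
  refine ⟨fun i => (m : ℝ) + i, fun i s f => θ ^ s * (2 - θ) ^ f / θ ^ (m + 1 + i), by simp,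
    fun i j hij => by simpa using hij, ?_, fun i => ?_, fun N => ?_⟩
  · exact Filter.tendsto_atTop_add_const_left _ _ tendsto_natCast_atTop_atTop
  · have hpow : 1 ≤ (2 - θ) * θ ^ (m + i) := by
      refine hθ.trans ?_
      have := sub_nonneg.2 h2
      gcongr
      · exact h1.le
      · omega
    refine isHitBound_exp (m := m + i) h1.le h2 hpow fun s f h => ?_
    have h' : (m + i) * (1 + f) < s := by beta_reduce at h; exact_mod_cast h
    nlinarith
  -- Partial geometric sum with its remainder, which is then dropped as non-negative.
  · have hsum : ∀ N : ℕ, ∑ i ∈ Finset.range N, ((m : ℝ) + (i + 1 : ℕ) - (m + i)) *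
        (θ ^ 0 * (2 - θ) ^ 0 / θ ^ (m + 1 + i)) =
        1 / (θ ^ m * (θ - 1)) - 1 / (θ ^ (m + N) * (θ - 1)) := by
      intro N
      have h3 : θ - 1 ≠ 0 := by linarith
      induction N with
      | zero => simp
      | succ N ih =>
        rw [Finset.sum_range_succ, ih]
        push_cast
        rw [pow_add, pow_add, pow_add, pow_add, pow_succ]
        field_simp
        ring
    rw [hsum]
    have : 0 < θ - 1 := by linarith
    have : 0 ≤ 1 / (θ ^ (m + N) * (θ - 1)) := by positivity
    linarith

/-! ### The constant 1.93 for `a = 1` -/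

/-- Levels `p / q`, exponential parameters `1000 θ`, and bounds times `10 ^ 6`. -/
def unitGrid : List (ℕ × ℕ × ℕ × ℕ) :=
  [(5, 1, 1965, 17321), (9, 2, 1950, 34417), (4, 1, 1927, 37581), (11, 3, 1906, 72960),
   (7, 2, 1892, 74677), (10, 3, 1877, 82890), (3, 1, 1839, 87391), (14, 5, 1810, 161614),
   (8, 3, 1787, 165648), (5, 2, 1754, 175305), (7, 3, 1716, 203899), (9, 4, 1694, 216896),
   (13, 6, 1671, 227864), (2, 1, 1618, 236761), (15, 8, 1571, 387505),
   (9, 5, 1540, 399244), (7, 4, 1518, 410122), (5, 3, 1479, 433376), (8, 5, 1445, 466938),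
   (14, 9, 1421, 486246), (3, 2, 1389, 499782), (13, 9, 1355, 565120),
   (7, 5, 1327, 585307), (11, 8, 1310, 602915), (4, 3, 1281, 624115), (9, 7, 1247, 671876),
   (5, 4, 1220, 696870), (6, 5, 1180, 746012), (7, 6, 1153, 780135), (8, 7, 1132, 807099),
   (10, 9, 1105, 843025), (14, 13, 1074, 885637), (21, 20, 1048, 923229)]

set_option maxRecDepth 100000 in
lemma gridCheck_unitGrid : gridCheck 48 6 1 unitGrid = true := by
  decide +kernel

theorem layered_one : Layered 1 0 1.93 := by
  -- The tail bound decreases in `θ`, and `1.983` is the largest three-decimal value with `1 ≤ (2 -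
  -- θ) * θ ^ 6`.
  have h6 : Layered 1 (((6 : ℕ) : ℝ) / (1 : ℕ)) (1 / ((1.983 : ℝ) ^ 6 * (1.983 - 1))) := by
    have := layered_exp_tail (θ := 1.983) (m := 6) (by norm_num) (by norm_num) (by norm_num)
    simpa using this
  have h := h6.of_gridCheck unitGrid one_pos gridCheck_unitGrid
  have hbot : gridBottom 6 1 unitGrid = 21 / 20 := by
    norm_num [gridBottom, unitGrid]
  rw [hbot] at h
  -- Between `0` and `21 / 20` the trivial probability bound is used: for a fair walk, levels up to
  -- `1` are reached almost surely.
  have h1 := h.prepend (y := 1) (V := fun _ _ => 1) (b := 1) (by norm_num) (isHitBound_one _) le_rfl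
  have h0 := h1.prepend (y := 0) (V := fun _ _ => 1) (b := 1) (by norm_num) (isHitBound_one _)
    le_rfl
  refine h0.mono ?_
  norm_num [gridSum, unitGrid]

/-! ### The constant 102 for `a = 0.01` -/

/-- Parameters of the exponential bounds at the integer levels `i ≥ 2`, for `a = 1 / 100`. -/
noncomputable def centiTheta : ℕ → ℝ
  | 2 => 1.61
  | 3 => 1.83
  | 4 => 1.92
  | 5 => 1.96
  | 6 => 1.98
  | 7 => 1.99
  | _ => 1.995

/-- The natural-number quotient `i / 100` is constant on blocks of 100 indices, which leaves 100
copies of a geometric series. -/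
lemma sum_range_inv_pow_div (θ : ℝ) (h1 : 1 < θ) (N : ℕ) :
    ∑ i ∈ Finset.range N, 1 / θ ^ (i / 100 + 1) ≤ 100 / (θ - 1) := by
  have h0 : 0 < θ := by linarith
  have hblock : ∀ K : ℕ, ∑ i ∈ Finset.range (100 * K), 1 / θ ^ (i / 100 + 1) =
      100 / (θ - 1) - 100 / (θ ^ K * (θ - 1)) := by
    intro K
    have h3 : θ - 1 ≠ 0 := by linarith
    induction K with
    | zero => simp
    | succ K ih =>
      rw [Nat.mul_succ, Finset.sum_range_add, ih]
      have : ∀ i ∈ Finset.range 100, 1 / θ ^ ((100 * K + i) / 100 + 1) = 1 / θ ^ (K + 1) := by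
        intro i hi
        rw [Finset.mem_range] at hi
        rw [show (100 * K + i) / 100 = K by omega]
      rw [Finset.sum_congr rfl this, Finset.sum_const, Finset.card_range, pow_succ]
      simp only [nsmul_eq_mul]
      field_simp
      push_cast
      ring
  calc _ ≤ ∑ i ∈ Finset.range (100 * N), 1 / θ ^ (i / 100 + 1) :=
        Finset.sum_le_sum_of_subset_of_nonneg
          (Finset.range_subset_range.2 (by omega)) fun i _ _ => by positivity
    _ ≤ _ := by
        rw [hblock]
        have : 0 < θ - 1 := by linarith
        have : 0 ≤ 100 / (θ ^ N * (θ - 1)) := by positivity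
        linarith

/-- At the integer level `i`, `s > i * (0.01 + f)` forces `s ≥ i * f + (i / 100 + 1)` by
integrality. Exponential bounds from level `2` on contribute at most `100`, and the trivial bound on
the interval from `0` to `2` adds `2`. -/
theorem layered_centi : Layered 0.01 0 102 := by
  let b : ℕ → ℝ := fun i => 1 / centiTheta i ^ (i / 100 + 1)
  have hbase : Layered 0.01 2 100 := by
    have hth : ∀ i, 1 < centiTheta i ∧ centiTheta i ≤ 2 := by
      intro i; unfold centiTheta; split <;> norm_num
    have hth8 : ∀ i, centiTheta (8 + i) = 1.995 := by
      intro i; unfold centiTheta; split <;> first | omega | rfl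
    -- Levels `2` to `7` use the largest admissible two-decimal `θ`. From level `8` on `1.995` is
    -- fixed, and increasing the exponent helps.
    have hpow : ∀ i, 1 ≤ (2 - centiTheta (2 + i)) * centiTheta (2 + i) ^ (2 + i) := by
      intro i
      rcases lt_or_ge i 6 with h | h
      · interval_cases i <;> norm_num [centiTheta]
      · obtain ⟨j, rfl⟩ := Nat.exists_eq_add_of_le h
        rw [show 2 + (6 + j) = 8 + j by ring, hth8]
        calc (1 : ℝ) ≤ (2 - 1.995) * 1.995 ^ 8 := by norm_num
          _ ≤ _ := by gcongr <;> norm_num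
    refine ⟨fun i => ((2 + i : ℕ) : ℝ), fun i s f => centiTheta (2 + i) ^ s *
      (2 - centiTheta (2 + i)) ^ f / centiTheta (2 + i) ^ ((2 + i) / 100 + 1), by simp,
      fun i j hij => by simpa using hij, ?_, fun i => ?_, fun N => ?_⟩
    · push_cast
      exact Filter.tendsto_atTop_add_const_left _ _ tendsto_natCast_atTop_atTop
    · refine isHitBound_exp (hth _).1.le (hth _).2 (hpow i) fun s f h => ?_
      have h' : (2 + i) * (1 + 100 * f) < 100 * s := by
        have : ((2 + i : ℕ) : ℝ) * (1 + 100 * f) < 100 * s := by linarith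
        exact_mod_cast this
      have h2 : 2 + i + 100 * ((2 + i) * f) < 100 * s := by linarith
      omega
    · have hle : ∑ i ∈ Finset.range N, (((2 + (i + 1) : ℕ) : ℝ) - ((2 + i : ℕ) : ℝ)) *
          (centiTheta (2 + i) ^ 0 * (2 - centiTheta (2 + i)) ^ 0 /
            centiTheta (2 + i) ^ ((2 + i) / 100 + 1)) = ∑ i ∈ Finset.range N, b (2 + i) := by
        refine Finset.sum_congr rfl fun i _ => ?_
        simp only [b]; push_cast; ring
      rw [hle]
      have hb0 : ∀ i, 0 ≤ b i := fun i => by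
        have := (hth i).1
        have : 0 < centiTheta i := by linarith
        simp only [b]; positivity
      -- The full series for `θ = 1.995` would include the eight indices below `8`, each
      -- contributing `1 / 1.995`; these are subtracted.
      have hb8 : ∑ i ∈ Finset.range N, b (8 + i) ≤ 100 / (1.995 - 1) - 8 / 1.995 := by
        have h1 := sum_range_inv_pow_div 1.995 (by norm_num) (8 + N)
        rw [Finset.sum_range_add] at h1
        have h2 : ∑ i ∈ Finset.range 8, 1 / (1.995 : ℝ) ^ (i / 100 + 1) = 8 / 1.995 := by
          norm_num [Finset.sum_range_succ]
        have h3 : ∑ i ∈ Finset.range N, b (8 + i) =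
            ∑ i ∈ Finset.range N, 1 / (1.995 : ℝ) ^ ((8 + i) / 100 + 1) :=
          Finset.sum_congr rfl fun i _ => by simp only [b, hth8]
        rw [h3]; linarith
      calc ∑ i ∈ Finset.range N, b (2 + i) ≤ ∑ i ∈ Finset.range (6 + N), b (2 + i) :=
            Finset.sum_le_sum_of_subset_of_nonneg
              (Finset.range_subset_range.2 (by omega)) fun i _ _ => hb0 _
        _ = ∑ i ∈ Finset.range 6, b (2 + i) + ∑ i ∈ Finset.range N, b (8 + i) := by
            rw [Finset.sum_range_add]
            congr 1
            exact Finset.sum_congr rfl fun i _ => by congr 1; ring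
        _ ≤ ∑ i ∈ Finset.range 6, b (2 + i) + (100 / (1.995 - 1) - 8 / 1.995) := by gcongr
        _ ≤ 100 := by norm_num [Finset.sum_range_succ, b, centiTheta]
  have h0 := hbase.prepend (y := 0) (V := fun _ _ => 1) (b := 1) (by norm_num) (isHitBound_one _)
    le_rfl
  exact h0.mono (by norm_num)

end GGMKnockoff

namespace GGMKnockoff

/-! ### The maximal ratio of sign-symmetric statistics -/

section SignSymmetry

variable {ι : Type*}

lemma measurable_posCount_abs (H : Finset ι) (j : ι) :
    Measurable fun w : ι → ℝ => (posCount H w |w j| : ℝ≥0∞) := by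
  classical
  have : (fun w : ι → ℝ => (posCount H w |w j| : ℝ≥0∞)) =
      fun w => ∑ k ∈ H, if |w j| ≤ w k then (1 : ℝ≥0∞) else 0 := by
    ext w
    rw [posCount, Finset.card_filter]
    push_cast
    rfl
  rw [this]
  refine Finset.measurable_fun_sum _ fun k _ => Measurable.ite ?_ measurable_const measurable_const
  exact measurableSet_le (by fun_prop) (by fun_prop)

lemma measurable_negCount_abs (H : Finset ι) (j : ι) :
    Measurable fun w : ι → ℝ => (negCount H w |w j| : ℝ≥0∞) := by
  classical
  have : (fun w : ι → ℝ => (negCount H w |w j| : ℝ≥0∞)) =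
      fun w => ∑ k ∈ H, if w k ≤ -|w j| then (1 : ℝ≥0∞) else 0 := by
    ext w
    rw [negCount, Finset.card_filter]
    push_cast
    rfl
  rw [this]
  refine Finset.measurable_fun_sum _ fun k _ => Measurable.ite ?_ measurable_const measurable_const
  exact measurableSet_le (by fun_prop) (by fun_prop)

lemma measurable_maxRatio [Countable ι] (a : ℝ) (H : Finset ι) :
    Measurable (maxRatio a H : (ι → ℝ) → ℝ≥0∞) := by
  classical
  unfold maxRatio
  refine Measurable.iSup fun j => ?_
  simp only [iSup_eq_if]
  refine Measurable.ite ?_ ?_ measurable_const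
  · exact (measurableSet_eq_fun (by fun_prop) measurable_const).compl
  · exact (measurable_posCount_abs H j).div
      (measurable_const.add (measurable_negCount_abs H j))

/-- Single flips are composed. The maps need not commute, since only their effect on `w` matters. -/
lemma exists_measurePreserving_flipOn [DecidableEq ι] {E : Type*} [MeasurableSpace E]
    {ν : Measure E} {w : E → ι → ℝ} (H : Finset ι)
    (hflip : ∀ j ∈ H, ∃ R : E → E, MeasurePreserving R ν ν ∧ ∀ e, w (R e) = flipOn {j} (w e)) :
    ∃ R : E → E, MeasurePreserving R ν ν ∧ ∀ e, w (R e) = flipOn H (w e) := by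
  induction H using Finset.induction_on with
  | empty => exact ⟨id, MeasurePreserving.id ν, fun e => by simp [flipOn_empty]⟩
  | insert a F ha ih =>
    obtain ⟨R, hR, hRw⟩ := ih fun j hj => hflip j (Finset.mem_insert_of_mem hj)
    obtain ⟨Q, hQ, hQw⟩ := hflip a (Finset.mem_insert_self a F)
    refine ⟨Q ∘ R, hQ.comp hR, fun e => ?_⟩
    rw [Function.comp_apply, hQw, hRw, flipOn_insert ha]

/-- By invariance each of the `2 ^ H.card` flipped ratios has the same integral, so the integral
equals that of their average, which is bounded pointwise. Conditioning on the moduli is thereby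
avoided. -/
theorem Layered.lintegral_maxRatio_le [Countable ι] [DecidableEq ι] {a c : ℝ} (ha : 0 < a)
    (h : Layered a 0 c) {E : Type*} [MeasurableSpace E] {ν : Measure E} [IsProbabilityMeasure ν]
    {w : E → ι → ℝ} (hw : Measurable w) (H : Finset ι)
    (hflip : ∀ j ∈ H, ∃ R : E → E, MeasurePreserving R ν ν ∧ ∀ e, w (R e) = flipOn {j} (w e)) :
    ∫⁻ e, maxRatio a H (w e) ∂ν ≤ ENNReal.ofReal c := by
  have hm : Measurable fun e => maxRatio a H (w e) := (measurable_maxRatio a H).comp hw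
  have hF : ∀ F ∈ H.powerset, ∫⁻ e, maxRatio a H (flipOn F (w e)) ∂ν =
      ∫⁻ e, maxRatio a H (w e) ∂ν := by
    intro F hF
    obtain ⟨R, hR, hRw⟩ := exists_measurePreserving_flipOn F
      fun j hj => hflip j (Finset.mem_powerset.1 hF hj)
    simp only [← hRw]
    exact hR.lintegral_comp hm
  have hflipm : ∀ F : Finset ι, Measurable fun v : ι → ℝ => flipOn F v := by
    intro F
    refine measurable_pi_lambda _ fun k => ?_
    unfold flipOn
    split_ifs <;> fun_prop
  have hsum : (2 : ℝ≥0∞) ^ H.card * ∫⁻ e, maxRatio a H (w e) ∂ν ≤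
      2 ^ H.card * ENNReal.ofReal c := by
    calc (2 : ℝ≥0∞) ^ H.card * ∫⁻ e, maxRatio a H (w e) ∂ν
        = ∑ F ∈ H.powerset, ∫⁻ e, maxRatio a H (flipOn F (w e)) ∂ν := by
          rw [Finset.sum_congr rfl hF]
          simp
      _ = ∫⁻ e, ∑ F ∈ H.powerset, maxRatio a H (flipOn F (w e)) ∂ν :=
          (lintegral_finsetSum _ fun F _ =>
            (measurable_maxRatio a H).comp ((hflipm F).comp hw)).symm
      _ ≤ ∫⁻ _, 2 ^ H.card * ENNReal.ofReal c ∂ν :=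
          lintegral_mono fun e => h.sum_maxRatio_le ha H (w e)
      _ = 2 ^ H.card * ENNReal.ofReal c := by simp
  exact (ENNReal.mul_le_mul_iff_right (by positivity) (by simp)).1 hsum

end SignSymmetry

/-! ### False discoveries are controlled by the maximal ratios -/

section Deterministic

variable {p : ℕ} {r : EdgeRule} {q δ : ℝ} {ac : ℝ × ℝ} {W : Fin p → Fin p → ℝ}

lemma searchDown_spec (k : ℕ) : IsFeasible r q δ ac W (searchDown r q δ ac W k) ∨
    searchDown r q δ ac W k = fun _ => ⊤ := by
  induction k with
  | zero =>
    rw [searchDown]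
    split_ifs with h
    · exact Or.inl h
    · exact Or.inr rfl
  | succ k ih =>
    rw [searchDown]
    split_ifs with h
    · exact Or.inl h
    · exact ih

/-- This is all that is needed about the search: feasibility, or an empty edge set. -/
lemma threshold_spec : IsFeasible r q δ ac W (threshold r q δ ac W) ∨
    threshold r q δ ac W = fun _ => ⊤ := by
  rw [threshold]
  split_ifs
  · exact Or.inr rfl
  · exact searchDown_spec _

lemma posSet_top (i : Fin p) : posSet W i ⊤ = ∅ := by
  simp [posSet]

lemma edgesOf_empty : edgesOf r (fun _ : Fin p => (∅ : Finset (Fin p))) = ∅ := by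
  cases r <;> simp [edgesOf]

lemma estEdges_top : estEdges r W (fun _ => ⊤) = ∅ := by
  simp [estEdges, posSet_top, edgesOf_empty]

/-- Every finite admissible threshold is a nonzero modulus, hence a competitor in `maxRatio`; at `⊤`
nothing is selected. Passing from negative nulls to all negatives only enlarges the right-hand side.
-/
lemma card_le_maxRatio_mul {a : ℝ} (ha : 0 < a) (H : Finset (Fin p)) (i : Fin p) {t : EReal}
    (ht : t ∈ thresholdCandidates W i) :
    ((H ∩ posSet W i t).card : ℝ≥0∞) ≤
      maxRatio a H (W i) * (ENNReal.ofReal a + ((negSet W i t).card : ℝ≥0∞)) := by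
  rw [thresholdCandidates, Finset.mem_erase, Finset.mem_insert] at ht
  obtain ⟨ht0, rfl | ht⟩ := ht
  · simp [posSet_top]
  · obtain ⟨j, -, rfl⟩ := Finset.mem_image.1 ht
    have hj : W i j ≠ 0 := by
      rintro h; exact ht0 (by simp [h])
    have hP : (H ∩ posSet W i ((|W i j| : ℝ) : EReal)).card = posCount H (W i) |W i j| := by
      unfold posCount posSet
      congr 1
      ext k
      simp
    have hM : negCount H (W i) |W i j| ≤ (negSet W i ((|W i j| : ℝ) : EReal)).card := by
      unfold negCount negSet
      refine Finset.card_le_card fun k hk => ?_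
      rw [Finset.mem_filter] at hk ⊢
      refine ⟨Finset.mem_univ _, ?_⟩
      rw [← EReal.coe_neg, EReal.coe_le_coe_iff]
      exact hk.2
    rw [hP]
    have h1 : (posCount H (W i) |W i j| : ℝ≥0∞) /
        (ENNReal.ofReal a + (negCount H (W i) |W i j| : ℝ≥0∞)) ≤ maxRatio a H (W i) := by
      unfold maxRatio
      exact le_iSup₂ (f := fun j (_ : W i j ≠ 0) => (posCount H (W i) |W i j| : ℝ≥0∞) /
        (ENNReal.ofReal a + (negCount H (W i) |W i j| : ℝ≥0∞))) j hj
    have ha' : ENNReal.ofReal a ≠ 0 := by simpa using ha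
    rw [ENNReal.div_le_iff (by simp [ha']) (by simp)] at h1
    refine h1.trans ?_
    gcongr

/-- `2` for AND and `1` for OR: the number of neighbourhood selections behind an edge. -/
def EdgeRule.mult : EdgeRule → ℕ
  | .AND => 2
  | .OR => 1

lemma constraintLevel_eq (c : ℝ) :
    constraintLevel p r q c = r.mult * (q / (c * p)) := by
  cases r
  · simp only [constraintLevel, EdgeRule.mult]; push_cast; ring
  · simp [constraintLevel, EdgeRule.mult]

open Classical in
lemma mem_estEdges {T : Fin p → EReal} {e : Fin p × Fin p} :
    e ∈ estEdges r W T ↔ e.1 < e.2 ∧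
      match r with
      | .AND => e.1 ∈ posSet W e.2 (T e.2) ∧ e.2 ∈ posSet W e.1 (T e.1)
      | .OR => e.1 ∈ posSet W e.2 (T e.2) ∨ e.2 ∈ posSet W e.1 (T e.1) := by
  rw [estEdges, edgesOf, Finset.mem_filter]
  exact and_iff_right (Finset.mem_univ _)

open Classical in
-- Both sides count ordered pairs of a node and a selected null. The pairs with increasing and with
-- non-increasing entries are disjoint; AND puts both orientations of an edge into the count, OR at
-- least one.
lemma mult_card_le_sum {T : Fin p → EReal} {H : Fin p → Finset (Fin p)}
    {F : Finset (Fin p × Fin p)} (hF : F ⊆ estEdges r W T)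
    (hH : ∀ e ∈ F, e.2 ∈ H e.1 ∧ e.1 ∈ H e.2) :
    r.mult * F.card ≤ ∑ i, (H i ∩ posSet W i (T i)).card := by
  set S : Finset (Fin p × Fin p) :=
    Finset.univ.filter fun e => e.2 ∈ H e.1 ∩ posSet W e.1 (T e.1) with hS
  have hcard : ∑ i, (H i ∩ posSet W i (T i)).card = S.card := by
    rw [hS, Finset.card_filter, ← Finset.univ_product_univ, Finset.sum_product]
    refine Finset.sum_congr rfl fun i _ => ?_
    rw [← Finset.card_filter]
    congr 1
    ext k
    simp
  set S1 := S.filter fun e => e.1 < e.2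
  set S2 := S.filter fun e => ¬ e.1 < e.2
  have hsplit : S1.card + S2.card = S.card := Finset.card_filter_add_card_filter_not _
  have hswap : ∀ G : Finset (Fin p × Fin p), (G.image Prod.swap).card = G.card := fun G =>
    Finset.card_image_of_injective _ Prod.swap_injective
  rw [hcard]
  cases r with
  | AND =>
    have hmem : ∀ e ∈ F,
        e.1 < e.2 ∧ e.1 ∈ posSet W e.2 (T e.2) ∧ e.2 ∈ posSet W e.1 (T e.1) :=
      fun e he => mem_estEdges.1 (hF he)
    have h1 : F ⊆ S1 := by
      intro e he
      simp only [S1, hS, Finset.mem_filter, Finset.mem_univ, true_and, Finset.mem_inter]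
      exact ⟨⟨(hH e he).1, (hmem e he).2.2⟩, (hmem e he).1⟩
    have h2 : F.image Prod.swap ⊆ S2 := by
      intro e' he'
      obtain ⟨e, he, rfl⟩ := Finset.mem_image.1 he'
      simp only [S2, hS, Finset.mem_filter, Finset.mem_univ, true_and, Finset.mem_inter,
        Prod.fst_swap, Prod.snd_swap, not_lt]
      exact ⟨⟨(hH e he).2, (hmem e he).2.1⟩, (hmem e he).1.le⟩
    have h3 := Finset.card_le_card h1
    have h4 := Finset.card_le_card h2
    rw [hswap] at h4
    simp only [EdgeRule.mult]
    omega
  | OR =>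
    have hmem : ∀ e ∈ F,
        e.1 < e.2 ∧ (e.1 ∈ posSet W e.2 (T e.2) ∨ e.2 ∈ posSet W e.1 (T e.1)) :=
      fun e he => mem_estEdges.1 (hF he)
    have h1 : F ⊆ S1 ∪ S2.image Prod.swap := by
      intro e he
      rw [Finset.mem_union]
      rcases (hmem e he).2 with h | h
      · right
        refine Finset.mem_image.2 ⟨e.swap, ?_, Prod.swap_swap e⟩
        simp only [S2, hS, Finset.mem_filter, Finset.mem_univ, true_and, Finset.mem_inter,
          Prod.fst_swap, Prod.snd_swap, not_lt]
        exact ⟨⟨(hH e he).2, h⟩, (hmem e he).1.le⟩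
      · left
        simp only [S1, hS, Finset.mem_filter, Finset.mem_univ, true_and, Finset.mem_inter]
        exact ⟨⟨(hH e he).1, h⟩, (hmem e he).1⟩
    have h2 := (Finset.card_le_card h1).trans (Finset.card_union_le _ _)
    rw [hswap] at h2
    simp only [EdgeRule.mult]
    omega

/-- The multiplicity of an edge cancels against the same factor in the constraint level. The
denominator `d` is left free to cover both error rates. -/
lemma card_div_le_sum_maxRatio {a c : ℝ} (ha : 0 < a) (hc : 0 < c) (hq : 0 ≤ q)
    {T : Fin p → EReal} (hT : ∀ i, T i ∈ thresholdCandidates W i) {H : Fin p → Finset (Fin p)}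
    {F : Finset (Fin p × Fin p)} (hF : F ⊆ estEdges r W T)
    (hH : ∀ e ∈ F, e.2 ∈ H e.1 ∧ e.1 ∈ H e.2) {d : ℝ} (hd : 0 < d)
    (hle : ∀ i, a + (negSet W i (T i)).card ≤ constraintLevel p r q c * d) :
    (F.card : ℝ≥0∞) / ENNReal.ofReal d ≤
      ENNReal.ofReal (q / (c * p)) * ∑ i, maxRatio a (H i) (W i) := by
  classical
  have hκ : 0 ≤ q / (c * p) := by positivity
  rw [ENNReal.div_le_iff (by simpa using hd) (by simp)]
  have h1 : (r.mult : ℝ≥0∞) * F.card ≤ r.mult *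
      (ENNReal.ofReal (q / (c * p)) * (∑ i, maxRatio a (H i) (W i)) * ENNReal.ofReal d) := by
    calc (r.mult : ℝ≥0∞) * F.card ≤ ∑ i, ((H i ∩ posSet W i (T i)).card : ℝ≥0∞) := by
          exact_mod_cast mult_card_le_sum hF hH
      _ ≤ ∑ i, maxRatio a (H i) (W i) *
            (ENNReal.ofReal (r.mult * (q / (c * p)) * d)) := by
          refine Finset.sum_le_sum fun i _ => (card_le_maxRatio_mul ha (H i) i (hT i)).trans ?_
          gcongr
          rw [← constraintLevel_eq, ← ENNReal.ofReal_natCast,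
            ← ENNReal.ofReal_add ha.le (by positivity)]
          exact ENNReal.ofReal_le_ofReal (hle i)
      _ = _ := by
          rw [← Finset.sum_mul, ENNReal.ofReal_mul (by positivity),
            ENNReal.ofReal_mul (by positivity), ENNReal.ofReal_natCast]
          ring
  have hm : (r.mult : ℝ≥0∞) ≠ 0 := by cases r <;> simp [EdgeRule.mult]
  exact (ENNReal.mul_le_mul_iff_right hm (by simp)).1 h1

theorem fdp_le_sum_maxRatio {a c : ℝ} (ha : 0 < a) (hc : 0 < c) (hq : 0 ≤ q)
    {H : Fin p → Finset (Fin p)} {F : Finset (Fin p × Fin p)}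
    (hF : F ⊆ estEdges r W (threshold r q 1 (a, c) W))
    (hH : ∀ e ∈ F, e.2 ∈ H e.1 ∧ e.1 ∈ H e.2) :
    (F.card : ℝ≥0∞) / max ((estEdges r W (threshold r q 1 (a, c) W)).card : ℝ≥0∞) 1 ≤
      ENNReal.ofReal (q / (c * p)) * ∑ i, maxRatio a (H i) (W i) := by
  set E := estEdges r W (threshold r q 1 (a, c) W) with hE
  rcases threshold_spec (r := r) (q := q) (δ := 1) (ac := (a, c)) (W := W) with h | h
  · have hd : (0 : ℝ) < max (E.card : ℝ) 1 := by positivity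
    have := card_div_le_sum_maxRatio ha hc hq (fun i => (h i).2) hF hH hd fun i => by
      have h1 := (h i).1
      rw [div_le_iff₀ (by positivity)] at h1
      simpa using h1
    convert this using 2
    rw [ENNReal.ofReal_max]
    simp
  · rw [hE, h, estEdges_top] at hF
    rw [Finset.subset_empty.1 hF]
    simp

theorem mfdp_le_sum_maxRatio {a c : ℝ} (ha : 0 < a) (hc : 0 < c) (hq : 0 ≤ q)
    {H : Fin p → Finset (Fin p)} {F : Finset (Fin p × Fin p)}
    (hF : F ⊆ estEdges r W (threshold r q 0 (a, c) W))
    (hH : ∀ e ∈ F, e.2 ∈ H e.1 ∧ e.1 ∈ H e.2) {h : Hyper p} (hac : h.ac = (a, c))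
    (hr : h.rule = r) :
    (F.card : ℝ≥0∞) / ((estEdges r W (threshold r q 0 (a, c) W)).card + mFDROffset q h) ≤
      ENNReal.ofReal (q / (c * p)) * ∑ i, maxRatio a (H i) (W i) := by
  set E := estEdges r W (threshold r q 0 (a, c) W) with hE
  rcases F.eq_empty_or_nonempty with rfl | ⟨e, he⟩
  · simp
  -- A false edge exists from here on, so `p` is positive and the maximum with `1` in the constraint
  -- can be dropped.
  have hp : 0 < p := e.1.pos
  have hE1 : (1 : ℝ) ≤ E.card := by exact_mod_cast Finset.card_pos.2 ⟨e, hF he⟩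
  have hoff : mFDROffset q h = ENNReal.ofReal (a * c * p) / ENNReal.ofReal (r.mult * q) := by
    rw [mFDROffset, hac, hr]
    congr 2
    cases r
    · simp only [EdgeRule.mult]; push_cast; ring
    · simp [EdgeRule.mult]
  rcases hq.eq_or_lt with rfl | hq
  · have : ENNReal.ofReal (a * c * p) ≠ 0 := by
      simp only [ne_eq, ENNReal.ofReal_eq_zero, not_le]; positivity
    rw [hoff]
    simp [ENNReal.div_zero this]
  have hm : (0 : ℝ) < r.mult := by cases r <;> simp [EdgeRule.mult]
  rcases threshold_spec (r := r) (q := q) (δ := 0) (ac := (a, c)) (W := W) with h | h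
  · have hd : (0 : ℝ) < E.card + a * c * p / (r.mult * q) := by positivity
    have := card_div_le_sum_maxRatio ha hc hq.le (fun i => (h i).2) hF hH hd fun i => by
      have h1 := (h i).1
      rw [div_le_iff₀ (by positivity), ← hE, max_eq_left hE1] at h1
      -- The offset is chosen so that, times the constraint level, it gives exactly `a`.
      have : constraintLevel p r q c * (a * c * p / (r.mult * q)) = a := by
        rw [constraintLevel_eq]; field_simp
      rw [mul_add, this]
      simp only [mul_zero, zero_add] at h1
      linarith
    convert this using 2
    rw [hoff, ENNReal.ofReal_add (by positivity) (by positivity),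
      ENNReal.ofReal_div_of_pos (by positivity)]
    simp
  · rw [hE, h, estEdges_top] at hF
    rw [Finset.subset_empty.1 hF]
    simp

end Deterministic

end GGMKnockoff

namespace GGMKnockoff

/-! ### Linear algebra of knockoffs -/

section KnockoffAlgebra

variable {m ι : Type*}

lemma isKnockoff_iff_entries [Fintype m] [DecidableEq ι] {A B : Matrix m ι ℝ} :
    IsKnockoff A B ↔ ∃ s : ι → ℝ, (∀ j, 0 ≤ s j) ∧ ∀ k l,
      (∑ r, A r k * B r l = ∑ r, A r k * A r l - if k = l then s k else 0) ∧
      (∑ r, B r k * A r l = ∑ r, A r k * A r l - if k = l then s k else 0) ∧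
      ∑ r, B r k * B r l = ∑ r, A r k * A r l := by
  unfold IsKnockoff
  refine exists_congr fun s => and_congr_right fun _ => ?_
  simp only [← Matrix.ext_iff, Matrix.mul_apply, Matrix.sub_apply, Matrix.transpose_apply,
    Matrix.diagonal_apply]
  exact ⟨fun h k l => ⟨h.1 k l, h.2.1 k l, h.2.2 k l⟩,
    fun h => ⟨fun k l => (h k l).1, fun k l => (h k l).2.1, fun k l => (h k l).2.2⟩⟩

lemma scaleCols_eq_mul_diagonal [Fintype ι] [DecidableEq ι] (d : ι → ℝ) (X : Matrix m ι ℝ) :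
    scaleCols d X = X * Matrix.diagonal (fun j => (d j)⁻¹) := by
  ext k j
  simp [scaleCols, div_eq_mul_inv]

variable [Fintype m] [DecidableEq ι]

/-- For `k ≠ l` all four inner products between originals and knockoffs agree; for `k = l` both
columns are swapped or neither is. So swapping leaves the joint Gram matrix unchanged. -/
lemma IsKnockoff.sum_swapCols {A B : Matrix m ι ℝ} (h : IsKnockoff A B) (H : Finset ι) (k l : ι) :
    (∑ r, swapCols H A B r k * swapCols H A B r l = ∑ r, A r k * A r l) ∧
    (∑ r, swapCols H A B r k * swapCols H B A r l = ∑ r, A r k * B r l) ∧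
    (∑ r, swapCols H B A r k * swapCols H A B r l = ∑ r, B r k * A r l) ∧
    (∑ r, swapCols H B A r k * swapCols H B A r l = ∑ r, B r k * B r l) := by
  obtain ⟨s, -, hs⟩ := isKnockoff_iff_entries.1 h
  obtain ⟨h1, h2, h3⟩ := hs k l
  simp only [swapCols, Matrix.of_apply]
  by_cases hk : k ∈ H <;> by_cases hl : l ∈ H
  · simp [hk, hl, h1, h2, h3]
  · have : k ≠ l := fun h => hl (h ▸ hk)
    simp [hk, hl, h1, h2, h3, this]
  · have : k ≠ l := fun h => hk (h ▸ hl)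
    simp [hk, hl, h1, h2, h3, this]
  · simp [hk, hl]

lemma IsKnockoff.swapCols {A B : Matrix m ι ℝ} (h : IsKnockoff A B) (H : Finset ι) :
    IsKnockoff (swapCols H A B) (swapCols H B A) := by
  obtain ⟨s, hs0, hs⟩ := isKnockoff_iff_entries.1 h
  refine isKnockoff_iff_entries.2 ⟨s, hs0, fun k l => ?_⟩
  obtain ⟨h1, h2, h3, h4⟩ := h.sum_swapCols H k l
  rw [h1, h2, h3, h4]
  exact hs k l

lemma IsKnockoff.gram_swapCols {A B : Matrix m ι ℝ} (h : IsKnockoff A B) (H : Finset ι) :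
    (GGMKnockoff.swapCols H A B).transpose * GGMKnockoff.swapCols H A B = A.transpose * A := by
  ext k l
  simpa only [Matrix.mul_apply, Matrix.transpose_apply] using (h.sum_swapCols H k l).1

lemma IsKnockoff.gram_fromCols_swapCols {A B : Matrix m ι ℝ} (h : IsKnockoff A B)
    (H : Finset ι) :
    (Matrix.fromCols (GGMKnockoff.swapCols H A B) (GGMKnockoff.swapCols H B A)).transpose *
        Matrix.fromCols (GGMKnockoff.swapCols H A B) (GGMKnockoff.swapCols H B A) =
      (Matrix.fromCols A B).transpose * Matrix.fromCols A B := by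
  ext k l
  simp only [Matrix.mul_apply, Matrix.transpose_apply]
  rcases k with k | k <;> rcases l with l | l
  · simpa using (h.sum_swapCols H k l).1
  · simpa using (h.sum_swapCols H k l).2.1
  · simpa using (h.sum_swapCols H k l).2.2.1
  · simpa using (h.sum_swapCols H k l).2.2.2

lemma IsStrategySolution.nonneg [Fintype ι] {o : OptStrategy} {X : Matrix m ι ℝ} {s : ι → ℝ}
    (h : IsStrategySolution o (X.transpose * X) s) (j : ι) : 0 ≤ s j := by
  cases o with
  | equi =>
    rw [h j]
    refine le_min (mul_nonneg zero_le_two (Real.sInf_nonneg fun x hx => ?_)) zero_le_one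
    have hpsd : (X.transpose * X).PosSemidef := by
      simpa using Matrix.posSemidef_conjTranspose_mul_self X
    rw [hpsd.isHermitian.spectrum_real_eq_range_eigenvalues] at hx
    obtain ⟨k, rfl⟩ := hx
    exact hpsd.eigenvalues_nonneg k
  | sdp => exact (h.1.2 j).1

lemma IsConstructedKnockoff.isKnockoff [Fintype ι] {o : OptStrategy} {X Xt : Matrix m ι ℝ}
    (h : IsConstructedKnockoff o X Xt) (hX : IsUnit (X.transpose * X).det) :
    IsKnockoff X Xt := by
  obtain ⟨s, U, C, hs, hUU, hUX, hCC, rfl⟩ := h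
  have hXU : X.transpose * U = 0 := by
    have := congrArg Matrix.transpose hUX
    simpa [Matrix.transpose_mul] using this
  set G := X.transpose * X with hG
  have hGG : G * G⁻¹ = 1 := Matrix.mul_nonsing_inv G hX
  have hGG' : G⁻¹ * G = 1 := Matrix.nonsing_inv_mul G hX
  have hGt : G.transpose = G := by simp [hG, Matrix.transpose_mul]
  have hGit : G⁻¹.transpose = G⁻¹ := by rw [Matrix.transpose_nonsing_inv, hGt]
  set S := Matrix.diagonal s with hS
  have hSt : S.transpose = S := Matrix.diagonal_transpose s
  have h1 : X.transpose * (X * (1 - G⁻¹ * S) + U * C) = G - S := by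
    rw [Matrix.mul_add, ← Matrix.mul_assoc, ← Matrix.mul_assoc, hXU, Matrix.zero_mul, add_zero,
      ← hG, mul_sub, mul_one, ← mul_assoc, hGG, one_mul]
  have h2 : (X * (1 - G⁻¹ * S) + U * C).transpose * X = G - S := by
    have := congrArg Matrix.transpose h1
    rwa [Matrix.transpose_mul, Matrix.transpose_transpose, Matrix.transpose_sub, hGt, hSt] at this
  refine ⟨s, fun j => hs.nonneg j, h1, h2, ?_⟩
  -- The cross term vanishes because the columns of `U` are orthogonal to those of `X`.
  have h3 : (X * (1 - G⁻¹ * S) + U * C).transpose * (U * C) = C.transpose * C := by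
    rw [Matrix.transpose_add, Matrix.transpose_mul, Matrix.transpose_mul, Matrix.add_mul,
      ← Matrix.mul_assoc, Matrix.mul_assoc _ X.transpose U, hXU, Matrix.mul_zero, Matrix.zero_mul,
      zero_add, ← Matrix.mul_assoc, Matrix.mul_assoc _ U.transpose U, hUU, mul_one]
  rw [Matrix.mul_add, h3, ← Matrix.mul_assoc, h2, hCC, sub_mul, mul_sub, mul_one, ← mul_assoc,
    hGG, one_mul, mul_sub, mul_one, two_smul, mul_assoc]
  abel

lemma colNorm_ne_zero [Fintype ι] {X : Matrix m ι ℝ} (hX : IsUnit (X.transpose * X).det) (j : ι) :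
    colNorm X j ≠ 0 := by
  intro h
  rw [colNorm, Real.sqrt_eq_zero (Finset.sum_nonneg fun _ _ => sq_nonneg _),
    Finset.sum_eq_zero_iff_of_nonneg fun _ _ => sq_nonneg _] at h
  have hcol : ∀ k, X k j = 0 := fun k => by simpa using h k (Finset.mem_univ k)
  have : (X.transpose * X).det = 0 := Matrix.det_eq_zero_of_row_eq_zero j fun l => by
    simp [Matrix.mul_apply, hcol]
  rw [this] at hX
  exact not_isUnit_zero hX

/-- Undoing the scaling multiplies the diagonal entry `s j` by `d j ^ 2`, so it stays non-negative.
-/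
lemma IsKnockoff.of_scaleCols {X Xt : Matrix m ι ℝ} {d : ι → ℝ} (hd : ∀ j, d j ≠ 0)
    (h : IsKnockoff (scaleCols d X) (scaleCols d Xt)) : IsKnockoff X Xt := by
  obtain ⟨s, hs0, hs⟩ := isKnockoff_iff_entries.1 h
  refine isKnockoff_iff_entries.2
    ⟨fun j => d j ^ 2 * s j, fun j => mul_nonneg (sq_nonneg _) (hs0 j), fun k l => ?_⟩
  have hsc : ∀ A B : Matrix m ι ℝ, ∑ r, A r k * B r l =
      d k * d l * ∑ r, scaleCols d A r k * scaleCols d B r l := by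
    intro A B
    rw [Finset.mul_sum]
    refine Finset.sum_congr rfl fun r _ => ?_
    have h1 := hd k
    have h2 := hd l
    simp only [scaleCols, Matrix.of_apply]
    field_simp
  obtain ⟨h1, h2, h3⟩ := hs k l
  have hite : d k * d l * (if k = l then s k else 0) =
      if k = l then d k ^ 2 * s k else 0 := by
    split_ifs with hkl
    · subst hkl; ring
    · ring
  refine ⟨?_, ?_, ?_⟩
  · rw [hsc X Xt, h1, mul_sub, ← hsc X X, hite]
  · rw [hsc Xt X, h2, mul_sub, ← hsc X X, hite]
  · rw [hsc Xt Xt, h3, ← hsc X X]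

lemma isUnit_gram_scaleCols [Fintype ι] {X : Matrix m ι ℝ} {d : ι → ℝ} (hd : ∀ j, d j ≠ 0)
    (hX : IsUnit (X.transpose * X).det) :
    IsUnit ((scaleCols d X).transpose * scaleCols d X).det := by
  rw [scaleCols_eq_mul_diagonal, Matrix.transpose_mul, Matrix.diagonal_transpose,
    Matrix.mul_assoc, ← Matrix.mul_assoc _ X, ← mul_assoc, Matrix.det_mul, Matrix.det_mul]
  refine (IsUnit.mul ?_ hX).mul ?_ <;>
  · rw [Matrix.det_diagonal, isUnit_iff_ne_zero, Finset.prod_ne_zero_iff]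
    exact fun j _ => inv_ne_zero (hd j)

end KnockoffAlgebra

lemma IsKnockoffRule.isKnockoff {p : ℕ} {std : Bool} {o : OptStrategy} {K : KnockoffRule p}
    (hK : IsKnockoffRule std o K) {n : ℕ} (i : Fin p) {X : Matrix (Fin n) (Others i) ℝ}
    (hn : 2 * Fintype.card (Others i) ≤ n) (hX : IsUnit (X.transpose * X).det) :
    IsKnockoff X (K n i X) := by
  have h := hK.constructed n i X hn hX
  cases std with
  | true =>
    have hd := colNorm_ne_zero hX
    exact (IsConstructedKnockoff.isKnockoff h (isUnit_gram_scaleCols hd hX)).of_scaleCols hd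
  | false => exact IsConstructedKnockoff.isKnockoff h hX

/-! ### Reflections exchanging a variable with its knockoff -/

section Reflection

variable {m ι : Type*} [Fintype m] [DecidableEq ι]

/-- The reflection along the vector `v`. -/
noncomputable def reflectAlong (v : m → ℝ) (x : m → ℝ) : m → ℝ :=
  (WithLp.ofLp ((ℝ ∙ (WithLp.toLp 2 v : EuclideanSpace ℝ m))ᗮ.reflection (WithLp.toLp 2 x)))

lemma reflectAlong_add (v x y : m → ℝ) :
    reflectAlong v (x + y) = reflectAlong v x + reflectAlong v y := by
  simp [reflectAlong]

lemma reflectAlong_smul (v : m → ℝ) (c : ℝ) (x : m → ℝ) :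
    reflectAlong v (c • x) = c • reflectAlong v x := by
  simp [reflectAlong]

lemma reflectAlong_sum {κ : Type*} (s : Finset κ) (v : m → ℝ) (x : κ → m → ℝ) :
    reflectAlong v (∑ k ∈ s, x k) = ∑ k ∈ s, reflectAlong v (x k) := by
  classical
  induction s using Finset.induction_on with
  | empty => simp [reflectAlong]
  | insert a s ha ih => rw [Finset.sum_insert ha, Finset.sum_insert ha, reflectAlong_add, ih]

lemma dotProduct_reflectAlong (v x y : m → ℝ) :
    x ⬝ᵥ reflectAlong v y = reflectAlong v x ⬝ᵥ y := by
  have h : ∀ a b : m → ℝ, a ⬝ᵥ b =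
      inner ℝ (WithLp.toLp 2 a : EuclideanSpace ℝ m) (WithLp.toLp 2 b) := by
    intro a b
    rw [EuclideanSpace.inner_toLp_toLp, star_trivial, dotProduct_comm]
  rw [h, h]
  simp only [reflectAlong, WithLp.toLp_ofLp]
  set R := (ℝ ∙ (WithLp.toLp 2 v : EuclideanSpace ℝ m))ᗮ.reflection
  rw [← R.inner_map_map (WithLp.toLp 2 x) (R (WithLp.toLp 2 y))]
  simp [R]

lemma reflectAlong_of_dotProduct_eq_zero {v x : m → ℝ} (h : v ⬝ᵥ x = 0) :
    reflectAlong v x = x := by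
  unfold reflectAlong
  rw [Submodule.reflection_mem_subspace_eq_self]
  rw [Submodule.mem_orthogonal_singleton_iff_inner_right, EuclideanSpace.inner_toLp_toLp,
    star_trivial, dotProduct_comm]
  exact h

lemma reflectAlong_sub {x y : m → ℝ} (h : x ⬝ᵥ x = y ⬝ᵥ y) : reflectAlong (x - y) x = y := by
  have hn : ‖(WithLp.toLp 2 x : EuclideanSpace ℝ m)‖ = ‖(WithLp.toLp 2 y : EuclideanSpace ℝ m)‖ := by
    rw [EuclideanSpace.norm_eq, EuclideanSpace.norm_eq]
    congr 1
    simpa [dotProduct, sq] using h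
  exact congrArg WithLp.ofLp (Submodule.reflection_sub hn)

lemma reflectAlong_reflectAlong (v x : m → ℝ) : reflectAlong v (reflectAlong v x) = x := by
  simp [reflectAlong]

/-- The standard Gaussian is invariant under linear isometries. Other variances, including zero,
follow by scaling, which commutes with the reflection. -/
lemma measurePreserving_reflectAlong (σ : NNReal) (v : m → ℝ) :
    MeasurePreserving (reflectAlong v) (Measure.pi fun _ => gaussianReal 0 σ)
      (Measure.pi fun _ => gaussianReal 0 σ) := by
  have hstd : MeasurePreserving (reflectAlong v) (Measure.pi fun _ => gaussianReal 0 1)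
      (Measure.pi fun _ => gaussianReal 0 1) := by
    have h1 : MeasurePreserving (MeasurableEquiv.toLp 2 (m → ℝ))
        (Measure.pi fun _ => gaussianReal 0 1) (stdGaussian (EuclideanSpace ℝ m)) :=
      ⟨MeasurableEquiv.measurable _, map_pi_eq_stdGaussian⟩
    have h2 : MeasurePreserving
        ((ℝ ∙ (WithLp.toLp 2 v : EuclideanSpace ℝ m))ᗮ.reflection)
        (stdGaussian (EuclideanSpace ℝ m)) (stdGaussian (EuclideanSpace ℝ m)) :=
      ⟨LinearIsometryEquiv.continuous _ |>.measurable, stdGaussian_map _⟩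
    exact (h1.symm).comp (h2.comp h1)
  have hscale : MeasurePreserving (fun x : m → ℝ => (Real.sqrt σ) • x)
      (Measure.pi fun _ => gaussianReal 0 1) (Measure.pi fun _ => gaussianReal 0 σ) := by
    refine measurePreserving_pi (fun _ : m => gaussianReal 0 1) (fun _ => gaussianReal 0 σ)
      (f := fun _ x => Real.sqrt σ * x) fun _ => ⟨by fun_prop, ?_⟩
    rw [gaussianReal_map_const_mul]
    congr 1
    · simp
    · ext
      simp
  refine ⟨by unfold reflectAlong; fun_prop, ?_⟩
  rw [← hscale.map_eq, Measure.map_map (by unfold reflectAlong; fun_prop) hscale.measurable]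
  have : reflectAlong v ∘ (fun x : m → ℝ => (Real.sqrt σ) • x) =
      (fun x : m → ℝ => (Real.sqrt σ) • x) ∘ reflectAlong v := by
    ext1 x; exact reflectAlong_smul v _ x
  rw [this, ← Measure.map_map hscale.measurable hstd.measurable, hstd.map_eq]

variable {D Dt : Matrix m ι ℝ}

/-- Column `j` and its knockoff have equal length, so the reflection along their difference
exchanges them. The knockoff equations make every other column, original or knockoff, orthogonal to
this difference. -/
lemma IsKnockoff.reflectAlong_col (h : IsKnockoff D Dt) (j k : ι) :
    reflectAlong (D.col j - Dt.col j) (D.col k) = (GGMKnockoff.swapCols {j} D Dt).col k ∧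
    reflectAlong (D.col j - Dt.col j) (Dt.col k) = (GGMKnockoff.swapCols {j} Dt D).col k := by
  obtain ⟨s, -, hs⟩ := isKnockoff_iff_entries.1 h
  have hjj : D.col j ⬝ᵥ D.col j = Dt.col j ⬝ᵥ Dt.col j := by
    simpa [dotProduct, Matrix.col] using (hs j j).2.2.symm
  by_cases hk : k = j
  · subst hk
    have h1 := reflectAlong_sub hjj
    have hs1 : (GGMKnockoff.swapCols {k} D Dt).col k = Dt.col k := by
      ext r; simp [GGMKnockoff.swapCols, Matrix.col]
    have hs2 : (GGMKnockoff.swapCols {k} Dt D).col k = D.col k := by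
      ext r; simp [GGMKnockoff.swapCols, Matrix.col]
    rw [hs1, hs2]
    refine ⟨h1, ?_⟩
    have h2 := reflectAlong_reflectAlong (D.col k - Dt.col k) (D.col k)
    rwa [h1] at h2
  · have hs1 : (GGMKnockoff.swapCols {j} D Dt).col k = D.col k := by
      ext r; simp [GGMKnockoff.swapCols, Matrix.col, hk]
    have hs2 : (GGMKnockoff.swapCols {j} Dt D).col k = Dt.col k := by
      ext r; simp [GGMKnockoff.swapCols, Matrix.col, hk]
    have hjk : ¬ j = k := fun h => hk h.symm
    rw [hs1, hs2]
    obtain ⟨h1, h2, h3⟩ := hs j k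
    rw [if_neg hjk, sub_zero] at h1 h2
    constructor <;> refine reflectAlong_of_dotProduct_eq_zero ?_ <;>
      rw [sub_dotProduct] <;> simp only [dotProduct, Matrix.col, Matrix.transpose_apply]
    · rw [h2, sub_self]
    · rw [h1, h3, sub_self]

/-- The reflection is self-adjoint, so it can be moved from the response to the columns. -/
lemma IsKnockoff.mulVec_reflectAlong (h : IsKnockoff D Dt) (j : ι) (y : m → ℝ) :
    (Matrix.fromCols D Dt).transpose.mulVec (reflectAlong (D.col j - Dt.col j) y) =
      (Matrix.fromCols (GGMKnockoff.swapCols {j} D Dt)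
        (GGMKnockoff.swapCols {j} Dt D)).transpose.mulVec y := by
  ext k
  rcases k with k | k
  · have := congrArg (· ⬝ᵥ y) (h.reflectAlong_col j k).1
    simp only [← dotProduct_reflectAlong] at this
    exact this
  · have := congrArg (· ⬝ᵥ y) (h.reflectAlong_col j k).2
    simp only [← dotProduct_reflectAlong] at this
    exact this

/-- Only columns other than `j` enter `D.mulVec β`, and the reflection fixes these. -/
lemma IsKnockoff.reflectAlong_mulVec [Fintype ι] (h : IsKnockoff D Dt) {j : ι} {β : ι → ℝ} (hβ : β j = 0) :
    reflectAlong (D.col j - Dt.col j) (D.mulVec β) = D.mulVec β := by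
  have hsum : D.mulVec β = ∑ k, β k • D.col k := by
    ext r
    simp [Matrix.mulVec, dotProduct, Matrix.col, mul_comm]
  rw [hsum, reflectAlong_sum]
  refine Finset.sum_congr rfl fun k _ => ?_
  rw [reflectAlong_smul, (h.reflectAlong_col j k).1]
  by_cases hk : k = j
  · rw [hk, hβ, zero_smul, zero_smul]
  · congr 1
    ext r
    simp [GGMKnockoff.swapCols, Matrix.col, hk]

end Reflection

/-- Under sufficiency and antisymmetry, responses that have the same cross products with the
design as the original response has with the swapped design produce flipped statistics. -/
lemma statistics_flip {p : ℕ} {P : FeatureProcedure p} (hs : HasSufficiency P)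
    (ha : HasAntisymmetry P) {n : ℕ} {i : Fin p} {A B : Matrix (Fin n) (Others i) ℝ}
    (hA : IsUnit (A.transpose * A).det) (hAB : IsKnockoff A B) (H : Finset (Others i))
    {y y' : Fin n → ℝ}
    (hy : (Matrix.fromCols A B).transpose.mulVec y' =
      (Matrix.fromCols (swapCols H A B) (swapCols H B A)).transpose.mulVec y) (j : Others i) :
    P n i A B y' j = if j ∈ H then - P n i A B y j else P n i A B y j := by
  obtain ⟨f, -, hf⟩ := hs n i
  rw [← ha n i A B y hA hAB H j, hf A B y' hA hAB, hf (swapCols H A B) (swapCols H B A) y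
    (by rwa [hAB.gram_swapCols]) (hAB.swapCols H), hAB.gram_fromCols_swapCols, hy]

end GGMKnockoff

namespace GGMKnockoff

/-! ### Linear forms of a Gaussian vector -/

section LinearForms

variable {p : ℕ} {S : Matrix (Fin p) (Fin p) ℝ}

lemma dotProduct_ofLp_eq_inner (a : Fin p → ℝ) (x : EuclideanSpace ℝ (Fin p)) :
    a ⬝ᵥ x.ofLp = inner ℝ (WithLp.toLp 2 a : EuclideanSpace ℝ (Fin p)) x := by
  rw [EuclideanSpace.inner_eq_star_dotProduct, star_trivial, dotProduct_comm]

lemma covariance_dotProduct (hS : S.PosSemidef) (a b : Fin p → ℝ) :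
    cov[fun x : EuclideanSpace ℝ (Fin p) => a ⬝ᵥ x.ofLp,
      fun x : EuclideanSpace ℝ (Fin p) => b ⬝ᵥ x.ofLp; multivariateGaussian 0 S] =
      a ⬝ᵥ S.mulVec b := by
  have := covarianceBilin_multivariateGaussian (μ := 0) hS (WithLp.toLp 2 a) (WithLp.toLp 2 b)
  rw [covarianceBilin_apply_eq_cov IsGaussian.memLp_two_id] at this
  simpa only [dotProduct_ofLp_eq_inner] using this

lemma hasGaussianLaw_dotProduct (a : Fin p → ℝ) :
    HasGaussianLaw (fun x : EuclideanSpace ℝ (Fin p) => a ⬝ᵥ x.ofLp)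
      (multivariateGaussian 0 S) := by
  simp only [dotProduct_ofLp_eq_inner]
  exact IsGaussian.hasGaussianLaw_id.map_fun (innerSL ℝ (WithLp.toLp 2 a))

lemma integral_dotProduct (a : Fin p → ℝ) :
    ∫ x : EuclideanSpace ℝ (Fin p), a ⬝ᵥ x.ofLp ∂multivariateGaussian 0 S = 0 := by
  simp only [dotProduct_ofLp_eq_inner]
  have := (innerSL ℝ (WithLp.toLp 2 a : EuclideanSpace ℝ (Fin p))).integral_comp_id_comm
    (μ := multivariateGaussian 0 S) IsGaussian.integrable_id
  rw [integral_id_multivariateGaussian, map_zero] at this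
  exact this

lemma integral_dotProduct_mul (hS : S.PosSemidef) (a b : Fin p → ℝ) :
    ∫ x : EuclideanSpace ℝ (Fin p), (a ⬝ᵥ x.ofLp) * (b ⬝ᵥ x.ofLp) ∂multivariateGaussian 0 S =
      a ⬝ᵥ S.mulVec b := by
  rw [← covariance_dotProduct hS, covariance, integral_dotProduct, integral_dotProduct]
  simp

/-- Joint Gaussianity turns vanishing covariances into independence. -/
lemma indepFun_dotProduct (hS : S.PosSemidef) {J K : Type*} [Finite J] [Finite K]
    (a : J → Fin p → ℝ) (b : K → Fin p → ℝ) (h : ∀ j k, a j ⬝ᵥ S.mulVec (b k) = 0) :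
    IndepFun (fun (x : EuclideanSpace ℝ (Fin p)) j => a j ⬝ᵥ x.ofLp)
      (fun (x : EuclideanSpace ℝ (Fin p)) k => b k ⬝ᵥ x.ofLp) (multivariateGaussian 0 S) := by
  have := Fintype.ofFinite J
  have := Fintype.ofFinite K
  refine HasGaussianLaw.indepFun_of_covariance_eval ?_ fun j k => ?_
  · simp only [dotProduct_ofLp_eq_inner]
    exact IsGaussian.hasGaussianLaw_id.map_fun
      ((ContinuousLinearMap.pi fun j => innerSL ℝ (WithLp.toLp 2 (a j))).prod
        (ContinuousLinearMap.pi fun k => innerSL ℝ (WithLp.toLp 2 (b k))))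
  · rw [covariance_dotProduct hS, h]

end LinearForms

/-! ### Missing edges and zeros of the precision matrix -/

section CondIndep

lemma CondIndepFun.integral_mul_eq {Ω : Type*} {m' mΩ : MeasurableSpace Ω} [StandardBorelSpace Ω]
    {hm' : m' ≤ mΩ} {μ : Measure Ω} [IsFiniteMeasure μ] {f g : Ω → ℝ}
    (h : CondIndepFun m' hm' f g μ) (hf : Measurable f) (hg : Measurable g)
    (hfi : Integrable f μ) (hgi : Integrable g μ) (hfgi : Integrable (fun ω => f ω * g ω) μ) :
    ∫ ω, f ω * g ω ∂μ = ∫ ω, (μ[f | m']) ω * (μ[g | m']) ω ∂μ := by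
  rw [← integral_condExp hm']
  -- Conditional independence is an identity of composition-products; it yields independence under
  -- almost every conditional law.
  have hκ := (Kernel.indepFun_iff_compProd_map_prod_eq_compProd_prod_map_map hf hg).1 h
  have hae : ∀ᵐ ω ∂μ, IndepFun f g (condExpKernel μ m' ω) := by
    refine ae_of_ae_trim hm' ?_
    filter_upwards [Kernel.ae_eq_of_compProd_eq hκ] with ω hω
    rw [indepFun_iff_map_prod_eq_prod_map_map hf.aemeasurable hg.aemeasurable]
    rw [Kernel.map_apply _ (by fun_prop), Kernel.prod_apply, Kernel.map_apply _ hf,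
      Kernel.map_apply _ hg] at hω
    exact hω
  refine integral_congr_ae ?_
  filter_upwards [hae, condExp_ae_eq_integral_condExpKernel hm' hfi,
    condExp_ae_eq_integral_condExpKernel hm' hgi,
    condExp_ae_eq_integral_condExpKernel hm' hfgi] with ω h0 h1 h2 h3
  rw [h1, h2, h3]
  exact h0.integral_fun_mul_eq_mul_integral hf.aestronglyMeasurable hg.aestronglyMeasurable

variable {p : ℕ} {Om : Matrix (Fin p) (Fin p) ℝ}

lemma inv_mulVec_row (hOm : Om.PosDef) (i : Fin p) :
    Om⁻¹.mulVec (Om i) = Pi.single i 1 := by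
  have hu : IsUnit Om.det := (Matrix.isUnit_iff_isUnit_det _).1 hOm.isUnit
  have hsym : Om i = Om.mulVec (Pi.single i 1) := by
    ext k
    rw [Matrix.mulVec_single_one, Matrix.col_apply]
    simpa using (hOm.isHermitian.apply i k).symm
  rw [hsym, Matrix.mulVec_mulVec, Matrix.nonsing_inv_mul _ hu, Matrix.one_mulVec]

/-- Coordinate `i` is the residual `a ⬝ᵥ x` plus a combination of the conditioning coordinates. The
residual is uncorrelated with these, hence independent of them, and has mean zero. -/
lemma condExp_coord {i : Fin p} {m' : MeasurableSpace (EuclideanSpace ℝ (Fin p))}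
    {S : Matrix (Fin p) (Fin p) ℝ} (hS : S.PosSemidef) {K : Type*} [Finite K] (b : K → Fin p)
    (hm' : m' = MeasurableSpace.comap
      (fun (x : EuclideanSpace ℝ (Fin p)) (k : K) => x (b k)) inferInstance)
    (a : Fin p → ℝ) (ha : ∀ k, a ⬝ᵥ S.mulVec (Pi.single (b k) 1) = 0)
    (hsub : ∀ l, (∀ k, b k ≠ l) → (Pi.single i 1 - a : Fin p → ℝ) l = 0) :
    (multivariateGaussian 0 S)[fun x : EuclideanSpace ℝ (Fin p) => x i | m'] =ᵐ[
      multivariateGaussian 0 S] fun x => (Pi.single i 1 - a : Fin p → ℝ) ⬝ᵥ x.ofLp := by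
  have hle : m' ≤ WithLp.measurableSpace 2 (Fin p → ℝ) := by
    rw [hm']; exact Measurable.comap_le (by fun_prop)
  set γ := multivariateGaussian (0 : EuclideanSpace ℝ (Fin p)) S
  set c : Fin p → ℝ := Pi.single i 1 - a with hc
  have hint : ∀ d : Fin p → ℝ, Integrable (fun x : EuclideanSpace ℝ (Fin p) => d ⬝ᵥ x.ofLp) γ :=
    fun d => (hasGaussianLaw_dotProduct d).integrable
  have hsplit : (fun x : EuclideanSpace ℝ (Fin p) => x i) =
      (fun x : EuclideanSpace ℝ (Fin p) => a ⬝ᵥ x.ofLp) + fun x => c ⬝ᵥ x.ofLp := by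
    ext x
    rw [Pi.add_apply, ← add_dotProduct, hc, add_sub_cancel, single_one_dotProduct]
  have hmeasc : StronglyMeasurable[m'] fun x : EuclideanSpace ℝ (Fin p) => c ⬝ᵥ x.ofLp := by
    unfold dotProduct
    refine Finset.stronglyMeasurable_fun_sum _ fun l _ => ?_
    by_cases hl : ∃ k, b k = l
    · obtain ⟨k, rfl⟩ := hl
      refine StronglyMeasurable.const_mul (Measurable.stronglyMeasurable ?_) _
      have h1 : @Measurable _ _ m' _
          (fun (x : EuclideanSpace ℝ (Fin p)) (k : K) => x (b k)) := by
        rw [hm']; exact comap_measurable _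
      exact (measurable_pi_apply k).comp h1
    · have : c l = 0 := hsub l fun k hk => hl ⟨k, hk⟩
      simp only [this, zero_mul]
      exact stronglyMeasurable_const
  have hindep : γ[fun x : EuclideanSpace ℝ (Fin p) => a ⬝ᵥ x.ofLp | m'] =ᵐ[γ] fun _ => 0 := by
    have hI := indepFun_dotProduct hS (fun _ : Unit => a) (fun k => Pi.single (b k) 1)
      fun _ k => ha k
    have hI' : IndepFun (fun x : EuclideanSpace ℝ (Fin p) => a ⬝ᵥ x.ofLp)
        (fun (x : EuclideanSpace ℝ (Fin p)) k => x (b k)) γ := by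
      have := hI.comp (measurable_pi_apply ()) measurable_id
      simpa [Function.comp_def] using this
    have := condExp_indep_eq (m₁ := MeasurableSpace.comap
      (fun x : EuclideanSpace ℝ (Fin p) => a ⬝ᵥ x.ofLp) inferInstance) (m₂ := m') (μ := γ)
      (f := fun x : EuclideanSpace ℝ (Fin p) => a ⬝ᵥ x.ofLp)
      (Measurable.comap_le (by unfold dotProduct; fun_prop)) hle
      (comap_measurable _).stronglyMeasurable (by rw [hm']; exact hI')
    rwa [integral_dotProduct] at this
  rw [hsplit]
  filter_upwards [condExp_add (hint a) (hint c) m', hindep] with x h1 h2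
  rw [h1, Pi.add_apply, h2, zero_add, condExp_of_stronglyMeasurable hle hmeasc (hint c)]

/-- The residuals of `x i` and `x j` given the other coordinates have covariance `- b / det`, with
`det` the principal minor on `i` and `j`. Conditional independence makes it zero. -/
theorem precision_eq_zero_of_not_isEdge (hOm : Om.PosDef) {i j : Fin p} (hij : i ≠ j)
    (h : ¬ IsEdge Om i j) : Om i j = 0 := by
  have hci := not_not.1 fun hn => h ⟨hij, hn⟩
  have hS : Om⁻¹.PosSemidef := hOm.inv.posSemidef
  have hsym : ∀ k l, Om k l = Om l k := fun k l => by
    simpa using hOm.isHermitian.apply l k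
  have hSrow : ∀ k l, (Pi.single k 1 : Fin p → ℝ) ⬝ᵥ Om⁻¹.mulVec (Om l) = if k = l then 1 else 0 :=
    fun k l => by rw [inv_mulVec_row hOm, single_one_dotProduct, Pi.single_apply]
  have hrowS : ∀ k l, Om l ⬝ᵥ Om⁻¹.mulVec (Pi.single k 1) = if k = l then 1 else 0 := by
    intro k l
    rw [← hSrow k l, Matrix.dotProduct_mulVec, dotProduct_comm, ← Matrix.mulVec_transpose]
    rw [← Matrix.conjTranspose_eq_transpose_of_trivial, hS.isHermitian.eq]
  have hrow : ∀ k l, Om k ⬝ᵥ Om⁻¹.mulVec (Om l) = Om k l := by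
    intro k l; rw [inv_mulVec_row hOm, dotProduct_single_one]
  set a := Om i i
  set b := Om i j
  set c := Om j j
  have hdet : 0 < a * c - b * b := by
    have h0 := (hOm.submatrix (e := ![i, j]) (by
      intro x y hxy
      fin_cases x <;> fin_cases y <;> simp_all)).det_pos
    rw [Matrix.det_fin_two] at h0
    simpa [a, b, c, hsym j i] using h0
  set det := a * c - b * b
  -- The rows `Om i` and `Om j` give forms uncorrelated with all other coordinates. The inverse of
  -- the 2 by 2 block normalises their `i`, `j` entries to `(1, 0)` for `r₁` and `(0, 1)` for `r₂`.
  set r₁ : Fin p → ℝ := det⁻¹ • (c • Om i - b • Om j) with hr₁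
  set r₂ : Fin p → ℝ := det⁻¹ • (a • Om j - b • Om i) with hr₂
  let m' : MeasurableSpace (EuclideanSpace ℝ (Fin p)) := MeasurableSpace.comap
    (fun (x : EuclideanSpace ℝ (Fin p)) (k : {k : Fin p // k ≠ i ∧ k ≠ j}) => x k.1) inferInstance
  have hr₁S : ∀ k : {k : Fin p // k ≠ i ∧ k ≠ j}, r₁ ⬝ᵥ Om⁻¹.mulVec (Pi.single k.1 1) = 0 := by
    rintro ⟨k, hk1, hk2⟩
    simp only [hr₁, smul_dotProduct, sub_dotProduct, hrowS, if_neg hk1, if_neg hk2]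
    simp
  have hr₂S : ∀ k : {k : Fin p // k ≠ i ∧ k ≠ j}, r₂ ⬝ᵥ Om⁻¹.mulVec (Pi.single k.1 1) = 0 := by
    rintro ⟨k, hk1, hk2⟩
    simp only [hr₂, smul_dotProduct, sub_dotProduct, hrowS, if_neg hk1, if_neg hk2]
    simp
  have hval : ∀ l, (∀ k : {k : Fin p // k ≠ i ∧ k ≠ j}, k.1 ≠ l) → l = i ∨ l = j := by
    intro l hl
    by_contra hcon
    rw [not_or] at hcon
    exact hl ⟨l, hcon⟩ rfl
  have hE₁ := condExp_coord (i := i) (m' := m') hS Subtype.val rfl r₁ hr₁S (by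
    intro l hl
    rcases hval l hl with rfl | rfl
    · have : det⁻¹ * (c * a - b * b) = 1 := by
        rw [mul_comm c a]; exact inv_mul_cancel₀ hdet.ne'
      simp [hr₁, hsym j l, a, b, c] at this ⊢
      linarith
    · simp [hr₁, b, c, hij.symm]
      right; ring)
  have hE₂ := condExp_coord (i := j) (m' := m') hS Subtype.val rfl r₂ hr₂S (by
    intro l hl
    rcases hval l hl with rfl | rfl
    · simp [hr₂, a, b, hij, hsym j l]
      right; ring
    · have : det⁻¹ * (a * c - b * b) = 1 := inv_mul_cancel₀ hdet.ne'
      simp [hr₂, a, b, c] at this ⊢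
      linarith)
  have hcoord : ∀ k : Fin p, (fun x : EuclideanSpace ℝ (Fin p) => x k) =
      fun x => (Pi.single k 1 : Fin p → ℝ) ⬝ᵥ x.ofLp := fun k => by
    ext x; rw [single_one_dotProduct]
  have hLp : ∀ k : Fin p, MemLp (fun x : EuclideanSpace ℝ (Fin p) => x k) 2
      (multivariateGaussian 0 Om⁻¹) := fun k => by
    rw [hcoord]; exact (hasGaussianLaw_dotProduct _).memLp_two
  have key := CondIndepFun.integral_mul_eq hci (by fun_prop) (by fun_prop)
    ((hLp i).integrable (by norm_num)) ((hLp j).integrable (by norm_num))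
    ((hLp i).integrable_mul (hLp j))
  have h2 : ∫ x, ((multivariateGaussian 0 Om⁻¹)[fun x : EuclideanSpace ℝ (Fin p) => x i | m']) x *
      ((multivariateGaussian 0 Om⁻¹)[fun x : EuclideanSpace ℝ (Fin p) => x j | m']) x
        ∂multivariateGaussian 0 Om⁻¹ =
      (Pi.single i 1 - r₁) ⬝ᵥ Om⁻¹.mulVec (Pi.single j 1 - r₂) := by
    rw [← integral_dotProduct_mul hS]
    refine integral_congr_ae ?_
    filter_upwards [hE₁, hE₂] with x h1 h2
    rw [h1, h2]
  have h1 : ∫ x : EuclideanSpace ℝ (Fin p), x i * x j ∂multivariateGaussian 0 Om⁻¹ =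
      (Pi.single i 1 : Fin p → ℝ) ⬝ᵥ Om⁻¹.mulVec (Pi.single j 1) := by
    rw [← integral_dotProduct_mul hS]
    simp only [single_one_dotProduct]
  rw [h1] at key
  have key' := key.trans h2
  have e1 : (Pi.single i 1 : Fin p → ℝ) ⬝ᵥ Om⁻¹.mulVec r₂ = - det⁻¹ * b := by
    simp [hr₂, Matrix.mulVec_smul, Matrix.mulVec_sub, inv_mulVec_row hOm, hij.symm]
  have e2 : r₁ ⬝ᵥ Om⁻¹.mulVec (Pi.single j 1) = - det⁻¹ * b := by
    simp only [hr₁, smul_dotProduct, sub_dotProduct, hrowS, if_neg hij.symm, if_true]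
    simp
  have e3 : r₁ ⬝ᵥ Om⁻¹.mulVec r₂ = - det⁻¹ * b := by
    have : r₁ ⬝ᵥ Om⁻¹.mulVec r₂ = det⁻¹ * det⁻¹ * (- b * det) := by
      simp only [hr₁, hr₂, Matrix.mulVec_smul, Matrix.mulVec_sub, smul_dotProduct,
        sub_dotProduct, dotProduct_smul, dotProduct_sub, hrow, smul_eq_mul, hsym j i]
      simp only [a, b, c, det]
      ring
    rw [this]
    field_simp
  rw [Matrix.mulVec_sub, sub_dotProduct, dotProduct_sub, dotProduct_sub, e1, e2, e3] at key'
  have h0 : det⁻¹ * b = 0 := by linarith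
  rcases mul_eq_zero.1 h0 with h | h
  · exact absurd (inv_eq_zero.1 h) hdet.ne'
  · exact h

end CondIndep

end GGMKnockoff

namespace GGMKnockoff

/-! ### The law of a Gaussian sample -/

section SampleLaw

variable {p : ℕ} {Om : Matrix (Fin p) (Fin p) ℝ}

/-- The law of a row of the data matrix. -/
noncomputable def rowLaw (Om : Matrix (Fin p) (Fin p) ℝ) : Measure (Fin p → ℝ) :=
  (multivariateGaussian 0 Om⁻¹).map WithLp.ofLp

instance isProbabilityMeasure_rowLaw : IsProbabilityMeasure (rowLaw Om) :=
  Measure.isProbabilityMeasure_map (by fun_prop)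

/-- The law of a data matrix with rows indexed by `m`. -/
noncomputable def sampleLaw (Om : Matrix (Fin p) (Fin p) ℝ) (m : Type*) [Fintype m] :
    Measure (Matrix m (Fin p) ℝ) :=
  Measure.pi fun _ => rowLaw Om

instance isProbabilityMeasure_sampleLaw {m : Type*} [Fintype m] :
    IsProbabilityMeasure (sampleLaw Om m) :=
  inferInstanceAs (IsProbabilityMeasure (Measure.pi fun _ : m => rowLaw Om))

lemma measurable_of_entries {α m ι : Type*} [MeasurableSpace α] {f : α → Matrix m ι ℝ}
    (h : ∀ k j, Measurable fun a => f a k j) : Measurable f :=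
  measurable_pi_iff.2 fun k => measurable_pi_iff.2 fun j => h k j

lemma measurable_entry {m ι : Type*} (k : m) (j : ι) :
    Measurable fun X : Matrix m ι ℝ => X k j :=
  (measurable_pi_apply j).comp (measurable_pi_apply (X := fun _ : m => ι → ℝ) k)

lemma _root_.Measurable.entry {α m ι : Type*} [MeasurableSpace α] {f : α → Matrix m ι ℝ}
    (h : Measurable f) (k : m) (j : ι) : Measurable fun a => f a k j :=
  (measurable_entry k j).comp h

lemma IsGaussianSample.map_eq {Ω : Type*} [MeasurableSpace Ω] {μ : Measure Ω}
    [IsProbabilityMeasure μ] {n : ℕ} {X : Ω → Matrix (Fin n) (Fin p) ℝ}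
    (hX : IsGaussianSample μ Om X) : μ.map X = sampleLaw Om (Fin n) := by
  have hrow : ∀ k, Measurable fun ω => X ω k := fun k =>
    (measurable_pi_apply (X := fun _ : Fin n => Fin p → ℝ) k).comp hX.measurable
  have h1 := (iIndepFun_iff_map_fun_eq_pi_map fun k => (hrow k).aemeasurable).1 hX.indep
  refine Eq.trans h1 ?_
  unfold sampleLaw
  congr 1
  ext1 k
  have : (fun ω => X ω k) = WithLp.ofLp ∘ fun ω => (WithLp.toLp 2 (X ω k)) := rfl
  rw [this, ← Measure.map_map (by fun_prop) (by have := hrow k; fun_prop), hX.law k]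
  rfl

lemma measurePreserving_submatrix {m m' : Type*} [Fintype m] [Fintype m'] (e : m ≃ m') :
    MeasurePreserving (fun X : Matrix m' (Fin p) ℝ => X.submatrix e id) (sampleLaw Om m')
      (sampleLaw Om m) := by
  have := measurePreserving_piCongrLeft (fun _ : m => rowLaw Om) e.symm
  have hfun : (fun X : Matrix m' (Fin p) ℝ => X.submatrix e id) =
      MeasurableEquiv.piCongrLeft (fun _ : m => Fin p → ℝ) e.symm := by
    funext X k
    obtain ⟨k', rfl⟩ := e.symm.surjective k
    refine Eq.trans ?_
      (MeasurableEquiv.piCongrLeft_apply_apply (β := fun _ => Fin p → ℝ) e.symm X k').symm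
    funext j
    change X (e (e.symm k')) j = X k' j
    rw [Equiv.apply_symm_apply]
  rw [hfun]
  exact this

/-- Put two blocks of rows together. -/
def joinRows {a b m ι : Type*} (e : a ⊕ b ≃ m) (A : Matrix a ι ℝ) (B : Matrix b ι ℝ) :
    Matrix m ι ℝ :=
  Matrix.of fun k => Sum.elim A B (e.symm k)

lemma measurable_joinRows {a b m ι : Type*} (e : a ⊕ b ≃ m) :
    Measurable fun z : Matrix a ι ℝ × Matrix b ι ℝ => joinRows e z.1 z.2 := by
  refine measurable_of_entries fun k j => ?_
  simp only [joinRows, Matrix.of_apply]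
  rcases e.symm k with k | k
  · exact measurable_fst.entry k j
  · exact measurable_snd.entry k j

lemma measurePreserving_joinRows {a b m : Type*} [Fintype a] [Fintype b] [Fintype m]
    (e : a ⊕ b ≃ m) :
    MeasurePreserving
      (fun z : Matrix a (Fin p) ℝ × Matrix b (Fin p) ℝ => joinRows e z.1 z.2)
      ((sampleLaw Om a).prod (sampleLaw Om b)) (sampleLaw Om m) := by
  have h1 := measurePreserving_sumPiEquivProdPi_symm (fun _ : a ⊕ b => rowLaw Om)
  have h2 := measurePreserving_submatrix (Om := Om) e.symm
  refine Eq.mp (congrArg (fun f => MeasurePreserving f _ _) ?_) (h2.comp h1)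
  funext z
  ext k j
  change (Sum.rec (motive := fun _ => Fin p → ℝ) z.1 z.2 (e.symm k) : Fin p → ℝ) j =
    Sum.elim z.1 z.2 (e.symm k) j
  rcases e.symm k with k | k <;> rfl

/-- The coefficients of the regression of node `i` on the other nodes. -/
noncomputable def regCoef (Om : Matrix (Fin p) (Fin p) ℝ) (i : Fin p) : Others i → ℝ :=
  fun j => - (Om i i)⁻¹ * Om i j

/-- The data matrix with design `z.1` for node `i`, coefficients `β` and noise `z.2`. -/
noncomputable def assemble {m : Type*} (i : Fin p) (β : Others i → ℝ)
    (z : Matrix m (Others i) ℝ × (m → ℝ)) : Matrix m (Fin p) ℝ :=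
  Matrix.of fun k j => if h : j ≠ i then z.1 k ⟨j, h⟩ else z.1.mulVec β k + z.2 k

lemma sum_others (i : Fin p) (f : Fin p → ℝ) : ∑ j, f j = f i + ∑ j : Others i, f j := by
  rw [← Finset.add_sum_erase _ f (Finset.mem_univ i)]
  congr 1
  refine Finset.sum_subtype _ (fun j => by simp) f

lemma measurable_others (i : Fin p) :
    Measurable fun (x : Fin p → ℝ) (j : Others i) => x j := by fun_prop

/-- The law of the residual is Gaussian, and it is independent of the other nodes. -/
lemma exists_rowLaw_regression (hOm : Om.PosDef) (i : Fin p) : ∃ v : NNReal,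
    ((rowLaw Om).map (fun x (j : Others i) => x j)).prod (gaussianReal 0 v) =
      (rowLaw Om).map fun x => (fun j : Others i => x j, x i - ∑ j, regCoef Om i j * x j) := by
  have hii : Om i i ≠ 0 := hOm.diag_pos.ne'
  set a : Fin p → ℝ := (Om i i)⁻¹ • Om i with ha
  have hres : ∀ x : Fin p → ℝ, x i - ∑ j, regCoef Om i j * x j = a ⬝ᵥ x := by
    intro x
    rw [dotProduct, sum_others i]
    simp only [ha, Pi.smul_apply, smul_eq_mul, inv_mul_cancel₀ hii, one_mul, regCoef, neg_mul,
      Finset.sum_neg_distrib, sub_neg_eq_add]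
  refine ⟨Var[fun x : EuclideanSpace ℝ (Fin p) => a ⬝ᵥ x.ofLp;
    multivariateGaussian 0 Om⁻¹].toNNReal, ?_⟩
  · have hind := indepFun_dotProduct hOm.inv.posSemidef
      (fun j : Others i => (Pi.single j.1 1 : Fin p → ℝ)) (fun _ : Unit => a) (by
        intro j _
        rw [ha, Matrix.mulVec_smul, inv_mulVec_row hOm, dotProduct_smul, single_one_dotProduct,
          Pi.single_apply, if_neg j.2, smul_zero])
    have hind' : IndepFun (fun (x : EuclideanSpace ℝ (Fin p)) (j : Others i) => x j)
        (fun x : EuclideanSpace ℝ (Fin p) => a ⬝ᵥ x.ofLp) (multivariateGaussian 0 Om⁻¹) := by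
      have := hind.comp measurable_id (measurable_pi_apply ())
      simpa [Function.comp_def] using this
    have hma : Measurable fun x : EuclideanSpace ℝ (Fin p) => a ⬝ᵥ x.ofLp := by
      unfold dotProduct; fun_prop
    have hma' : Measurable fun x : Fin p → ℝ => a ⬝ᵥ x := by
      unfold dotProduct; fun_prop
    have hmap := (indepFun_iff_map_prod_eq_prod_map_map (by fun_prop) hma.aemeasurable).1 hind'
    rw [(hasGaussianLaw_dotProduct a).map_eq_gaussianReal, integral_dotProduct] at hmap
    simp only [hres]
    unfold rowLaw
    rw [Measure.map_map (by fun_prop) (by fun_prop), Measure.map_map (by fun_prop) (by fun_prop)]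
    exact hmap.symm

/-- The law of the design matrix of the regression of node `i`. -/
noncomputable def designLaw (Om : Matrix (Fin p) (Fin p) ℝ) (i : Fin p) (m : Type*) [Fintype m] :
    Measure (Matrix m (Others i) ℝ) :=
  Measure.pi fun _ => (rowLaw Om).map fun x (j : Others i) => x j

instance isProbabilityMeasure_designLaw {i : Fin p} {m : Type*} [Fintype m] :
    IsProbabilityMeasure (designLaw Om i m) := by
  have : IsProbabilityMeasure ((rowLaw Om).map fun x (j : Others i) => x j) :=
    Measure.isProbabilityMeasure_map (measurable_others i).aemeasurable
  exact inferInstanceAs (IsProbabilityMeasure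
    (Measure.pi fun _ : m => (rowLaw Om).map fun x (j : Others i) => x j))

/-- Row by row, the node is its regression on the other nodes plus independent noise. The value of
the common variance is irrelevant, since reflections preserve the noise law for any `v`. -/
lemma exists_measurePreserving_assemble (hOm : Om.PosDef) (i : Fin p) (m : Type*) [Fintype m] :
    ∃ v : NNReal, MeasurePreserving (assemble i (regCoef Om i))
      ((designLaw Om i m).prod (Measure.pi fun _ : m => gaussianReal 0 v)) (sampleLaw Om m) := by
  obtain ⟨v, hv⟩ := exists_rowLaw_regression hOm i
  refine ⟨v, ?_⟩
  have : IsProbabilityMeasure ((rowLaw Om).map fun x (j : Others i) => x j) :=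
    Measure.isProbabilityMeasure_map (measurable_others i).aemeasurable
  have h1 := (measurePreserving_arrowProdEquivProdArrow _ _ m
    (fun _ => (rowLaw Om).map fun x (j : Others i) => x j) (fun _ => gaussianReal 0 v)).symm
  let g : (Others i → ℝ) × ℝ → Fin p → ℝ := fun z j =>
    if h : j ≠ i then z.1 ⟨j, h⟩ else ∑ j, z.1 j * regCoef Om i j + z.2
  have hg : Measurable g := by
    refine measurable_pi_iff.2 fun j => ?_
    simp only [g]
    split_ifs <;> fun_prop
  have h2 : MeasurePreserving g
      (((rowLaw Om).map fun x (j : Others i) => x j).prod (gaussianReal 0 v)) (rowLaw Om) := by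
    refine ⟨hg, ?_⟩
    rw [hv, Measure.map_map hg ((measurable_others i).prodMk (by fun_prop))]
    refine Eq.trans (congrArg (fun f => Measure.map f _) ?_) Measure.map_id
    funext x j
    simp only [g, Function.comp_apply, id]
    split_ifs with h
    · rfl
    · rw [not_not.1 h]
      simp [mul_comm]
  have h3 := (measurePreserving_pi _ _ fun _ : m => h2).comp h1
  refine Eq.mp (congrArg (fun f => MeasurePreserving f _ _) ?_) h3
  funext z
  ext k j
  simp only [assemble, Matrix.of_apply]
  rfl

end SampleLaw

end GGMKnockoff

namespace GGMKnockoff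

/-! ### Gaussian designs have full column rank -/

lemma isUnit_det_gram {m ι : Type*} [Fintype m] [Fintype ι] [DecidableEq ι] {A : Matrix m ι ℝ}
    (h : Function.Injective A.mulVec) : IsUnit (A.transpose * A).det := by
  have := Matrix.PosDef.conjTranspose_mul_self A h
  rw [Matrix.conjTranspose_eq_transpose_of_trivial] at this
  exact this.det_pos.ne'.isUnit

section FullRank

variable {p : ℕ} {Om : Matrix (Fin p) (Fin p) ℝ}

/-- A proper subspace lies in the kernel of a nonzero linear form, whose law is Gaussian with
positive variance and so has no atom at zero. -/
lemma ae_notMem_submodule (hOm : Om.PosDef) {V : Submodule ℝ (Fin p → ℝ)} (hV : V < ⊤) :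
    ∀ᵐ x ∂rowLaw Om, x ∉ V := by
  obtain ⟨φ, hφ, hker⟩ := V.exists_le_ker_of_lt_top hV
  set c : Fin p → ℝ := fun j => φ (Pi.single j 1) with hc
  have hφc : ∀ x, φ x = c ⬝ᵥ x := by
    intro x
    rw [LinearMap.pi_apply_eq_sum_univ φ x, dotProduct]
    exact Finset.sum_congr rfl fun j _ => by
      rw [smul_eq_mul, mul_comm, hc]
      congr 2
      funext l
      simp [Pi.single_apply, eq_comm]
  have hc0 : c ≠ 0 := by
    rintro h0
    exact hφ (LinearMap.ext fun x => by rw [hφc, h0, zero_dotProduct]; rfl)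
  have hvar : 0 < Var[fun x : EuclideanSpace ℝ (Fin p) => c ⬝ᵥ x.ofLp;
      multivariateGaussian 0 Om⁻¹] := by
    rw [← covariance_self (by unfold dotProduct; fun_prop), covariance_dotProduct hOm.inv.posSemidef]
    simpa using hOm.inv.dotProduct_mulVec_pos hc0
  have hmap := (hasGaussianLaw_dotProduct (S := Om⁻¹) c).map_eq_gaussianReal
  have : NullSingletonClass ((multivariateGaussian 0 Om⁻¹).map
      fun x : EuclideanSpace ℝ (Fin p) => c ⬝ᵥ x.ofLp) := by
    rw [hmap]
    exact nullSingletonClass_gaussianReal (by simpa using hvar)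
  have h0 := measure_singleton (μ := (multivariateGaussian 0 Om⁻¹).map
      fun x : EuclideanSpace ℝ (Fin p) => c ⬝ᵥ x.ofLp) 0
  rw [Measure.map_apply (by unfold dotProduct; fun_prop) (measurableSet_singleton _)] at h0
  refine ae_map_iff (by fun_prop) ?_ |>.2 ?_
  · exact (Submodule.closed_of_finiteDimensional V).measurableSet.compl
  · refine measure_mono_null (fun x hx => ?_) h0
    have hx' : x.ofLp ∈ V := not_not.1 hx
    have := hker hx'
    rw [LinearMap.mem_ker, hφc] at this
    exact this

lemma ae_linearIndependent_rows (hOm : Om.PosDef) {k : ℕ} (hk : k ≤ p) :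
    ∀ᵐ X ∂(Measure.pi fun _ : Fin k => rowLaw Om), LinearIndependent ℝ X := by
  induction k with
  | zero => exact ae_of_all _ fun X => linearIndependent_empty_type
  | succ k ih =>
    have hmp := (measurePreserving_piFinSuccAbove (fun _ : Fin (k + 1) => rowLaw Om) 0).symm
    rw [← hmp.map_eq]
    have hmeas : MeasurableSet {X : Fin (k + 1) → Fin p → ℝ | LinearIndependent ℝ X} :=
      isOpen_setOfPred_linearIndependent.measurableSet
    refine (ae_map_iff hmp.measurable.aemeasurable hmeas).2 ?_
    have hmeas' := hmp.measurable hmeas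
    refine (Measure.ae_prod_iff_ae_ae hmeas').2 ?_
    -- The order of the quantifiers is exchanged so that the new row is drawn after the span of the
    -- others is fixed.
    refine (Measure.ae_ae_comm (p := fun x X => LinearIndependent ℝ
      ((MeasurableEquiv.piFinSuccAbove (fun _ : Fin (k + 1) => Fin p → ℝ) 0).symm (x, X)))
      hmeas').2 ?_
    filter_upwards [ih (by omega)] with X hX
    have hlt : Submodule.span ℝ (Set.range X) < ⊤ := by
      refine lt_top_iff_ne_top.2 fun htop => ?_
      have h1 := finrank_span_eq_card hX
      rw [htop, finrank_top, Module.finrank_fin_fun, Fintype.card_fin] at h1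
      omega
    filter_upwards [ae_notMem_submodule hOm hlt] with x hx
    have : (MeasurableEquiv.piFinSuccAbove (fun _ : Fin (k + 1) => Fin p → ℝ) 0).symm (x, X) =
        Fin.cons x X := by
      simp [MeasurableEquiv.piFinSuccAbove_symm_apply, Fin.insertNthEquiv]
    rw [this]
    exact linearIndependent_finCons.2 ⟨hX, hx⟩

/-- Already the first `p` rows form an invertible square matrix. -/
lemma ae_mulVec_injective (hOm : Om.PosDef) {m : ℕ} (hm : p ≤ m) :
    ∀ᵐ X ∂sampleLaw Om (Fin m), Function.Injective X.mulVec := by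
  let e : Fin p ⊕ Fin (m - p) ≃ Fin m := finSumFinEquiv.trans (finCongr (by omega))
  have hmp := measurePreserving_joinRows (Om := Om) e
  have hrows : ∀ᵐ X ∂sampleLaw Om (Fin m), LinearIndependent ℝ fun k : Fin p => X (e (.inl k)) := by
    have hmeas : MeasurableSet {X : Matrix (Fin m) (Fin p) ℝ |
        LinearIndependent ℝ fun k : Fin p => X (e (.inl k))} := by
      have hopen : MeasurableSet {X : Fin p → Fin p → ℝ | LinearIndependent ℝ X} :=
        isOpen_setOfPred_linearIndependent.measurableSet
      have hsub : Measurable fun (X : Matrix (Fin m) (Fin p) ℝ) (k : Fin p) => X (e (.inl k)) :=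
        measurable_of_entries fun k j => measurable_entry _ _
      exact hsub hopen
    rw [← hmp.map_eq]
    refine (ae_map_iff hmp.measurable.aemeasurable hmeas).2 ?_
    have h1 : ∀ᵐ X ∂sampleLaw Om (Fin p), LinearIndependent ℝ X :=
      ae_linearIndependent_rows hOm le_rfl
    filter_upwards [Measure.quasiMeasurePreserving_fst.ae h1] with z hz
    have : (fun k : Fin p => joinRows e z.1 z.2 (e (.inl k))) = z.1 := by
      funext k j
      simp only [joinRows, Matrix.of_apply, Equiv.symm_apply_apply]
      rfl
    rwa [this]
  filter_upwards [hrows] with X hX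
  have hu : IsUnit (X.submatrix (e ∘ Sum.inl) id) :=
    Matrix.linearIndependent_rows_iff_isUnit.1 hX
  intro x y hxy
  refine Matrix.mulVec_injective_iff_isUnit.2 hu ?_
  ext k
  exact congrFun hxy (e (.inl k))

lemma nodeDesign_mulVec_injective {m p : ℕ} {X : Matrix (Fin m) (Fin p) ℝ}
    (hX : Function.Injective X.mulVec) (i : Fin p) :
    Function.Injective (nodeDesign X i).mulVec := by
  have key : ∀ b : Others i → ℝ, (nodeDesign X i).mulVec b =
      X.mulVec fun j => if h : j ≠ i then b ⟨j, h⟩ else 0 := by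
    intro b
    ext k
    simp only [Matrix.mulVec, dotProduct]
    rw [sum_others i]
    simp only [ne_eq, not_true, dite_false, mul_zero, zero_add]
    refine Finset.sum_congr rfl fun j _ => ?_
    rw [dif_pos j.2]
    rfl
  intro b b' h
  rw [key, key] at h
  ext j
  have := congrFun (hX h) j
  simpa [j.2] using this

end FullRank

end GGMKnockoff

namespace GGMKnockoff

/-! ### Recycled knockoffs -/

section JoinRows

variable {a b m ι : Type*}

@[simp] lemma joinRows_inl (e : a ⊕ b ≃ m) (A : Matrix a ι ℝ) (B : Matrix b ι ℝ) (k : a) (j : ι) :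
    joinRows e A B (e (.inl k)) j = A k j := by
  simp only [joinRows, Matrix.of_apply, Equiv.symm_apply_apply]; rfl

@[simp] lemma joinRows_inr (e : a ⊕ b ≃ m) (A : Matrix a ι ℝ) (B : Matrix b ι ℝ) (k : b) (j : ι) :
    joinRows e A B (e (.inr k)) j = B k j := by
  simp only [joinRows, Matrix.of_apply, Equiv.symm_apply_apply]; rfl

lemma swapCols_joinRows [DecidableEq ι] (e : a ⊕ b ≃ m) (C : Matrix a ι ℝ) (D Dt : Matrix b ι ℝ)
    (H : Finset ι) : swapCols H (joinRows e C D) (joinRows e C Dt) =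
      joinRows e C (swapCols H D Dt) := by
  ext k j
  obtain ⟨k, rfl⟩ := e.surjective k
  rcases k with k | k
  · simp [swapCols]
  · simp [swapCols]

lemma joinRows_mulVec_injective [Fintype ι] (e : a ⊕ b ≃ m) (C : Matrix a ι ℝ) {D : Matrix b ι ℝ}
    (hD : Function.Injective D.mulVec) : Function.Injective (joinRows e C D).mulVec := by
  intro x y hxy
  refine hD (funext fun k => ?_)
  have := congrFun hxy (e (.inr k))
  simpa only [Matrix.mulVec, dotProduct, joinRows_inr] using this

variable [Fintype a] [Fintype b] [Fintype m]

lemma sum_joinRows (e : a ⊕ b ≃ m) (f : m → ℝ) :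
    ∑ k, f k = ∑ k, f (e (.inl k)) + ∑ k, f (e (.inr k)) := by
  rw [← Equiv.sum_comp e, Fintype.sum_sum_type]

/-- Rows shared by design and knockoffs add the same matrix to all Gram blocks, so `s` is unchanged.
-/
lemma IsKnockoff.joinRows [Fintype ι] [DecidableEq ι] (e : a ⊕ b ≃ m) (C : Matrix a ι ℝ) {D Dt : Matrix b ι ℝ}
    (h : IsKnockoff D Dt) : IsKnockoff (joinRows e C D) (joinRows e C Dt) := by
  obtain ⟨s, hs0, hs⟩ := isKnockoff_iff_entries.1 h
  refine isKnockoff_iff_entries.2 ⟨s, hs0, fun k l => ?_⟩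
  obtain ⟨h1, h2, h3⟩ := hs k l
  simp only [sum_joinRows e, joinRows_inl, joinRows_inr, h1, h2, h3]
  exact ⟨by ring, by ring, trivial⟩

lemma fromCols_joinRows_mulVec (e : a ⊕ b ≃ m) (C : Matrix a ι ℝ) (D Dt : Matrix b ι ℝ)
    (y : m → ℝ) :
    (Matrix.fromCols (joinRows e C D) (joinRows e C Dt)).transpose.mulVec y =
      (Matrix.fromCols C C).transpose.mulVec (fun k => y (e (.inl k))) +
        (Matrix.fromCols D Dt).transpose.mulVec fun k => y (e (.inr k)) := by
  ext k
  rcases k with k | k <;>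
    simp [Matrix.mulVec, dotProduct, Matrix.transpose_apply, sum_joinRows e]

/-- Reflecting the second part of the response has the same effect on the cross products with
recycled knockoffs as swapping a variable with its knockoff. -/
lemma IsKnockoff.fromCols_joinRows_mulVec_reflectAlong [Fintype ι] [DecidableEq ι] (e : a ⊕ b ≃ m) (C : Matrix a ι ℝ)
    {D Dt : Matrix b ι ℝ} (h : IsKnockoff D Dt) (j : ι) {y y' : m → ℝ}
    (h1 : ∀ k, y' (e (.inl k)) = y (e (.inl k)))
    (h2 : (fun k => y' (e (.inr k))) =
      reflectAlong (D.col j - Dt.col j) fun k => y (e (.inr k))) :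
    (Matrix.fromCols (GGMKnockoff.joinRows e C D)
        (GGMKnockoff.joinRows e C Dt)).transpose.mulVec y' =
      (Matrix.fromCols
        (GGMKnockoff.swapCols {j} (GGMKnockoff.joinRows e C D) (GGMKnockoff.joinRows e C Dt))
        (GGMKnockoff.swapCols {j} (GGMKnockoff.joinRows e C Dt)
          (GGMKnockoff.joinRows e C D))).transpose.mulVec y := by
  rw [swapCols_joinRows, swapCols_joinRows, fromCols_joinRows_mulVec, fromCols_joinRows_mulVec,
    h2, h.mulVec_reflectAlong]
  simp only [h1]

end JoinRows

section Halves

variable {n p : ℕ}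

/-- The rows of the first and of the second half. -/
def splitEquiv (n : ℕ) : Fin (n / 2) ⊕ Fin (n - n / 2) ≃ Fin n :=
  finSumFinEquiv.trans (finCongr (by omega))

lemma splitEquiv_inl (k : Fin (n / 2)) : (splitEquiv n (.inl k) : ℕ) = k := by
  simp [splitEquiv]

lemma splitEquiv_inr (k : Fin (n - n / 2)) : (splitEquiv n (.inr k) : ℕ) = n / 2 + k := by
  simp [splitEquiv]

lemma firstHalf_apply (X : Matrix (Fin n) (Fin p) ℝ) (k : Fin (n / 2)) (j : Fin p) :
    firstHalf X k j = X (splitEquiv n (.inl k)) j := by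
  have : splitEquiv n (.inl k) = ⟨k, by omega⟩ := Fin.ext (splitEquiv_inl k)
  rw [this]; rfl

lemma secondHalf_apply (X : Matrix (Fin n) (Fin p) ℝ) (k : Fin (n - n / 2)) (j : Fin p) :
    secondHalf X k j = X (splitEquiv n (.inr k)) j := by
  have : splitEquiv n (.inr k) = ⟨n / 2 + k, by omega⟩ := Fin.ext (splitEquiv_inr k)
  rw [this]; rfl

lemma firstHalf_joinRows (A : Matrix (Fin (n / 2)) (Fin p) ℝ)
    (B : Matrix (Fin (n - n / 2)) (Fin p) ℝ) : firstHalf (joinRows (splitEquiv n) A B) = A := by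
  ext k j
  rw [firstHalf_apply, joinRows_inl]

lemma secondHalf_joinRows (A : Matrix (Fin (n / 2)) (Fin p) ℝ)
    (B : Matrix (Fin (n - n / 2)) (Fin p) ℝ) : secondHalf (joinRows (splitEquiv n) A B) = B := by
  ext k j
  rw [secondHalf_apply, joinRows_inr]

lemma joinRows_halves (X : Matrix (Fin n) (Fin p) ℝ) :
    joinRows (splitEquiv n) (firstHalf X) (secondHalf X) = X := by
  ext k j
  obtain ⟨k, rfl⟩ := (splitEquiv n).surjective k
  rcases k with k | k
  · rw [joinRows_inl, firstHalf_apply]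
  · rw [joinRows_inr, secondHalf_apply]

lemma measurable_firstHalf :
    Measurable (firstHalf : Matrix (Fin n) (Fin p) ℝ → Matrix (Fin (n / 2)) (Fin p) ℝ) :=
  measurable_of_entries fun k j => by
    simp only [firstHalf_apply]
    exact measurable_entry _ _

lemma measurable_secondHalf :
    Measurable (secondHalf : Matrix (Fin n) (Fin p) ℝ → Matrix (Fin (n - n / 2)) (Fin p) ℝ) :=
  measurable_of_entries fun k j => by
    simp only [secondHalf_apply]
    exact measurable_entry _ _

lemma nodeDesign_eq_joinRows (X : Matrix (Fin n) (Fin p) ℝ) (i : Fin p) :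
    nodeDesign X i =
      joinRows (splitEquiv n) (nodeDesign (firstHalf X) i) (nodeDesign (secondHalf X) i) := by
  conv_lhs => rw [← joinRows_halves X]
  ext k j
  obtain ⟨k, rfl⟩ := (splitEquiv n).surjective k
  rcases k with k | k
  · rw [joinRows_inl, nodeDesign, Matrix.submatrix_apply, id, joinRows_inl]; rfl
  · rw [joinRows_inr, nodeDesign, Matrix.submatrix_apply, id, joinRows_inr]; rfl

lemma recycledKnockoff_eq_joinRows (K : KnockoffRule p) (X : Matrix (Fin n) (Fin p) ℝ)
    (i : Fin p) :
    recycledKnockoff K X i =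
      joinRows (splitEquiv n) (nodeDesign (firstHalf X) i)
        (K (n - n / 2) i (nodeDesign (secondHalf X) i)) := by
  ext k j
  obtain ⟨k, rfl⟩ := (splitEquiv n).surjective k
  rcases k with k | k
  · have hk : (splitEquiv n (.inl k) : ℕ) < n / 2 := by rw [splitEquiv_inl]; exact k.2
    rw [joinRows_inl, recycledKnockoff, Matrix.of_apply, dif_pos hk]
    simp only [nodeDesign, Matrix.submatrix_apply, id, firstHalf_apply]
  · have hk : ¬ (splitEquiv n (.inr k) : ℕ) < n / 2 := by rw [splitEquiv_inr]; omega
    rw [joinRows_inr, recycledKnockoff, Matrix.of_apply, dif_neg hk]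
    congr 1
    ext
    simp [splitEquiv_inr]

lemma measurable_nodeDesign (i : Fin p) :
    Measurable fun X : Matrix (Fin n) (Fin p) ℝ => nodeDesign X i :=
  measurable_of_entries fun k j => measurable_entry k j.1

lemma measurable_recycledKnockoff {std : Bool} {o : OptStrategy} {K : KnockoffRule p}
    (hK : IsKnockoffRule std o K) (i : Fin p) :
    Measurable fun X : Matrix (Fin n) (Fin p) ℝ => recycledKnockoff K X i := by
  simp only [recycledKnockoff_eq_joinRows]
  exact (measurable_joinRows (splitEquiv n)).comp
    (((measurable_nodeDesign i).comp measurable_firstHalf).prodMk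
      ((hK.measurable _ i).comp ((measurable_nodeDesign i).comp measurable_secondHalf)))

lemma card_others (i : Fin p) : Fintype.card (Others i) = p - 1 := by
  rw [Fintype.card_subtype_compl, Fintype.card_fin, Fintype.card_subtype_eq]

/-- If the second half of a design has full column rank, then so has the design, and recycled
knockoffs are knockoffs. -/
lemma isKnockoff_recycledKnockoff {std : Bool} {o : OptStrategy} {K : KnockoffRule p}
    (hK : IsKnockoffRule std o K) (hnp : 4 * p ≤ n) {X : Matrix (Fin n) (Fin p) ℝ} {i : Fin p}
    (hX : Function.Injective (nodeDesign (secondHalf X) i).mulVec) :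
    IsUnit ((nodeDesign X i).transpose * nodeDesign X i).det ∧
      IsKnockoff (nodeDesign (secondHalf X) i) (K (n - n / 2) i (nodeDesign (secondHalf X) i)) ∧
      IsKnockoff (nodeDesign X i) (recycledKnockoff K X i) := by
  have h2 : IsKnockoff (nodeDesign (secondHalf X) i)
      (K (n - n / 2) i (nodeDesign (secondHalf X) i)) :=
    -- The second half has at least `2 * p` rows, twice the number of columns or more.
    hK.isKnockoff i (by rw [card_others]; omega) (isUnit_det_gram hX)
  refine ⟨isUnit_det_gram ?_, h2, ?_⟩
  · rw [nodeDesign_eq_joinRows]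
    exact joinRows_mulVec_injective _ _ hX
  · rw [nodeDesign_eq_joinRows, recycledKnockoff_eq_joinRows]
    exact h2.joinRows _ _

end Halves

/-- On designs of full column rank, the statistics are a measurable function of the data. -/
lemma exists_measurable_statMatrix {n p : ℕ} {P : FeatureProcedure p} (hs : HasSufficiency P)
    {Xt : Matrix (Fin n) (Fin p) ℝ → (i : Fin p) → Matrix (Fin n) (Others i) ℝ}
    (hXt : ∀ i, Measurable fun X => Xt X i) :
    ∃ W : Matrix (Fin n) (Fin p) ℝ → Fin p → Fin p → ℝ, (∀ i, Measurable fun X => W X i) ∧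
      ∀ X i, IsUnit ((nodeDesign X i).transpose * nodeDesign X i).det →
        IsKnockoff (nodeDesign X i) (Xt X i) → statMatrix P X (Xt X) i = W X i := by
  -- Measurability is available only for the function from sufficiency, which agrees with `P` on
  -- full-rank designs with genuine knockoffs.
  choose f hf hPf using hs n
  refine ⟨fun X i j => if h : j ≠ i then
    f i ((Matrix.fromCols (nodeDesign X i) (Xt X i)).transpose *
        Matrix.fromCols (nodeDesign X i) (Xt X i),
      (Matrix.fromCols (nodeDesign X i) (Xt X i)).transpose.mulVec fun k => X k i) ⟨j, h⟩
    else 0, fun i => ?_, fun X i h1 h2 => ?_⟩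
  · refine measurable_pi_iff.2 fun j => ?_
    dsimp only
    split_ifs with h
    · have hM : ∀ k l, Measurable fun X : Matrix (Fin n) (Fin p) ℝ =>
          Matrix.fromCols (nodeDesign X i) (Xt X i) k l := by
        intro k l
        rcases l with l | l
        · exact (measurable_nodeDesign i).entry k l
        · exact (hXt i).entry k l
      refine (measurable_pi_apply (⟨j, h⟩ : Others i)).comp ((hf i).comp (Measurable.prodMk ?_ ?_))
      · refine measurable_of_entries fun k l => ?_
        simp only [Matrix.mul_apply, Matrix.transpose_apply]
        exact Finset.measurable_sum _ fun r _ => (hM r k).mul (hM r l)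
      · refine measurable_pi_iff.2 fun k => ?_
        simp only [Matrix.mulVec, dotProduct, Matrix.transpose_apply]
        exact Finset.measurable_sum _ fun r _ => (hM r k).mul (measurable_entry r i)
    · exact measurable_const
  · funext j
    simp only [statMatrix]
    split_ifs with h
    · rw [hPf i _ _ _ h1 h2]
    · rfl

end GGMKnockoff

namespace GGMKnockoff

/-! ### Statistics from recycled knockoffs, conditionally on the first half -/

section Conditional

variable {n p : ℕ} {Om : Matrix (Fin p) (Fin p) ℝ}

open Classical in
/-- The nodes other than `i` that have coefficient zero in the regression of node `i`. -/
noncomputable def nullSet (Om : Matrix (Fin p) (Fin p) ℝ) (i : Fin p) : Finset (Fin p) :=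
  Finset.univ.filter fun k => k ≠ i ∧ Om i k = 0

lemma nodeDesign_assemble {m : ℕ} (i : Fin p) (β : Others i → ℝ)
    (z : Matrix (Fin m) (Others i) ℝ × (Fin m → ℝ)) : nodeDesign (assemble i β z) i = z.1 := by
  ext k j
  simp [nodeDesign, assemble, j.2]

/-- The mean `D.mulVec β` is fixed by the reflection, so reflecting the noise amounts to reflecting
the whole second-half response. Its cross products then become those of the design with `j` swapped.
-/
lemma statMatrix_reflectAlong {std : Bool} {o : OptStrategy} {K : KnockoffRule p}
    (hK : IsKnockoffRule std o K) (hnp : 4 * p ≤ n) {P : FeatureProcedure p}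
    (hs : HasSufficiency P) (ha : HasAntisymmetry P) (X₁ : Matrix (Fin (n / 2)) (Fin p) ℝ)
    {i : Fin p} {D : Matrix (Fin (n - n / 2)) (Others i) ℝ} (hD : Function.Injective D.mulVec)
    {β : Others i → ℝ} {j : Others i} (hβ : β j = 0) (ε : Fin (n - n / 2) → ℝ) :
    let X := fun ε => joinRows (splitEquiv n) X₁ (assemble i β (D, ε))
    let W := fun ε => statMatrix P (X ε) (recycledKnockoff K (X ε)) i
    W (reflectAlong (D.col j - (K (n - n / 2) i D).col j) ε) = flipOn {j.1} (W ε) := by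
  intro X W
  have hDX : ∀ ε, nodeDesign (secondHalf (X ε)) i = D := fun ε => by
    simp only [X]
    rw [secondHalf_joinRows, nodeDesign_assemble]
  have hA : ∀ ε, nodeDesign (X ε) i = joinRows (splitEquiv n) (nodeDesign X₁ i) D := fun ε => by
    rw [nodeDesign_eq_joinRows, hDX]
    simp only [X]
    rw [firstHalf_joinRows]
  have hB : ∀ ε, recycledKnockoff K (X ε) i =
      joinRows (splitEquiv n) (nodeDesign X₁ i) (K (n - n / 2) i D) := fun ε => by
    rw [recycledKnockoff_eq_joinRows, hDX]
    simp only [X]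
    rw [firstHalf_joinRows]
  obtain ⟨h1, h2, h3⟩ := isKnockoff_recycledKnockoff hK hnp (X := X ε) (i := i)
    (by rw [hDX]; exact hD)
  rw [hDX] at h2
  rw [hA] at h1 h3
  rw [hB] at h3
  funext l
  simp only [W, statMatrix, flipOn, Finset.mem_singleton, hA, hB]
  by_cases hl : l ≠ i
  · rw [dif_pos hl, dif_pos hl]
    have hy := h2.fromCols_joinRows_mulVec_reflectAlong (splitEquiv n) (nodeDesign X₁ i) j
      (y := fun k => X ε k i)
      (y' := fun k => X (reflectAlong (D.col j - (K (n - n / 2) i D).col j) ε) k i)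
      (fun k => by simp only [X, joinRows_inl]) (by
        have hcol : ∀ ε, (fun k => X ε (splitEquiv n (.inr k)) i) = D.mulVec β + ε := by
          intro ε
          funext k
          simp [X, assemble]
        rw [hcol, hcol, reflectAlong_add, h2.reflectAlong_mulVec hβ])
    rw [statistics_flip hs ha h1 h3 {j} hy ⟨l, hl⟩]
    simp only [Finset.mem_singleton, Subtype.ext_iff]
  · rw [dif_neg hl, dif_neg hl]
    simp

/-- Conditionally also on the second-half design only the noise is random. The reflections depend on
that design alone, so they realise every null flip as a symmetry of the noise law. -/
lemma lintegral_maxRatio_recycled {std : Bool} {o : OptStrategy} {K : KnockoffRule p}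
    (hK : IsKnockoffRule std o K) (hnp : 4 * p ≤ n) (hOm : Om.PosDef) {P : FeatureProcedure p}
    (hs : HasSufficiency P) (ha : HasAntisymmetry P) {a c : ℝ} (ha0 : 0 < a)
    (hac : Layered a 0 c) {W : Matrix (Fin n) (Fin p) ℝ → Fin p → Fin p → ℝ}
    (hWm : ∀ i, Measurable fun X => W X i)
    (hW : ∀ X i, IsUnit ((nodeDesign X i).transpose * nodeDesign X i).det →
      IsKnockoff (nodeDesign X i) (recycledKnockoff K X i) →
      statMatrix P X (recycledKnockoff K X) i = W X i)
    (X₁ : Matrix (Fin (n / 2)) (Fin p) ℝ) (i : Fin p) :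
    ∫⁻ X₂, maxRatio a (nullSet Om i) (W (joinRows (splitEquiv n) X₁ X₂) i)
      ∂sampleLaw Om (Fin (n - n / 2)) ≤ ENNReal.ofReal c := by
  obtain ⟨v, hv⟩ := exists_measurePreserving_assemble hOm i (Fin (n - n / 2))
  have hmW : Measurable fun X₂ => W (joinRows (splitEquiv n) X₁ X₂) i :=
    (hWm i).comp ((measurable_joinRows (splitEquiv n)).comp measurable_prodMk_left)
  have hm : Measurable fun X₂ =>
      maxRatio a (nullSet Om i) (W (joinRows (splitEquiv n) X₁ X₂) i) :=
    (measurable_maxRatio a _).comp hmW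
  have hD : ∀ᵐ D ∂designLaw Om i (Fin (n - n / 2)), Function.Injective D.mulVec := by
    have h1 : ∀ᵐ X ∂sampleLaw Om (Fin (n - n / 2)), Function.Injective (nodeDesign X i).mulVec :=
      (ae_mulVec_injective hOm (by omega)).mono fun X hX => nodeDesign_mulVec_injective hX i
    have h2 := hv.quasiMeasurePreserving.ae h1
    simp only [nodeDesign_assemble] at h2
    filter_upwards [Measure.ae_ae_of_ae_prod h2] with D hD
    -- The rank condition does not involve the noise, so any noise vector serves as witness.
    exact hD.exists.choose_spec
  have hprod := lintegral_prod (μ := designLaw Om i (Fin (n - n / 2)))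
    (ν := Measure.pi fun _ => gaussianReal 0 v) (fun z => maxRatio a (nullSet Om i)
      (W (joinRows (splitEquiv n) X₁ (assemble i (regCoef Om i) z)) i))
    (hm.comp hv.measurable).aemeasurable
  rw [← hv.lintegral_comp hm, hprod]
  refine le_trans (b := ∫⁻ _, ENNReal.ofReal c ∂designLaw Om i (Fin (n - n / 2)))
    (lintegral_mono_ae (hD.mono fun D hD => ?_)) ?_
  · refine hac.lintegral_maxRatio_le ha0
      (w := fun ε => W (joinRows (splitEquiv n) X₁ (assemble i (regCoef Om i) (D, ε))) i)
      (hmW.comp (hv.measurable.comp measurable_prodMk_left)) _ fun j hj => ?_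
    obtain ⟨hji, hj0⟩ := (Finset.mem_filter.1 hj).2
    refine ⟨_, measurePreserving_reflectAlong v
      (D.col ⟨j, hji⟩ - (K (n - n / 2) i D).col ⟨j, hji⟩), fun ε => ?_⟩
    have hgood : ∀ ε, statMatrix P (joinRows (splitEquiv n) X₁ (assemble i (regCoef Om i) (D, ε)))
        (recycledKnockoff K (joinRows (splitEquiv n) X₁ (assemble i (regCoef Om i) (D, ε)))) i =
        W (joinRows (splitEquiv n) X₁ (assemble i (regCoef Om i) (D, ε))) i := by
      intro ε
      obtain ⟨h1, -, h3⟩ := isKnockoff_recycledKnockoff hK hnp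
        (X := joinRows (splitEquiv n) X₁ (assemble i (regCoef Om i) (D, ε))) (i := i)
        (by rw [secondHalf_joinRows, nodeDesign_assemble]; exact hD)
      exact hW _ i h1 h3
    rw [← hgood, ← hgood]
    exact statMatrix_reflectAlong hK hnp hs ha X₁ hD (by simp [regCoef, hj0]) ε
  · simp

/-- The bound on the error rate conditionally on the first half of the data. -/
lemma lintegral_sum_maxRatio_recycled {std : Bool} {o : OptStrategy} {K : KnockoffRule p}
    (hK : IsKnockoffRule std o K) (hnp : 4 * p ≤ n) (hOm : Om.PosDef) {P : FeatureProcedure p}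
    (hs : HasSufficiency P) (ha : HasAntisymmetry P) {a c q : ℝ} (ha0 : 0 < a) (hc : 0 < c)
    (hq : 0 ≤ q) (hac : Layered a 0 c) {W : Matrix (Fin n) (Fin p) ℝ → Fin p → Fin p → ℝ}
    (hWm : ∀ i, Measurable fun X => W X i)
    (hW : ∀ X i, IsUnit ((nodeDesign X i).transpose * nodeDesign X i).det →
      IsKnockoff (nodeDesign X i) (recycledKnockoff K X i) →
      statMatrix P X (recycledKnockoff K X) i = W X i)
    (X₁ : Matrix (Fin (n / 2)) (Fin p) ℝ) :
    ∫⁻ X₂, ENNReal.ofReal (q / (c * p)) *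
        ∑ i, maxRatio a (nullSet Om i) (W (joinRows (splitEquiv n) X₁ X₂) i)
      ∂sampleLaw Om (Fin (n - n / 2)) ≤ ENNReal.ofReal q := by
  have hm : ∀ i, Measurable fun X₂ => maxRatio a (nullSet Om i)
      (W (joinRows (splitEquiv n) X₁ X₂) i) := fun i =>
    (measurable_maxRatio _ _).comp ((hWm i).comp
      ((measurable_joinRows (splitEquiv n)).comp measurable_prodMk_left))
  rw [lintegral_const_mul _ (Finset.measurable_sum _ fun i _ => hm i),
    lintegral_finsetSum _ fun i _ => hm i]
  calc _ ≤ ENNReal.ofReal (q / (c * p)) * ∑ _i : Fin p, ENNReal.ofReal c := by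
        gcongr with i
        exact lintegral_maxRatio_recycled hK hnp hOm hs ha ha0 hac hWm hW X₁ i
    _ ≤ ENNReal.ofReal q := by
        rcases Nat.eq_zero_or_pos p with rfl | hp
        · simp
        · have hp' : (0 : ℝ) < p := by exact_mod_cast hp
          rw [Finset.sum_const, Finset.card_univ, Fintype.card_fin, nsmul_eq_mul,
            ← ENNReal.ofReal_natCast, ← ENNReal.ofReal_mul hp'.le,
            ← ENNReal.ofReal_mul (by positivity)]
          refine ENNReal.ofReal_le_ofReal (le_of_eq ?_)
          field_simp

end Conditional

/-! ### Assembling the error bound -/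

/-- No sigma-algebra on `γ` is needed: finitely many values with measurable fibres replace
measurability of `s`. -/
lemma measurable_of_finite_choice {α β γ : Type*} [MeasurableSpace α] [MeasurableSpace β]
    {C : Set γ} (hC : C.Finite) {s : α → γ} (hs : ∀ x, s x ∈ C)
    (hsm : ∀ c, MeasurableSet {x | s x = c}) {g : γ → α → β} (hg : ∀ c ∈ C, Measurable (g c)) :
    Measurable fun x => g (s x) x := by
  intro t ht
  have : (fun x => g (s x) x) ⁻¹' t = ⋃ c ∈ C, {x | s x = c} ∩ g c ⁻¹' t := by
    ext x
    simp only [Set.mem_preimage, Set.mem_iUnion, Set.mem_inter_iff, Set.mem_ofPred_eq, exists_prop]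
    exact ⟨fun h => ⟨s x, hs x, rfl, h⟩, by rintro ⟨c, -, rfl, h⟩; exact h⟩
  rw [this]
  exact hC.measurableSet_biUnion fun c hc => (hsm c).inter (hg c hc ht)

lemma finite_candidates {p : ℕ} {A : Set (ℝ × ℝ)} (hA : A.Finite) (Os : Set OptStrategy)
    {Ps : Set (FeatureProcedure p)} (hPs : Ps.Finite) (Rs : Set EdgeRule) :
    (candidates A Os Ps Rs).Finite := by
  have hO : Os.Finite := (Set.toFinite {.equi, .sdp}).subset fun o _ => by cases o <;> simp
  have hR : Rs.Finite := (Set.toFinite {.AND, .OR}).subset fun o _ => by cases o <;> simp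
  refine ((hA.prod (hO.prod (hPs.prod hR))).image
    fun t => (⟨t.1, t.2.1, t.2.2.1, t.2.2.2⟩ : Hyper p)).subset ?_
  rintro h ⟨h1, h2, h3, h4⟩
  exact ⟨(h.ac, h.opt, h.proc, h.rule), ⟨h1, h2, h3, h4⟩, rfl⟩

/-! ### Random splitting, and selection from the first half -/

section Law

variable {n p : ℕ} {Om : Matrix (Fin p) (Fin p) ℝ}

lemma measurePreserving_secondHalf :
    MeasurePreserving (secondHalf : Matrix (Fin n) (Fin p) ℝ → _) (sampleLaw Om (Fin n))
      (sampleLaw Om (Fin (n - n / 2))) := by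
  refine ⟨measurable_secondHalf, ?_⟩
  rw [← (measurePreserving_joinRows (Om := Om) (splitEquiv n)).map_eq,
    Measure.map_map measurable_secondHalf (measurable_joinRows _)]
  have : (secondHalf ∘ fun z : Matrix (Fin (n / 2)) (Fin p) ℝ ×
      Matrix (Fin (n - n / 2)) (Fin p) ℝ => joinRows (splitEquiv n) z.1 z.2) = Prod.snd := by
    funext z
    exact secondHalf_joinRows _ _
  rw [this]
  exact measurePreserving_snd.map_eq

/-- For fixed `u` a row permutation preserves the i.i.d. law, so the split data remain independent
of `U` although the permutation depends on it. -/
lemma measurePreserving_prodMk_splitData {Ω S : Type*} [MeasurableSpace Ω] [MeasurableSpace S]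
    {μ : Measure Ω} [IsProbabilityMeasure μ] {X : Ω → Matrix (Fin n) (Fin p) ℝ}
    (hX : IsGaussianSample μ Om X) {U : Ω → S} (hU : Measurable U) (hUX : IndepFun U X μ)
    {split : S → Equiv.Perm (Fin n)} (hsplit : ∀ π, MeasurableSet {u | split u = π}) :
    MeasurePreserving (fun ω => (U ω, splitData split (U ω) (X ω))) μ
      ((μ.map U).prod (sampleLaw Om (Fin n))) := by
  have : IsProbabilityMeasure (μ.map U) := Measure.isProbabilityMeasure_map hU.aemeasurable
  have h1 : MeasurePreserving (fun ω => (U ω, X ω)) μ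
      ((μ.map U).prod (sampleLaw Om (Fin n))) := by
    refine ⟨hU.prodMk hX.measurable, ?_⟩
    rw [(indepFun_iff_map_prod_eq_prod_map_map hU.aemeasurable hX.measurable.aemeasurable).1 hUX,
      hX.map_eq]
  have hm : Measurable (Function.uncurry fun u (Y : Matrix (Fin n) (Fin p) ℝ) =>
      splitData split u Y) := by
    refine measurable_of_finite_choice (C := Set.univ) Set.finite_univ
      (s := fun z : S × Matrix (Fin n) (Fin p) ℝ => split z.1)
      (g := fun π z => z.2.submatrix π id) (fun _ => Set.mem_univ _)
      (fun π => measurable_fst (hsplit π)) fun π _ => ?_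
    exact measurable_of_entries fun k j => measurable_snd.entry _ _
  have h2 : MeasurePreserving (fun z : S × Matrix (Fin n) (Fin p) ℝ =>
      (z.1, splitData split z.1 z.2)) ((μ.map U).prod (sampleLaw Om (Fin n)))
      ((μ.map U).prod (sampleLaw Om (Fin n))) :=
    (MeasurePreserving.id _).skew_product hm
      (ae_of_all _ fun u => (measurePreserving_submatrix (split u)).map_eq)
  exact h2.comp h1

/-- A bound on the expected loss that holds conditionally on the first half, for each choice of the
hyperparameters, holds when they are chosen with the first half. -/
lemma lintegral_chosen_loss_le {Ω S : Type*} [MeasurableSpace Ω] [MeasurableSpace S]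
    {μ : Measure Ω} [IsProbabilityMeasure μ] (hnp : 4 * p ≤ n) (hOm : Om.PosDef)
    {X : Ω → Matrix (Fin n) (Fin p) ℝ} (hX : IsGaussianSample μ Om X) {U : Ω → S}
    (hU : Measurable U) (hUX : IndepFun U X μ) {split : S → Equiv.Perm (Fin n)}
    (hsplit : ∀ π, MeasurableSet {u | split u = π}) {C : Set (Hyper p)} (hC : C.Finite)
    {sel : S → Matrix (Fin (n / 2)) (Fin p) ℝ → Hyper p}
    (hselm : ∀ h, MeasurableSet {z : S × Matrix (Fin (n / 2)) (Fin p) ℝ | sel z.1 z.2 = h})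
    (hsel : ∀ u X₁, sel u X₁ ∈ C) {L G : Hyper p → Matrix (Fin n) (Fin p) ℝ → ℝ≥0∞}
    (hG : ∀ h ∈ C, Measurable (G h))
    (hLG : ∀ h ∈ C, ∀ Y, Function.Injective (secondHalf Y).mulVec → L h Y ≤ G h Y) {r : ℝ≥0∞}
    (hr : ∀ h ∈ C, ∀ X₁, ∫⁻ X₂, G h (joinRows (splitEquiv n) X₁ X₂)
      ∂sampleLaw Om (Fin (n - n / 2)) ≤ r) :
    ∫⁻ ω, L (chosenHyper split sel (U ω) (X ω)) (splitData split (U ω) (X ω)) ∂μ ≤ r := by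
  have : IsProbabilityMeasure (μ.map U) := Measure.isProbabilityMeasure_map hU.aemeasurable
  have hselm' : ∀ h, MeasurableSet {z : S × Matrix (Fin n) (Fin p) ℝ |
      sel z.1 (firstHalf z.2) = h} := fun h =>
    (measurable_fst.prodMk (measurable_firstHalf.comp measurable_snd)) (hselm h)
  have hGsel : Measurable fun z : S × Matrix (Fin n) (Fin p) ℝ => G (sel z.1 (firstHalf z.2)) z.2 :=
    measurable_of_finite_choice hC
      (s := fun z : S × Matrix (Fin n) (Fin p) ℝ => sel z.1 (firstHalf z.2))
      (g := fun h (z : S × Matrix (Fin n) (Fin p) ℝ) => G h z.2) (fun z => hsel _ _) hselm'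
      fun h hh => (hG h hh).comp measurable_snd
  have hmp := measurePreserving_prodMk_splitData hX hU hUX hsplit
  have hsnd : MeasurePreserving Prod.snd ((μ.map U).prod (sampleLaw Om (Fin n)))
      (sampleLaw Om (Fin n)) := measurePreserving_snd
  have hgood : ∀ᵐ ω ∂μ,
      Function.Injective (secondHalf (splitData split (U ω) (X ω))).mulVec :=
    (hsnd.comp hmp).quasiMeasurePreserving.ae
      (measurePreserving_secondHalf.quasiMeasurePreserving.ae
        (ae_mulVec_injective hOm (by omega)))
  -- Measurability of `L` is not required: only its majorant `G` is integrated by Fubini.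
  have h1 : ∫⁻ ω, L (chosenHyper split sel (U ω) (X ω)) (splitData split (U ω) (X ω)) ∂μ ≤
      ∫⁻ ω, G (sel (U ω) (firstHalf (splitData split (U ω) (X ω))))
        (splitData split (U ω) (X ω)) ∂μ :=
    lintegral_mono_ae (hgood.mono fun ω hω => hLG _ (hsel _ _) _ hω)
  have h2 : ∫⁻ ω, G (sel (U ω) (firstHalf (splitData split (U ω) (X ω))))
        (splitData split (U ω) (X ω)) ∂μ =
      ∫⁻ u, ∫⁻ Y, G (sel u (firstHalf Y)) Y ∂sampleLaw Om (Fin n) ∂μ.map U := by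
    rw [← lintegral_prod _ hGsel.aemeasurable, ← hmp.lintegral_comp hGsel]
  have h3 : ∀ u, ∫⁻ Y, G (sel u (firstHalf Y)) Y ∂sampleLaw Om (Fin n) ≤ r := by
    intro u
    have hGu : Measurable fun Y => G (sel u (firstHalf Y)) Y :=
      hGsel.comp measurable_prodMk_left
    have hj := measurePreserving_joinRows (Om := Om) (splitEquiv n)
    have hprod := lintegral_prod (μ := sampleLaw Om (Fin (n / 2)))
      (ν := sampleLaw Om (Fin (n - n / 2)))
      (fun z => G (sel u (firstHalf (joinRows (splitEquiv n) z.1 z.2)))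
        (joinRows (splitEquiv n) z.1 z.2)) (hGu.comp hj.measurable).aemeasurable
    rw [← hj.lintegral_comp hGu, hprod]
    refine le_trans (b := ∫⁻ _, r ∂sampleLaw Om (Fin (n / 2))) (lintegral_mono fun X₁ => ?_) ?_
    -- With `u` and `X₁` fixed, the selected hyperparameters are constant in `X₂`.
    · simp only [firstHalf_joinRows]
      exact hr _ (hsel u X₁) X₁
    · simp
  rw [h2] at h1
  refine h1.trans ((lintegral_mono h3).trans ?_)
  simp

/-- Both error rates enter only through the pathwise bound `hL`. The statistics are replaced by
measurable versions that agree with them whenever the second half has full rank. -/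
theorem lintegral_recycling_loss_le {Ω S : Type*} [MeasurableSpace Ω] [MeasurableSpace S]
    {μ : Measure Ω} [IsProbabilityMeasure μ] (hnp : 4 * p ≤ n) (hOm : Om.PosDef)
    {X : Ω → Matrix (Fin n) (Fin p) ℝ} (hX : IsGaussianSample μ Om X) {U : Ω → S}
    (hU : Measurable U) (hUX : IndepFun U X μ) {split : S → Equiv.Perm (Fin n)}
    (hsplit : ∀ π, MeasurableSet {u | split u = π}) {C : Set (Hyper p)} (hC : C.Finite)
    (hCs : ∀ h ∈ C, HasSufficiency h.proc) (hCa : ∀ h ∈ C, HasAntisymmetry h.proc)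
    (hCac : ∀ h ∈ C, 0 < h.ac.1 ∧ 0 < h.ac.2 ∧ Layered h.ac.1 0 h.ac.2)
    {std : Bool} {K : OptStrategy → KnockoffRule p} (hK : ∀ o, IsKnockoffRule std o (K o))
    {q : ℝ} (hq : 0 ≤ q) {sel : S → Matrix (Fin (n / 2)) (Fin p) ℝ → Hyper p}
    (hselm : ∀ h, MeasurableSet {z : S × Matrix (Fin (n / 2)) (Fin p) ℝ | sel z.1 z.2 = h})
    (hsel : ∀ u X₁, sel u X₁ ∈ C) {L : Hyper p → Matrix (Fin n) (Fin p) ℝ → ℝ≥0∞}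
    (hL : ∀ h ∈ C, ∀ Y, L h Y ≤ ENNReal.ofReal (q / (h.ac.2 * p)) *
      ∑ i, maxRatio h.ac.1 (nullSet Om i) (statMatrix h.proc Y (recycledKnockoff (K h.opt) Y) i)) :
    ∫⁻ ω, L (chosenHyper split sel (U ω) (X ω)) (splitData split (U ω) (X ω)) ∂μ ≤
      ENNReal.ofReal q := by
  have hW : ∀ h : Hyper p, ∃ W : Matrix (Fin n) (Fin p) ℝ → Fin p → Fin p → ℝ, h ∈ C →
      (∀ i, Measurable fun X => W X i) ∧
      ∀ X i, IsUnit ((nodeDesign X i).transpose * nodeDesign X i).det →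
        IsKnockoff (nodeDesign X i) (recycledKnockoff (K h.opt) X i) →
        statMatrix h.proc X (recycledKnockoff (K h.opt) X) i = W X i := by
    intro h
    by_cases hh : h ∈ C
    · obtain ⟨W, hW⟩ := exists_measurable_statMatrix (hCs h hh)
        (Xt := recycledKnockoff (n := n) (K h.opt)) (measurable_recycledKnockoff (hK h.opt))
      exact ⟨W, fun _ => hW⟩
    · exact ⟨0, fun h => absurd h hh⟩
  choose W hW using hW
  refine lintegral_chosen_loss_le hnp hOm hX hU hUX hsplit hC hselm hsel (G := fun h Y =>
    ENNReal.ofReal (q / (h.ac.2 * p)) * ∑ i, maxRatio h.ac.1 (nullSet Om i) (W h Y i))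
    (fun h hh => (Finset.measurable_sum _ fun i _ =>
      (measurable_maxRatio _ _).comp ((hW h hh).1 i)).const_mul _) (fun h hh Y hY => ?_)
    fun h hh X₁ => ?_
  · refine (hL h hh Y).trans_eq ?_
    congr 1
    refine Finset.sum_congr rfl fun i _ => ?_
    obtain ⟨h1, -, h3⟩ := isKnockoff_recycledKnockoff (hK h.opt) hnp
      (nodeDesign_mulVec_injective hY i)
    rw [(hW h hh).2 Y i h1 h3]
  · obtain ⟨ha, hc, hlay⟩ := hCac h hh
    exact lintegral_sum_maxRatio_recycled (hK h.opt) hnp hOm (hCs h hh) (hCa h hh) ha hc hq hlay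
      (hW h hh).1 (hW h hh).2 X₁

lemma mem_nullSet_of_mem_falseEdges (hOm : Om.PosDef) {E : Finset (Fin p × Fin p)}
    (hE : ∀ e ∈ E, e.1 < e.2) {e : Fin p × Fin p} (he : e ∈ falseEdges Om E) :
    e.2 ∈ nullSet Om e.1 ∧ e.1 ∈ nullSet Om e.2 := by
  simp only [falseEdges, Finset.mem_filter] at he
  obtain ⟨h1, h2⟩ := he
  have hlt := hE e h1
  have h0 := precision_eq_zero_of_not_isEdge hOm hlt.ne h2
  have h0' : Om e.2 e.1 = 0 := by
    rw [← h0]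
    simpa using hOm.isHermitian.apply e.1 e.2
  exact ⟨Finset.mem_filter.2 ⟨Finset.mem_univ _, hlt.ne', h0⟩,
    Finset.mem_filter.2 ⟨Finset.mem_univ _, hlt.ne, h0'⟩⟩

lemma falseEdges_subset (E : Finset (Fin p × Fin p)) : falseEdges Om E ⊆ E := fun e he => by
  simp only [falseEdges, Finset.mem_filter] at he
  exact he.1

lemma lt_of_mem_estEdges {r : EdgeRule} {W : Fin p → Fin p → ℝ} {T : Fin p → EReal}
    {e : Fin p × Fin p} (he : e ∈ estEdges r W T) : e.1 < e.2 := by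
  simp only [estEdges, edgesOf, Finset.mem_filter] at he
  exact he.2.1

end Law

lemma layered_of_mem {A : Set (ℝ × ℝ)} (hA : A ⊆ {((1 : ℝ), (1.93 : ℝ)), ((0.01 : ℝ), (102 : ℝ))})
    {ac : ℝ × ℝ} (h : ac ∈ A) : 0 < ac.1 ∧ 0 < ac.2 ∧ Layered ac.1 0 ac.2 := by
  rcases hA h with rfl | rfl
  · exact ⟨by norm_num, by norm_num, layered_one⟩
  · exact ⟨by norm_num, by norm_num, layered_centi⟩

end GGMKnockoff

theorem theorem3
    {Ω : Type*} [MeasurableSpace Ω] (μ : MeasureTheory.Measure Ω)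
    [MeasureTheory.IsProbabilityMeasure μ]
    {S : Type*} [MeasurableSpace S]
    (n p : ℕ) (hnp : 4 * p ≤ n)
    (Om : Matrix (Fin p) (Fin p) ℝ) (hOm : Om.PosDef)
    (X : Ω → Matrix (Fin n) (Fin p) ℝ) (hX : GGMKnockoff.IsGaussianSample μ Om X)
    -- auxiliary randomness (splitting, tie-breaking), independent of the data
    (U : Ω → S) (hU : Measurable U) (hUX : ProbabilityTheory.IndepFun U X μ)
    (split : S → Equiv.Perm (Fin n)) (hsplit : ∀ π, MeasurableSet {u | split u = π})
    -- hyperparameter space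
    (A : Set (ℝ × ℝ)) (hA : A ⊆ {((1 : ℝ), (1.93 : ℝ)), ((0.01 : ℝ), (102 : ℝ))})
    (Os : Set GGMKnockoff.OptStrategy) (Rs : Set GGMKnockoff.EdgeRule)
    (Ps : Set (GGMKnockoff.FeatureProcedure p)) (hPs : Ps.Finite)
    (hsuff : ∀ P ∈ Ps, GGMKnockoff.HasSufficiency P)
    (hanti : ∀ P ∈ Ps, GGMKnockoff.HasAntisymmetry P)
    -- knockoff constructions, on raw or on standardized designs
    (std : Bool) (K : GGMKnockoff.OptStrategy → GGMKnockoff.KnockoffRule p)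
    (hK : ∀ o, GGMKnockoff.IsKnockoffRule std o (K o))
    (q : ℝ) (hq : q ∈ Set.Icc (0 : ℝ) 1) :
    (∀ sel : S → Matrix (Fin (n / 2)) (Fin p) ℝ → GGMKnockoff.Hyper p,
      GGMKnockoff.IsSelection (GGMKnockoff.candidates A Os Ps Rs) K q 1 sel →
      GGMKnockoff.FDR μ Om
          (fun ω => GGMKnockoff.recyclingProcedure K q 1 split sel (U ω) (X ω))
        ≤ ENNReal.ofReal q) ∧
    (∀ sel : S → Matrix (Fin (n / 2)) (Fin p) ℝ → GGMKnockoff.Hyper p,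
      GGMKnockoff.IsSelection (GGMKnockoff.candidates A Os Ps Rs) K q 0 sel →
      GGMKnockoff.mFDRre μ Om q
          (fun ω => GGMKnockoff.chosenHyper split sel (U ω) (X ω))
          (fun ω => GGMKnockoff.recyclingProcedure K q 0 split sel (U ω) (X ω))
        ≤ ENNReal.ofReal q) := by
  have hC := GGMKnockoff.finite_candidates (((Set.finite_singleton _).insert _).subset hA) Os hPs Rs
  have hCac : ∀ h ∈ GGMKnockoff.candidates A Os Ps Rs,
      0 < h.ac.1 ∧ 0 < h.ac.2 ∧ GGMKnockoff.Layered h.ac.1 0 h.ac.2 :=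
    fun h hh => GGMKnockoff.layered_of_mem hA hh.1
  refine ⟨fun sel hsel => ?_, fun sel hsel => ?_⟩
  · exact GGMKnockoff.lintegral_recycling_loss_le hnp hOm hX hU hUX hsplit hC
      (fun h hh => hsuff _ hh.2.2.1) (fun h hh => hanti _ hh.2.2.1) hCac hK hq.1 hsel.measurable
      hsel.mem
      (L := fun h Y => ((GGMKnockoff.falseEdges Om (GGMKnockoff.recycledFilter K q 1 h Y)).card :
        ENNReal) / max ((GGMKnockoff.recycledFilter K q 1 h Y).card : ENNReal) 1)
      fun h hh Y => GGMKnockoff.fdp_le_sum_maxRatio (hCac h hh).1 (hCac h hh).2.1 hq.1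
        (GGMKnockoff.falseEdges_subset _) fun e he => GGMKnockoff.mem_nullSet_of_mem_falseEdges hOm
          (fun _ => GGMKnockoff.lt_of_mem_estEdges) he
  · exact GGMKnockoff.lintegral_recycling_loss_le hnp hOm hX hU hUX hsplit hC
      (fun h hh => hsuff _ hh.2.2.1) (fun h hh => hanti _ hh.2.2.1) hCac hK hq.1 hsel.measurable
      hsel.mem
      (L := fun h Y => ((GGMKnockoff.falseEdges Om (GGMKnockoff.recycledFilter K q 0 h Y)).card :
        ENNReal) / ((GGMKnockoff.recycledFilter K q 0 h Y).card + GGMKnockoff.mFDROffset q h))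
      fun h hh Y => GGMKnockoff.mfdp_le_sum_maxRatio (hCac h hh).1 (hCac h hh).2.1 hq.1
        (GGMKnockoff.falseEdges_subset _) (fun e he => GGMKnockoff.mem_nullSet_of_mem_falseEdges hOm
          (fun _ => GGMKnockoff.lt_of_mem_estEdges) he) rfl rfl
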